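/- **Setting.** Fix $c>1$, put $\gamma^*=1-1/c^2$, and fix $\kappa\in\bigl(\sqrt{\gamma^{*2}/(1+\gamma^{*2})},\,1\bigr)$. For $d\to\infty$ let $n=n(d)\ge 1$ be integers with $\log n=o(d)$ (sparse data, $n=2^{o(d)}$) and $\log d=o(\log n)$ (so $d^{O(1)}=n^{o(1)}$). Let $C(a)$ be the relative volume of a spherical cap $\{u\in S^{d-1}: u_1\ge a\}$, let $\mu=\mu(d)$ satisfy $n=1/C(\mu)$ for all large $d$, and let $\alpha=\kappa\mu$. *Random instance.* Let $q\in S^{d-1}$ be any query. The data set $\mathcal D$ consists of $n$ independent random points of $S^{d-1}$: a planted neighbor $p^*$ (with any fixed label), uniform on $\{u\in S^{d-1}:\langle u,q\rangle=\gamma^*\}$, and $n-1$ points that are uniform on $S^{d-1}$. *Data structure.* The $\alpha$-near neighbor graph on $\mathcal D$ joins $p\ne p'$ when $\langle p,p'\rangle\ge\alpha$. The neighbors of each $p$ are kept in a bucket $\mathcal B(p)$, stored as a binary search tree on labels. - *Insert* compares the new point with all points of $\mathcal D$ and adds the edges found to both buckets. The structure is built by successive insertions. - *Delete* of $p$ removes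 $p$ from the buckets of all its neighbors and empties $\mathcal B(p)$. - *Query* starts at a uniformly random $p\in\mathcal D$. While $\langle p,q\rangle<\gamma^*$, it runs through the bucket of the current point and replaces the current point $p$ by a scanned $p'$ whenever $\langle p',q\rangle\ge\langle p,q\rangle+1/d$. If no replacement occurs in such a run, it starts over at a fresh uniformly random point of $\mathcal D$. When the loop ends it returns $p$. Costs count arithmetic operations and comparisons on numbers, memory accesses and visited tree nodes (an inner product costs $2d$). Space counts memory words. **Theorem (complexities for sparse data / for succeeding in many iterations).** For every $\varepsilon>0$, with probability tending to $1$ as $d\to\infty$ (over $\mathcal D$ and the random choices of the query), the structure stores the $\alpha$-near neighbor graph of $\mathcal D$, and all of the following hold: - Query returns $p^*$ in time at most $n^{\rho_q+\varepsilon}$, where $\rho_q=\dfrac{1-2\gamma^*\sqrt{\kappa^2(1-\kappa^2)}}{1-\gamma^{*2}}$; - the space lies between $n^{2-\kappa^2-\varepsilon}$ and $n^{2-\kappa^2+\varepsilon}$; - for every unit vector $p$, inserting $p$ yields the graph of $\mathcal D\cup\{p\}$ (with $p$ under a new label), at a cost between $n^{1-\varepsilon}$ and $n^{1+\varepsilon}$;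 - for every $p\in\mathcal D$, deleting $p$ yields the graph of $\mathcal D\setminus\{p\}$, at a cost between $n^{1-\kappa^2-\varepsilon}$ and $n^{1-\kappa^2+\varepsilon}$. In other words, query time at most $n^{\rho_q+o(1)}$, space $n^{2-\kappa^2+o(1)}$, insertion $n^{1+o(1)}$, deletion $n^{1-\kappa^2+o(1)}$. Moreover, write the space as $n^{1+\rho_s+o(1)}$, i.e. $\rho_s=1-\kappa^2$. Then the exponent $\rho_q$ above satisfies the trade-off inequality $$(2c^2-1)\rho_q+2c^2(c^2-1)\sqrt{\rho_s(1-\rho_s)}\ \ge\ c^4$$ with equality. Conversely, for $\rho_s=1-\kappa^2$ and every real $\rho_q$ that satisfies this inequality, for every $\varepsilon>0$, with probability tending to $1$, Query returns $p^*$ in time at most $n^{\rho_q+\varepsilon}$ and the space is at most $n^{1+\rho_s+\varepsilon}$. -/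

import Mathlib

open MeasureTheory ProbabilityTheory Filter Topology Asymptotics
open scoped RealInnerProductSpace

noncomputable section

namespace NNG

/-! ### Geometry of the sphere and random instances -/

/-- Euclidean space of dimension `d`. -/
abbrev E (d : ℕ) : Type := EuclideanSpace ℝ (Fin d)

/-- The uniform distribution on the unit sphere, as a law on the ambient space: the surface
measure, normalized to total mass one. -/
def sphereLaw (d : ℕ) : Measure (E d) :=
  (((volume : Measure (E d)).toSphere Set.univ)⁻¹ • (volume : Measure (E d)).toSphere).map
    (fun x : Metric.sphere (0 : E d) 1 => (x : E d))

/-- `C(a)`: relative volume of a spherical cap of height `a`, i.e. the probability that the first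
coordinate of a uniformly random point of the sphere is at least `a`. -/
def capVolume (d : ℕ) (a : ℝ) : ℝ :=
  (sphereLaw d).real {x | ∃ h : 0 < d, a ≤ x ⟨0, h⟩}

/-- The unit vector in the direction of the component of `x` orthogonal to the unit vector `q`. -/
def orthDir {d : ℕ} (q x : E d) : E d :=
  ‖x - ⟪x, q⟫ • q‖⁻¹ • (x - ⟪x, q⟫ • q)

/-- Law of the planted neighbor: the uniform distribution on the unit vectors whose inner product
with the unit vector `q` is `γ`. Such a vector is `γ q + √(1 - γ²) u` with `u` uniform on the unit
sphere of the hyperplane orthogonal to `q`. -/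
def plantedLaw {d : ℕ} (q : E d) (γ : ℝ) : Measure (E d) :=
  (sphereLaw d).map (fun x => γ • q + √(1 - γ ^ 2) • orthDir q x)

/-- Law of the data set: independent points, uniform on the sphere, except for the planted neighbor
of `q`, which has label `star`. -/
def dataLaw {d n : ℕ} (star : Fin n) (q : E d) (γ : ℝ) : Measure (Fin n → E d) :=
  Measure.pi fun i => if i = star then plantedLaw q γ else sphereLaw d

/-- Law of the random choices of the query algorithm: independent uniform labels. -/
def startLaw (n : ℕ) [NeZero n] : Measure (ℕ → Fin n) :=
  Measure.infinitePi fun _ : ℕ => (PMF.uniformOfFintype (Fin n)).toMeasure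

/-- Joint law of the data set and of the (independent) random choices of the query algorithm. -/
def instanceLaw {d n : ℕ} [NeZero n] (star : Fin n) (q : E d) (γ : ℝ) :
    Measure ((Fin n → E d) × (ℕ → Fin n)) :=
  (dataLaw star q γ).prod (startLaw n)

/-- The `α`-near neighbor graph of the labelled points `x`. -/
def nnGraph {d : ℕ} (α : ℝ) (x : ℕ → E d) : SimpleGraph ℕ where
  Adj i j := i ≠ j ∧ α ≤ ⟪x i, x j⟫
  symm := ⟨fun i j h => ⟨h.1.symm, by rw [real_inner_comm]; exact h.2⟩⟩
  loopless := ⟨fun _ h => h.1 rfl⟩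

/-! ### Programs with a step count

Unit cost: one arithmetic operation or comparison on numbers, one memory access, or one visit of a
node of a search tree. -/

/-- The value of a computation together with the number of steps that it has taken. -/
structure Ticked (A : Type) where
  val : A
  cost : ℕ

instance : Monad Ticked where
  pure a := ⟨a, 0⟩
  bind m f := ⟨(f m.val).val, m.cost + (f m.val).cost⟩

/-- Spend `k` steps. -/
def tick (k : ℕ) : Ticked Unit := ⟨(), k⟩

/-- Inner product of two `d`-dimensional vectors: `d` multiplications and `d` additions. -/
def innerT {d : ℕ} (x y : E d) : Ticked ℝ := ⟨⟪x, y⟫, 2 * d⟩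

/-! ### Buckets: binary search trees, branching on the binary digits of the label -/

/-- A search tree; `node a l r` carries the label `a` if there is one. -/
inductive SearchTree where
  | nil : SearchTree
  | node (key : Option ℕ) (l r : SearchTree) : SearchTree

namespace SearchTree

/-- Number of nodes. -/
def nodes : SearchTree → ℕ
  | nil => 0
  | node _ l r => 1 + l.nodes + r.nodes

/-- Node constructor that frees a node which carries nothing. -/
def mk : Option ℕ → SearchTree → SearchTree → SearchTree
  | none, nil, nil => nil
  | a, l, r => node a l r

/-- Store `k` at the given path. -/
def insertAt (k : ℕ) : List Bool → SearchTree → Ticked SearchTree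
  | [], nil => do
      tick 1
      pure (node (some k) nil nil)
  | [], node _ l r => do
      tick 1
      pure (node (some k) l r)
  | b :: bs, nil => do
      tick 1
      let t ← insertAt k bs nil
      pure (if b then node none nil t else node none t nil)
  | true :: bs, node a l r => do
      tick 1
      let t ← insertAt k bs r
      pure (node a l t)
  | false :: bs, node a l r => do
      tick 1
      let t ← insertAt k bs l
      pure (node a t r)

/-- Remove what is stored at the given path. -/
def eraseAt : List Bool → SearchTree → Ticked SearchTree
  | _, nil => do
      tick 1
      pure nil
  | [], node _ l r => do
      tick 1
      pure (mk none l r)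
  | true :: bs, node a l r => do
      tick 1
      let t ← eraseAt bs r
      pure (mk a l t)
  | false :: bs, node a l r => do
      tick 1
      let t ← eraseAt bs l
      pure (mk a t r)

/-- Add the label `k`. -/
def insert (k : ℕ) (t : SearchTree) : Ticked SearchTree := insertAt k k.bits t

/-- Remove the label `k`. -/
def erase (k : ℕ) (t : SearchTree) : Ticked SearchTree := eraseAt k.bits t

/-- Traversal: put the labels of the tree in front of the list `acc`. -/
def keysAux : SearchTree → List ℕ → Ticked (List ℕ)
  | nil, acc => do
      tick 1
      pure acc
  | node a l r, acc => do
      tick 1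
      let acc₁ ← keysAux r acc
      let acc₂ ← keysAux l acc₁
      pure (a.toList ++ acc₂)

/-- List the labels of the tree. -/
def keys (t : SearchTree) : Ticked (List ℕ) := keysAux t []

end SearchTree

/-! ### The data structure -/

/-- Memory: arrays, indexed by labels, of points and of buckets. The labels below `size` have been
handed out; a label is `live` if its point belongs to the data set at present. -/
structure Store (d : ℕ) where
  size : ℕ
  live : ℕ → Bool
  pt : ℕ → E d
  bucket : ℕ → SearchTree

namespace Store

variable {d : ℕ}

/-- The empty data structure. -/
def empty (d : ℕ) : Store d := ⟨0, fun _ => false, fun _ => 0, fun _ => SearchTree.nil⟩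

/-- Number of memory words in use: for each label the coordinates of its point, the flag `live` and
a pointer to its bucket; for each node of a bucket the label and two pointers. -/
def space (S : Store d) : ℕ :=
  ∑ i ∈ Finset.range S.size, (d + 2 + 3 * (S.bucket i).nodes)

/-- `S` stores the `α`-near neighbor graph of the points `x i` with labels `i ∈ V`. -/
def Represents (S : Store d) (α : ℝ) (V : Finset ℕ) (x : ℕ → E d) : Prop :=
  (∀ i, S.live i = true ↔ i ∈ V) ∧
  (∀ i ∈ V, S.pt i = x i) ∧
  ∀ i ∈ V, (S.bucket i).keys.val.Nodup ∧
    ∀ j, j ∈ (S.bucket i).keys.val ↔ j ∈ V ∧ (nnGraph α x).Adj i j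

/-- The loop of the insertion of `p` with label `new`: for each `p'` in the data set, if
`⟪p, p'⟫ ≥ α`, add `p'` to the bucket of `p` and `p` to the bucket of `p'`. -/
def insertLoop (α : ℝ) (p : E d) (new : ℕ) (S : Store d) :
    List ℕ → (ℕ → SearchTree) → Ticked (ℕ → SearchTree)
  | [], B => pure B
  | j :: js, B => do
      tick 1
      if S.live j then do
        let a ← innerT p (S.pt j)
        tick 1
        if α ≤ a then do
          let t ← (B new).insert j
          tick 1
          let B₁ := Function.update B new t
          let t' ← (B₁ j).insert new
          tick 1
          insertLoop α p new S js (Function.update B₁ j t')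
        else insertLoop α p new S js B
      else insertLoop α p new S js B

/-- Insertion of the point `p`, under a fresh label. -/
def insert (α : ℝ) (p : E d) (S : Store d) : Ticked (Store d) := do
  tick (d + 3)
  let B ← insertLoop α p S.size S (List.range S.size)
    (Function.update S.bucket S.size SearchTree.nil)
  pure { size := S.size + 1
         live := Function.update S.live S.size true
         pt := Function.update S.pt S.size p
         bucket := B }

/-- The loop of the deletion of the label `j`: remove `j` from each bucket in a list. -/
def deleteLoop (j : ℕ) : List ℕ → (ℕ → SearchTree) → Ticked (ℕ → SearchTree)
  | [], B => pure B
  | k :: ks, B => do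
      let t ← (B k).erase j
      tick 1
      deleteLoop j ks (Function.update B k t)

/-- Deletion of the point with label `j`. -/
def delete (j : ℕ) (S : Store d) : Ticked (Store d) := do
  let nb ← (S.bucket j).keys
  let B ← deleteLoop j nb S.bucket
  tick 2
  pure { S with
    live := Function.update S.live j false
    bucket := Function.update B j SearchTree.nil }

/-- The data structure of a list of points, built by successive insertions. -/
def build (α : ℝ) {n : ℕ} (x : Fin n → E d) : Store d :=
  (List.ofFn x).foldl (fun S p => (S.insert α p).val) (empty d)

/-- The inner loop of a query: go through the neighbors in the list, and move to a neighbor whenever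
its inner product with `q` exceeds that of the current point by at least `1 / d`. The state is the
current label and the flag that tells if there has been progress. -/
def scan (S : Store d) (q : E d) : List ℕ → ℕ × Bool → Ticked (ℕ × Bool)
  | [], s => pure s
  | j :: js, s => do
      let a ← innerT (S.pt j) q
      let b ← innerT (S.pt s.1) q
      tick 2
      if b + 1 / (d : ℝ) ≤ a then scan S q js (j, true) else scan S q js s

/-- The outer loop of a query, cut off after `fuel` rounds: `p` is the label of the current point,
`ω` lists the random labels, and `k` of them have been used. The result is `none` if the loop
was cut off. -/
def queryLoop (S : Store d) (q : E d) (γ : ℝ) (ω : ℕ → ℕ) : ℕ → ℕ → ℕ → Ticked (Option ℕ)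
  | 0, _, _ => pure none
  | fuel + 1, p, k => do
      let a ← innerT (S.pt p) q
      tick 1
      if γ ≤ a then pure (some p)
      else do
        let nb ← (S.bucket p).keys
        let s ← scan S q nb (p, false)
        if s.2 then queryLoop S q γ ω fuel s.1 k
        else do
          tick 1
          queryLoop S q γ ω fuel (ω k) (k + 1)

/-- Query: start at a random point, and start over at a random point if there is no progress. -/
def query (S : Store d) (q : E d) (γ : ℝ) (ω : ℕ → ℕ) (fuel : ℕ) : Ticked (Option ℕ) := do
  tick 1
  queryLoop S q γ ω fuel (ω 0) 1

/-- With random labels `ω`, the query stops after at most `T` steps and returns the label `r`. -/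
def QueryReturns (S : Store d) (q : E d) (γ : ℝ) (ω : ℕ → ℕ) (r : ℕ) (T : ℝ) : Prop :=
  ∃ fuel, (S.query q γ ω fuel).val = some r ∧ ((S.query q γ ω fuel).cost : ℝ) ≤ T

end Store

/-- The points `x 0, …, x (n - 1)` as a family indexed by all labels. -/
def labelled {d n : ℕ} (x : Fin n → E d) (i : ℕ) : E d :=
  if h : i < n then x ⟨i, h⟩ else 0

end NNG

end

namespace NNG

/-! ### Programs with a step count -/

/-! Volumes. For heights `a` that are small but large against `1/√d`, a cap has relative volume
`exp(-(1+o(1)) d a²/2)`. Hence `n = 1/C(μ)` forces `log n = (1+o(1)) d μ²/2`. Caps of height `tμ`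
then have volume `n^(-t²+o(1))`, and intersections of caps of heights `sμ`, `tμ` in orthogonal
directions have volume `n^(-(s²+t²)+o(1))` (`Sparse.cap_le`, `Sparse.le_wedge`, `Sparse.wedge_le`).
Chernoff bounds and a union bound give every vertex degree `n^(1-κ²+o(1))` (`deg_tail`). Space,
insertion and deletion follow by counting steps, since factors `d` and `log n` are `n^o(1)`.

Queries. All points except the planted one have inner product with `q` below a constant `η < γ`, so
the loop can only end at the planted point. Every move gains at least `1/d`, so an attempt has at
most `2d+1` rounds (`QueryHyp.attempt`) and costs `n^(1-κ²+o(1))`. If a fraction `n^(-θ)` of the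
starts is sure to succeed, about `n^θ` attempts suffice, and the query exponent is `θ + 1 - κ²`
(`Sparse.tendsto_outcome`).

Good starts. Take `b` slightly above `√(1-κ²)`. The neighbors `j` of the planted point with `⟪j, q⟫
≥ bμ` lie in a wedge of volume `n^(-r)`, where `r = b² + (κ-γb)²/(1-γ²)`. There are about `n^(1-r)`
of them, each with about `n^(1-κ²)` neighbors `s`. For most such `s`, no other neighbor comes near
level `bμ`, since the expected number of those is `n^(1-κ²-b²) = o(1)`. A run through the bucket of
`s` therefore ends at `j` (or directly at the planted point), and the bucket of `j` contains the
planted point. So `θ = r - 1 + κ²`, and the query exponent is `r`, which tends to `ρ_q` as `b`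
decreases to `√(1-κ²)`. The lower bound on `κ` says precisely that `γ√(1-κ²) < κ`, which makes the
wedge formula valid.

The count of good starts takes all edges from such `j` and subtracts bad pairs and triples
(`card_second_starts`). The number of `j` is bounded below by Chernoff, the number of bad
configurations above by Markov (`few_secondStart_le`). This needs `r < 1`. If `ρ_q ≥ 1`, the direct
neighbors of the planted point suffice as starts: `θ = κ²` gives exponent `1`.

The trade-off is algebra from `γc² = c² - 1`. -/

@[simp] lemma Ticked.pure_val {A : Type} (a : A) : (pure a : Ticked A).val = a := rfl
@[simp] lemma Ticked.pure_cost {A : Type} (a : A) : (pure a : Ticked A).cost = 0 := rfl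
@[simp] lemma Ticked.bind_val {A B : Type} (m : Ticked A) (f : A → Ticked B) :
    (m >>= f).val = (f m.val).val := rfl
@[simp] lemma Ticked.bind_cost {A B : Type} (m : Ticked A) (f : A → Ticked B) :
    (m >>= f).cost = m.cost + (f m.val).cost := rfl
@[simp] lemma tick_cost (k : ℕ) : (tick k).cost = k := rfl
@[simp] lemma innerT_val {d : ℕ} (x y : E d) : (innerT x y).val = ⟪x, y⟫ := rfl
@[simp] lemma innerT_cost {d : ℕ} (x y : E d) : (innerT x y).cost = 2 * d := rfl

/-! ### Search trees -/

namespace SearchTree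

/-- The labels of a tree in the order of traversal. -/
def klist : SearchTree → List ℕ
  | nil => []
  | node a l r => a.toList ++ (klist l ++ klist r)

lemma keysAux_val (t : SearchTree) (acc : List ℕ) : (t.keysAux acc).val = t.klist ++ acc := by
  induction t generalizing acc with
  | nil => rfl
  | node a l r hl hr => simp [keysAux, klist, hl, hr]

lemma keysAux_cost (t : SearchTree) (acc : List ℕ) : (t.keysAux acc).cost = 2 * t.nodes + 1 := by
  induction t generalizing acc with
  | nil => rfl
  | node a l r hl hr => simp [keysAux, nodes, hl, hr]; ring

lemma keys_val (t : SearchTree) : t.keys.val = t.klist := by simp [keys, keysAux_val]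

lemma keys_cost (t : SearchTree) : t.keys.cost = 2 * t.nodes + 1 := keysAux_cost t []

lemma length_klist_le (t : SearchTree) : t.klist.length ≤ t.nodes := by
  induction t with
  | nil => simp [klist, nodes]
  | node a l r hl hr =>
    cases a <;> simp [klist, nodes] <;> omega

/-- In the subtree at path `pre`, each label is stored at the place given by its binary digits. -/
def Ok : List Bool → SearchTree → Prop
  | _, nil => True
  | pre, node a l r => (∀ k ∈ a, k.bits = pre) ∧ Ok (pre ++ [false]) l ∧ Ok (pre ++ [true]) r

/-- Membership in a subtree fixes a prefix of the binary digits. A label is thereby excluded from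
every subtree off its own path, and from all subtrees below its own node. -/
lemma Ok.exists_bits {pre : List Bool} {t : SearchTree} (h : Ok pre t) {k : ℕ} (hk : k ∈ t.klist) :
    ∃ bs, k.bits = pre ++ bs := by
  induction t generalizing pre with
  | nil => simp [klist] at hk
  | node a l r hl hr =>
    obtain ⟨h1, h2, h3⟩ := h
    simp only [klist, List.mem_append, Option.mem_toList] at hk
    rcases hk with hk | hk | hk
    · exact ⟨[], by simpa using h1 k hk⟩
    · obtain ⟨bs, hb⟩ := hl h2 hk
      exact ⟨false :: bs, by simpa using hb⟩
    · obtain ⟨bs, hb⟩ := hr h3 hk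
      exact ⟨true :: bs, by simpa using hb⟩

lemma bits_injective : Function.Injective Nat.bits := by
  intro a b h
  have := (Nat.digits_two_eq_bits a).trans ((congrArg _ h).trans (Nat.digits_two_eq_bits b).symm)
  exact Nat.digits_inj_iff.1 this

lemma insertAt_cost (k : ℕ) (bs : List Bool) (t : SearchTree) :
    (insertAt k bs t).cost = bs.length + 1 := by
  induction bs generalizing t with
  | nil => cases t <;> rfl
  | cons b bs ih =>
    cases t with
    | nil => simp [insertAt, ih]; ring
    | node a l r => cases b <;> simp [insertAt, ih] <;> ring

/-- A label can occur only at its own path, so it is either already there and the tree is unchanged,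
or it is new. In the second case at most one node per remaining digit is created, plus one for the
end of the path; this yields the bound on nodes in `Good`. -/
lemma insertAt_spec (k : ℕ) (bs : List Bool) (t : SearchTree) (pre : List Bool)
    (hk : k.bits = pre ++ bs) (h : Ok pre t) :
    Ok pre (insertAt k bs t).val ∧
      ((k ∈ t.klist ∧ (insertAt k bs t).val = t) ∨
        (k ∉ t.klist ∧ (insertAt k bs t).val.klist.Perm (k :: t.klist) ∧
          (insertAt k bs t).val.nodes ≤ t.nodes + (bs.length + 1))) := by
  induction bs generalizing t pre with
  | nil =>
    cases t with
    | nil => simp [insertAt, Ok, klist, nodes, hk]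
    | node a l r =>
      obtain ⟨h1, h2, h3⟩ := h
      simp only [List.append_nil] at hk
      cases a with
      | none =>
        have hl : k ∉ l.klist := fun h => by
          obtain ⟨bs, hb⟩ := h2.exists_bits h
          simp [hk] at hb
        have hr : k ∉ r.klist := fun h => by
          obtain ⟨bs, hb⟩ := h3.exists_bits h
          simp [hk] at hb
        refine ⟨⟨by simp [hk], h2, h3⟩, Or.inr ?_⟩
        simp [insertAt, klist, nodes, hl, hr]
      | some a =>
        have : k = a := bits_injective (hk.trans (h1 a rfl).symm)
        subst this
        exact ⟨⟨by simp [hk], h2, h3⟩, Or.inl (by simp [insertAt, klist])⟩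
  | cons b bs ih =>
    cases t with
    | nil =>
      obtain ⟨ho, h'⟩ := ih nil (pre ++ [b]) (by simpa using hk) trivial
      rcases h' with h' | h'
      · simp [klist] at h'
      · cases b <;> simp_all [insertAt, Ok, klist, nodes] <;> omega
    | node a l r =>
      obtain ⟨h1, h2, h3⟩ := h
      have ha : k ∉ a.toList := fun h => by
        have := h1 k (by simpa using h)
        simp [this] at hk
      cases b with
      | false =>
        have hr : k ∉ r.klist := fun h => by
          obtain ⟨bs, hb⟩ := h3.exists_bits h
          simp [hk] at hb
        obtain ⟨ho, h'⟩ := ih l (pre ++ [false]) (by simpa using hk) h2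
        refine ⟨⟨h1, ho, h3⟩, ?_⟩
        rcases h' with ⟨h', h''⟩ | ⟨h', hp, hn⟩
        · exact Or.inl ⟨by simp [klist, h'], by simp [insertAt, h'']⟩
        · refine Or.inr ⟨by simp_all [klist], ?_, ?_⟩
          · simp only [insertAt, klist, Ticked.bind_val, Ticked.pure_val]
            refine (List.Perm.append_left _ (List.Perm.append_right _ hp)).trans ?_
            simp
          · simp [insertAt, nodes]; omega
      | true =>
        have hr : k ∉ l.klist := fun h => by
          obtain ⟨bs, hb⟩ := h2.exists_bits h
          simp [hk] at hb
        obtain ⟨ho, h'⟩ := ih r (pre ++ [true]) (by simpa using hk) h3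
        refine ⟨⟨h1, h2, ho⟩, ?_⟩
        rcases h' with ⟨h', h''⟩ | ⟨h', hp, hn⟩
        · exact Or.inl ⟨by simp [klist, h'], by simp [insertAt, h'']⟩
        · refine Or.inr ⟨by simp_all [klist], ?_, ?_⟩
          · simp only [insertAt, klist, Ticked.bind_val, Ticked.pure_val]
            refine (List.Perm.append_left _ (List.Perm.append_left _ hp)).trans ?_
            simpa using List.perm_middle (l₁ := a.toList ++ l.klist)
          · simp [insertAt, nodes]; omega

lemma eraseAt_cost (bs : List Bool) (t : SearchTree) :
    1 ≤ (eraseAt bs t).cost ∧ (eraseAt bs t).cost ≤ bs.length + 1 := by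
  induction bs generalizing t with
  | nil => cases t <;> simp [eraseAt]
  | cons b bs ih =>
    cases t with
    | nil => simp [eraseAt]
    | node a l r =>
      have hl := ih l
      have hr := ih r
      cases b <;> simp [eraseAt] <;> omega

lemma klist_mk (a : Option ℕ) (l r : SearchTree) : (mk a l r).klist = (node a l r).klist := by
  rcases a with _ | a <;> rcases l with _ | _ <;> rcases r with _ | _ <;> rfl

lemma Ok.mk {pre : List Bool} {a : Option ℕ} {l r : SearchTree} (h : Ok pre (node a l r)) :
    Ok pre (mk a l r) := by
  rcases a with _ | a <;> rcases l with _ | _ <;> rcases r with _ | _ <;>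
    first | exact h | exact trivial

lemma filter_ne_eq_self {l : List ℕ} {k : ℕ} (h : k ∉ l) : l.filter (· ≠ k) = l := by
  rw [List.filter_eq_self]
  intro a ha
  simp only [decide_eq_true_eq]
  rintro rfl
  exact h ha

/-- Emptying the single place at the path of `k` removes every occurrence of `k`, because in an `Ok`
tree `k` cannot occur elsewhere. Freeing empty nodes by `mk` does not affect the list of labels. -/
lemma eraseAt_spec (k : ℕ) (bs : List Bool) (t : SearchTree) (pre : List Bool)
    (hk : k.bits = pre ++ bs) (h : Ok pre t) :
    Ok pre (eraseAt bs t).val ∧ (eraseAt bs t).val.klist = t.klist.filter (· ≠ k) := by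
  induction bs generalizing t pre with
  | nil =>
    cases t with
    | nil => simp [eraseAt, Ok, klist]
    | node a l r =>
      obtain ⟨h1, h2, h3⟩ := h
      simp only [List.append_nil] at hk
      have hl : k ∉ l.klist := fun h => by
        obtain ⟨bs, hb⟩ := h2.exists_bits h
        simp [hk] at hb
      have hr : k ∉ r.klist := fun h => by
        obtain ⟨bs, hb⟩ := h3.exists_bits h
        simp [hk] at hb
      refine ⟨Ok.mk ⟨by simp, h2, h3⟩, ?_⟩
      simp only [eraseAt, Ticked.bind_val, Ticked.pure_val, klist_mk, klist, List.filter_append,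
        filter_ne_eq_self hl, filter_ne_eq_self hr]
      cases a with
      | none => simp
      | some a =>
        have : k = a := bits_injective (hk.trans (h1 a rfl).symm)
        simp [this]
  | cons b bs ih =>
    cases t with
    | nil => simp [eraseAt, Ok, klist]
    | node a l r =>
      obtain ⟨h1, h2, h3⟩ := h
      have ha : k ∉ a.toList := fun h => by
        have := h1 k (by simpa using h)
        simp [this] at hk
      cases b with
      | false =>
        have hr : k ∉ r.klist := fun h => by
          obtain ⟨bs, hb⟩ := h3.exists_bits h
          simp [hk] at hb
        obtain ⟨ho, h'⟩ := ih l (pre ++ [false]) (by simpa using hk) h2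
        refine ⟨Ok.mk ⟨h1, ho, h3⟩, ?_⟩
        simp only [eraseAt, Ticked.bind_val, Ticked.pure_val, klist_mk, klist, List.filter_append,
          filter_ne_eq_self ha, filter_ne_eq_self hr, h']
      | true =>
        have hr : k ∉ l.klist := fun h => by
          obtain ⟨bs, hb⟩ := h2.exists_bits h
          simp [hk] at hb
        obtain ⟨ho, h'⟩ := ih r (pre ++ [true]) (by simpa using hk) h3
        refine ⟨Ok.mk ⟨h1, h2, ho⟩, ?_⟩
        simp only [eraseAt, Ticked.bind_val, Ticked.pure_val, klist_mk, klist, List.filter_append,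
          filter_ne_eq_self ha, filter_ne_eq_self hr, h']

lemma erase_cost (k : ℕ) (t : SearchTree) : 1 ≤ (t.erase k).cost ∧ (t.erase k).cost ≤ k.size + 1 := by
  rw [← Nat.size_eq_bits_len]
  exact eraseAt_cost k.bits t

lemma insert_cost (k : ℕ) (t : SearchTree) : (t.insert k).cost = k.size + 1 := by
  rw [← Nat.size_eq_bits_len]
  exact insertAt_cost k k.bits t

/-- Invariant of buckets: labels sit at their places, occur once, have at most `M` digits, and there
are at most `M + 1` nodes per label. -/
structure Good (M : ℕ) (t : SearchTree) : Prop where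
  ok : Ok [] t
  nodup : t.klist.Nodup
  nodes_le : t.nodes ≤ t.klist.length * (M + 1)

lemma good_nil (M : ℕ) : Good M nil := ⟨trivial, by simp [klist], by simp [nodes]⟩

lemma Good.insert {M k : ℕ} {t : SearchTree} (h : Good M t) (hk : k.size ≤ M) :
    Good M (t.insert k).val ∧ ∀ j, j ∈ (t.insert k).val.klist ↔ j = k ∨ j ∈ t.klist := by
  obtain ⟨ho, h' | ⟨h1, h2, h3⟩⟩ := insertAt_spec k k.bits t [] rfl h.ok
  · rw [SearchTree.insert, h'.2]
    refine ⟨h, fun j => ⟨Or.inr, ?_⟩⟩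
    rintro (rfl | hj)
    exacts [h'.1, hj]
  · refine ⟨⟨ho, ?_, ?_⟩, fun j => ?_⟩
    · exact h2.nodup_iff.2 (List.nodup_cons.2 ⟨h1, h.nodup⟩)
    · have := h.nodes_le
      have hl := h2.length_eq
      simp only [Nat.size_eq_bits_len, List.length_cons] at *
      rw [SearchTree.insert, hl]
      nlinarith
    · exact h2.mem_iff.trans List.mem_cons

end SearchTree

/-! ### Updates of the data structure -/

namespace Store

open SearchTree

variable {d : ℕ}

/-- Invariant of a store that was built by insertions: the labels are those below `m`, and the
buckets are the neighborhoods in the `α`-near neighbor graph. -/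
structure Inv (S : Store d) (α : ℝ) (x : ℕ → E d) (m M : ℕ) : Prop where
  size_eq : S.size = m
  live_iff : ∀ i, S.live i = true ↔ i < m
  pt_eq : ∀ i < m, S.pt i = x i
  good : ∀ i < m, SearchTree.Good M (S.bucket i)
  mem_iff : ∀ i < m, ∀ j, j ∈ (S.bucket i).klist ↔ j < m ∧ (nnGraph α x).Adj i j

/-- Each edge found is recorded at both ends; the two new alternatives for `j` belonging to bucket
`i` are these two ends. Every scanned label costs at least one step, hence the linear lower bound on
the cost even if no edges are found. -/
lemma insertLoop_spec (α : ℝ) (p : E d) (new M : ℕ) (S : Store d) (hM : new.size ≤ M)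
    (js : List ℕ) (B : ℕ → SearchTree) (hjs : ∀ j ∈ js, j < new)
    (hB : ∀ i ≤ new, SearchTree.Good M (B i)) :
    (∀ i ≤ new, SearchTree.Good M ((insertLoop α p new S js B).val i) ∧
      ∀ j, j ∈ ((insertLoop α p new S js B).val i).klist ↔ j ∈ (B i).klist ∨
        (i = new ∧ j ∈ js ∧ S.live j = true ∧ α ≤ ⟪p, S.pt j⟫) ∨
        (j = new ∧ i ∈ js ∧ S.live i = true ∧ α ≤ ⟪p, S.pt i⟫)) ∧
    js.length ≤ (insertLoop α p new S js B).cost ∧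
    (insertLoop α p new S js B).cost ≤ js.length * (2 * d + 2 * M + 6) := by
  induction js generalizing B with
  | nil => simp [insertLoop]; exact hB
  | cons a js ih =>
    have ha : a < new := hjs a (by simp)
    have hjs' : ∀ j ∈ js, j < new := fun j hj => hjs j (by simp [hj])
    by_cases hn : S.live a = true ∧ α ≤ ⟪p, S.pt a⟫
    · obtain ⟨hl, hα⟩ := hn
      have hMa : a.size ≤ M := (Nat.size_le_size ha.le).trans hM
      obtain ⟨g1, m1⟩ := (hB new le_rfl).insert hMa
      obtain ⟨g2, m2⟩ := (hB a ha.le).insert hM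
      -- The program reads bucket `a` only after bucket `new` has been updated; as `a < new`, it
      -- still sees the old bucket.
      have e : Function.update B new ((B new).insert a).val a = B a := by
        rw [Function.update_of_ne ha.ne]
      set B' := Function.update (Function.update B new ((B new).insert a).val) a
        ((B a).insert new).val with hB'
      have hB'a : B' a = ((B a).insert new).val := by simp [hB']
      have hB'n : B' new = ((B new).insert a).val := by
        rw [hB', Function.update_of_ne ha.ne', Function.update_self]
      have hB'i : ∀ i, i ≠ a → i ≠ new → B' i = B i := by
        intro i h1 h2
        rw [hB', Function.update_of_ne h1, Function.update_of_ne h2]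
      obtain ⟨h1, h2, h3⟩ := ih B' hjs' (by
        intro i hi
        by_cases h1 : i = a
        · rw [h1, hB'a]; exact g2
        by_cases h2 : i = new
        · rw [h2, hB'n]; exact g1
        rw [hB'i i h1 h2]; exact hB i hi)
      have hv : (insertLoop α p new S (a :: js) B).val = (insertLoop α p new S js B').val := by
        simp [insertLoop, hl, hα, e, hB']
      have hcost : (insertLoop α p new S (a :: js) B).cost =
          (2 * d + a.size + new.size + 6) + (insertLoop α p new S js B').cost := by
        simp [insertLoop, hl, hα, e, ← hB', SearchTree.insert_cost]; ring
      refine ⟨fun i hi => ?_, ?_, ?_⟩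
      · rw [hv]
        refine ⟨(h1 i hi).1, fun j => ?_⟩
        rw [(h1 i hi).2 j]
        by_cases hia : i = a
        · subst hia
          rw [hB'a, m2 j]
          simp only [List.mem_cons, ha.ne, false_and, false_or, true_or, true_and, hl, hα]
          tauto
        by_cases hin : i = new
        · subst hin
          rw [hB'n, m1 j]
          simp only [List.mem_cons, true_and, hia, false_or]
          constructor
          · rintro ((rfl | h) | h | h)
            exacts [Or.inr (Or.inl ⟨Or.inl rfl, hl, hα⟩), Or.inl h,
              Or.inr (Or.inl ⟨Or.inr h.1, h.2⟩), Or.inr (Or.inr h)]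
          · rintro (h | ⟨rfl | h, h'⟩ | h)
            exacts [Or.inl (Or.inr h), Or.inl (Or.inl rfl), Or.inr (Or.inl ⟨h, h'⟩),
              Or.inr (Or.inr h)]
        rw [hB'i i hia hin]
        simp [hia, hin]
      · rw [hcost, List.length_cons]; omega
      · rw [hcost, List.length_cons, Nat.succ_mul js.length]; omega
    · obtain ⟨c, hc1, hc2, hv, hcost⟩ : ∃ c, 1 ≤ c ∧ c ≤ 2 * d + 2 * M + 6 ∧
          (insertLoop α p new S (a :: js) B).val = (insertLoop α p new S js B).val ∧
          (insertLoop α p new S (a :: js) B).cost =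
            c + (insertLoop α p new S js B).cost := by
        by_cases hl : S.live a = true
        · have hα : ¬ α ≤ ⟪p, S.pt a⟫ := fun h => hn ⟨hl, h⟩
          exact ⟨1 + 2 * d + 1, by omega, by omega, by simp [insertLoop, hl, hα],
            by simp [insertLoop, hl, hα]; ring⟩
        · exact ⟨1, by omega, by omega, by simp [insertLoop, hl], by simp [insertLoop, hl]⟩
      obtain ⟨h1, h2, h3⟩ := ih B hjs' hB
      refine ⟨fun i hi => ?_, ?_, ?_⟩
      · rw [hv]
        refine ⟨(h1 i hi).1, fun j => ?_⟩
        rw [(h1 i hi).2 j]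
        have e1 : ∀ b, (b ∈ a :: js ∧ S.live b = true ∧ α ≤ ⟪p, S.pt b⟫) ↔
            (b ∈ js ∧ S.live b = true ∧ α ≤ ⟪p, S.pt b⟫) := by
          intro b
          rw [List.mem_cons]
          constructor
          · rintro ⟨rfl | hb, h⟩
            exacts [absurd h hn, ⟨hb, h⟩]
          · rintro ⟨hb, h⟩
            exact ⟨Or.inr hb, h⟩
        rw [e1, e1]
      · rw [hcost, List.length_cons]; omega
      · rw [hcost, List.length_cons, Nat.succ_mul js.length]; omega

lemma Inv.insert {S : Store d} {α : ℝ} {x : ℕ → E d} {m M : ℕ} (h : S.Inv α x m M)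
    (hM : m.size ≤ M) (p : E d) :
    (S.insert α p).val.Inv α (Function.update x m p) (m + 1) M ∧
      m ≤ (S.insert α p).cost ∧ (S.insert α p).cost ≤ (m + 1) * (2 * d + 2 * M + 6) := by
  obtain ⟨hs, hl, hp, hg, hm⟩ := h
  obtain ⟨h1, h2, h3⟩ := insertLoop_spec α p m M S hM (List.range m)
    (Function.update S.bucket m SearchTree.nil) (by simp) (by
      intro i hi
      by_cases h : i = m
      · subst h; simpa using good_nil M
      · rw [Function.update_of_ne h]; exact hg i (by omega))
  rw [List.length_range] at h2 h3
  refine ⟨⟨by simp [Store.insert, hs], ?_, ?_, ?_, ?_⟩, ?_, ?_⟩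
  · intro i
    by_cases h : i = m
    · subst h; simp [Store.insert, hs]
    · simp only [Store.insert, Ticked.bind_val, Ticked.pure_val, hs, Function.update_of_ne h, hl]
      omega
  · intro i hi
    by_cases h : i = m
    · subst h; simp [Store.insert, hs]
    · simp only [Store.insert, Ticked.bind_val, Ticked.pure_val, hs, Function.update_of_ne h]
      exact hp i (by omega)
  · intro i hi
    simpa [Store.insert, hs] using (h1 i (by omega)).1
  · intro i hi j
    have key := (h1 i (by omega)).2 j
    have e : (S.insert α p).val.bucket i =
      (insertLoop α p m S (List.range m) (Function.update S.bucket m SearchTree.nil)).val i := by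
      simp [Store.insert, hs]
    rw [e, key]
    simp only [List.mem_range, hl, nnGraph]
    by_cases him : i = m
    · subst him
      simp only [Function.update_self, klist, List.not_mem_nil, false_or, true_and, lt_irrefl,
        false_and, and_false, or_false]
      constructor
      · rintro ⟨a1, -, a2⟩
        refine ⟨by omega, by omega, ?_⟩
        rwa [Function.update_of_ne a1.ne, ← hp j a1]
      · rintro ⟨a1, a2, a3⟩
        have : j < i := by omega
        rw [Function.update_of_ne this.ne, ← hp j this] at a3
        exact ⟨this, this, a3⟩
    · have hi' : i < m := by omega
      rw [Function.update_of_ne him, Function.update_of_ne him, hm i hi' j]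
      simp only [him, false_and, false_or, hi', true_and]
      by_cases hj : j = m
      · subst hj
        simp only [lt_irrefl, false_and, false_or, Function.update_self, true_and,
          Nat.lt_succ_self, hp i hi', real_inner_comm, ne_eq, him, not_false_eq_true]
      · rw [Function.update_of_ne hj]
        simp only [hj, false_and, or_false, nnGraph]
        constructor
        · rintro ⟨a, b⟩; exact ⟨by omega, b⟩
        · rintro ⟨a, b⟩; exact ⟨by omega, b⟩
  · simp only [Store.insert, Ticked.bind_cost, hs, tick_cost]
    omega
  · simp only [Store.insert, Ticked.bind_cost, hs, tick_cost, Ticked.pure_cost]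
    rw [Nat.succ_mul]
    omega

lemma Inv.congr {S : Store d} {α : ℝ} {x y : ℕ → E d} {m M : ℕ} (h : S.Inv α x m M)
    (hxy : ∀ i < m, x i = y i) : S.Inv α y m M := by
  refine ⟨h.size_eq, h.live_iff, fun i hi => (h.pt_eq i hi).trans (hxy i hi), h.good, ?_⟩
  intro i hi j
  rw [h.mem_iff i hi j]
  refine and_congr_right fun hj => ?_
  simp [nnGraph, hxy i hi, hxy j hj]

lemma Inv.represents {S : Store d} {α : ℝ} {x : ℕ → E d} {m M : ℕ} (h : S.Inv α x m M) :
    S.Represents α (Finset.range m) x := by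
  refine ⟨by simpa using h.live_iff, by simpa using h.pt_eq, fun i hi => ?_⟩
  rw [Finset.mem_range] at hi
  simpa [keys_val] using ⟨(h.good i hi).nodup, h.mem_iff i hi⟩

/-- The digit bound `M` is fixed for the whole history, so that `Good M` survives later insertions
with longer labels. -/
lemma foldl_inv (α : ℝ) (l : List (E d)) (M : ℕ) (hM : l.length.size ≤ M) :
    (l.foldl (fun S p => (S.insert α p).val) (empty d)).Inv α (fun i => l.getD i 0) l.length M := by
  induction l using List.reverseRecOn with
  | nil => refine ⟨rfl, ?_, ?_, ?_, ?_⟩ <;> simp [empty]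
  | append_singleton l p ih =>
    rw [List.length_append, List.length_singleton] at hM
    have hM' : l.length.size ≤ M := (Nat.size_le_size (by omega)).trans hM
    rw [List.foldl_append, List.length_append, List.length_singleton]
    refine ((ih hM').insert hM' p).1.congr fun i hi => ?_
    by_cases h : i = l.length
    · subst h; simp
    · rw [Function.update_of_ne h, List.getD_append _ _ _ _ (by omega)]

lemma build_inv (α : ℝ) {n : ℕ} (x : Fin n → E d) :
    -- The bound `n.size`, rather than the size of the last label `n - 1`, also covers the label `n`
    -- of the next insertion.
    (build α x).Inv α (labelled x) n n.size := by
  have h := foldl_inv α (List.ofFn x) n.size (by simp)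
  rw [List.length_ofFn] at h
  refine h.congr fun i hi => ?_
  simp [labelled, hi]

lemma deleteLoop_spec (j M : ℕ) (hM : j.size ≤ M) (ks : List ℕ) (B : ℕ → SearchTree)
    (hB : ∀ k ∈ ks, SearchTree.Ok [] (B k)) :
    (∀ i, i ∉ ks → (deleteLoop j ks B).val i = B i) ∧
    (∀ i ∈ ks, ((deleteLoop j ks B).val i).klist = (B i).klist.filter (· ≠ j)) ∧
    ks.length ≤ (deleteLoop j ks B).cost ∧
    (deleteLoop j ks B).cost ≤ ks.length * (M + 2) := by
  induction ks generalizing B with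
  | nil => simp [deleteLoop]
  | cons k ks ih =>
    obtain ⟨o1, f1⟩ := eraseAt_spec j j.bits (B k) [] rfl (hB k (by simp))
    have hcost := erase_cost j (B k)
    obtain ⟨h1, h2, h3, h4⟩ := ih (Function.update B k ((B k).erase j).val) (by
      intro i hi
      by_cases h : i = k
      · subst h; rw [Function.update_self]; exact o1
      · rw [Function.update_of_ne h]; exact hB i (by simp [hi]))
    have hv : (deleteLoop j (k :: ks) B).val =
      (deleteLoop j ks (Function.update B k ((B k).erase j).val)).val := by simp [deleteLoop]
    have hc : (deleteLoop j (k :: ks) B).cost = ((B k).erase j).cost + 1 +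
      (deleteLoop j ks (Function.update B k ((B k).erase j).val)).cost := by
      simp [deleteLoop]; ring
    refine ⟨fun i hi => ?_, fun i hi => ?_, ?_, ?_⟩
    · rw [List.mem_cons, not_or] at hi
      rw [hv, h1 i hi.2, Function.update_of_ne hi.1]
    · rw [hv]
      by_cases hik : i = k
      · subst hik
        -- The list may contain repetitions; removing `j` twice is harmless, since filtering is
        -- idempotent.
        by_cases his : i ∈ ks
        · rw [h2 i his, Function.update_self]
          simp only [SearchTree.erase, f1, List.filter_filter, Bool.and_self]
        · rw [h1 i his, Function.update_self]
          exact f1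
      · rw [h2 i (by simpa [hik] using hi), Function.update_of_ne hik]
    · rw [hc, List.length_cons]; omega
    · rw [hc, List.length_cons, Nat.succ_mul ks.length]; omega

/-- The bucket of `j` lists exactly the buckets that contain `j`, because adjacency is symmetric.
The conclusion is `Represents` and not `Inv`: the live labels no longer form an initial segment. -/
lemma Inv.delete {S : Store d} {α : ℝ} {x : ℕ → E d} {m M : ℕ} (h : S.Inv α x m M)
    {j : ℕ} (hj : j < m) (hM : j.size ≤ M) :
    (S.delete j).val.Represents α ((Finset.range m).erase j) x ∧
      (S.bucket j).klist.length ≤ (S.delete j).cost ∧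
      (S.delete j).cost ≤ ((S.bucket j).klist.length + 1) * (3 * M + 6) := by
  obtain ⟨hs, hl, hp, hg, hm⟩ := h
  have hlt : ∀ k ∈ (S.bucket j).klist, k < m := fun k hk => ((hm j hj k).1 hk).1
  obtain ⟨h1, h2, h3, h4⟩ := deleteLoop_spec j M hM (S.bucket j).klist S.bucket
    (fun k hk => (hg k (hlt k hk)).ok)
  refine ⟨⟨fun i => ?_, fun i hi => ?_, fun i hi => ?_⟩, ?_, ?_⟩
  · by_cases h : i = j
    · subst h; simp [Store.delete]
    · simp [Store.delete, hl, h]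
  · rw [Finset.mem_erase, Finset.mem_range] at hi
    exact hp i hi.2
  · rw [Finset.mem_erase, Finset.mem_range] at hi
    obtain ⟨hij, him⟩ := hi
    have e : (S.delete j).val.bucket i = (deleteLoop j (S.bucket j).klist S.bucket).val i := by
      simp [Store.delete, Function.update_of_ne hij, keys_val]
    have e' : ((S.delete j).val.bucket i).klist = (S.bucket i).klist.filter (· ≠ j) := by
      rw [e]
      by_cases hi : i ∈ (S.bucket j).klist
      · exact h2 i hi
      · rw [h1 i hi, filter_ne_eq_self]
        rw [hm j hj] at hi
        rw [hm i him]
        exact fun h => hi ⟨him, h.2.symm⟩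
    rw [keys_val, e']
    refine ⟨(hg i him).nodup.filter _, fun k => ?_⟩
    simp only [List.mem_filter, hm i him k, Finset.mem_erase, Finset.mem_range, decide_eq_true_eq]
    tauto
  · simp only [Store.delete, Ticked.bind_cost, keys_val]
    omega
  · simp only [Store.delete, Ticked.bind_cost, keys_val, keys_cost, tick_cost,
      Ticked.pure_cost]
    have := (hg j hj).nodes_le
    nlinarith

lemma Inv.nodes_le {S : Store d} {α : ℝ} {x : ℕ → E d} {m M D : ℕ} (h : S.Inv α x m M)
    (hD : ∀ i < m, (S.bucket i).klist.length ≤ D) (i : ℕ) (hi : i < m) :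
    (S.bucket i).nodes ≤ D * (M + 1) :=
  (h.good i hi).nodes_le.trans (Nat.mul_le_mul_right _ (hD i hi))

lemma Inv.le_space {S : Store d} {α : ℝ} {x : ℕ → E d} {m M D : ℕ} (h : S.Inv α x m M)
    (hD : ∀ i < m, D ≤ (S.bucket i).klist.length) : m * D ≤ S.space := by
  rw [Store.space, h.size_eq]
  calc m * D = ∑ i ∈ Finset.range m, D := by simp
    _ ≤ _ := Finset.sum_le_sum fun i hi => by
      have h1 := hD i (Finset.mem_range.1 hi)
      have h2 := length_klist_le (S.bucket i)
      omega

lemma Inv.space_le {S : Store d} {α : ℝ} {x : ℕ → E d} {m M D : ℕ} (h : S.Inv α x m M)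
    (hD : ∀ i < m, (S.bucket i).klist.length ≤ D) :
    S.space ≤ m * (d + 2 + 3 * (D * (M + 1))) := by
  rw [Store.space, h.size_eq]
  calc _ ≤ ∑ i ∈ Finset.range m, (d + 2 + 3 * (D * (M + 1))) :=
        Finset.sum_le_sum fun i hi => by
          have := h.nodes_le hD i (Finset.mem_range.1 hi)
          omega
    _ = _ := by simp

end Store

/-! ### Queries -/

namespace Store

open SearchTree

variable {d : ℕ}

lemma scan_cost (S : Store d) (q : E d) (js : List ℕ) (s : ℕ × Bool) :
    (S.scan q js s).cost = js.length * (4 * d + 2) := by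
  induction js generalizing s with
  | nil => simp [scan]
  | cons j js ih =>
    by_cases h : ⟪S.pt s.1, q⟫ + 1 / (d : ℝ) ≤ ⟪S.pt j, q⟫
    · simp only [scan, Ticked.bind_cost, innerT_val, innerT_cost, tick_cost, h, ↓reduceIte, ih,
        List.length_cons]; ring
    · simp only [scan, Ticked.bind_cost, innerT_val, innerT_cost, tick_cost, h, ↓reduceIte, ih,
        List.length_cons]; ring

lemma scan_cons (S : Store d) (q : E d) (j : ℕ) (js : List ℕ) (s : ℕ × Bool) :
    (S.scan q (j :: js) s).val = if ⟪S.pt s.1, q⟫ + 1 / (d : ℝ) ≤ ⟪S.pt j, q⟫ then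
      (S.scan q js (j, true)).val else (S.scan q js s).val := by
  by_cases h : ⟪S.pt s.1, q⟫ + 1 / (d : ℝ) ≤ ⟪S.pt j, q⟫
  · simp only [scan, Ticked.bind_val, innerT_val, h, ↓reduceIte]
  · simp only [scan, Ticked.bind_val, innerT_val, h, ↓reduceIte]

lemma scan_spec (S : Store d) (q : E d) (js : List ℕ) (s : ℕ × Bool) :
    (S.scan q js s).val = s ∨ ((S.scan q js s).val.1 ∈ js ∧ (S.scan q js s).val.2 = true ∧
      ⟪S.pt s.1, q⟫ + 1 / (d : ℝ) ≤ ⟪S.pt (S.scan q js s).val.1, q⟫) := by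
  induction js generalizing s with
  | nil => exact Or.inl rfl
  | cons j js ih =>
    have hd : (0 : ℝ) ≤ 1 / (d : ℝ) := by positivity
    rw [scan_cons]
    split_ifs with h
    · rcases ih (j, true) with h' | ⟨h1, h2, h3⟩
      · rw [h']
        exact Or.inr ⟨by simp, rfl, h⟩
      · exact Or.inr ⟨by simp [h1], h2, by simp only at h3; linarith⟩
    · rcases ih s with h' | ⟨h1, h2, h3⟩
      · exact Or.inl h'
      · exact Or.inr ⟨by simp [h1], h2, h3⟩

/-- When `j` is scanned, either it becomes the current point or it beats the current point by less
than `1/d`; afterwards the inner product of the current point never decreases. So the final point is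
within `1/d` of the best one in the bucket, whatever the order of the scan. -/
lemma lt_scan (S : Store d) (q : E d) (hd : 0 < d) (js : List ℕ) (s : ℕ × Bool) :
    ∀ j ∈ js, ⟪S.pt j, q⟫ < ⟪S.pt (S.scan q js s).val.1, q⟫ + 1 / (d : ℝ) := by
  have hd : (0 : ℝ) < 1 / (d : ℝ) := by positivity
  have mono : ∀ js s, ⟪S.pt s.1, q⟫ ≤ ⟪S.pt (S.scan q js s).val.1, q⟫ := by
    intro js s
    rcases scan_spec S q js s with h | h
    · rw [h]
    · linarith [h.2.2]
  induction js generalizing s with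
  | nil => simp
  | cons j js ih =>
    rw [scan_cons]
    intro i hi
    rw [List.mem_cons] at hi
    split_ifs with h
    · rcases hi with rfl | hi
      · linarith [mono js (i, true)]
      · exact ih _ i hi
    · rcases hi with rfl | hi
      · linarith [mono js s]
      · exact ih _ i hi

/-- From the current label `p`, with `k` random labels used, the loop of a query returns `r` after
at most `T` steps. -/
def LoopReturns (S : Store d) (q : E d) (γ : ℝ) (ω : ℕ → ℕ) (r p k T : ℕ) : Prop :=
  ∃ fuel, (S.queryLoop q γ ω fuel p k).val = some r ∧ (S.queryLoop q γ ω fuel p k).cost ≤ T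

lemma LoopReturns.mono {S : Store d} {q : E d} {γ : ℝ} {ω : ℕ → ℕ} {r p k T T' : ℕ}
    (h : S.LoopReturns q γ ω r p k T) (hT : T ≤ T') : S.LoopReturns q γ ω r p k T' := by
  obtain ⟨f, h1, h2⟩ := h
  exact ⟨f, h1, h2.trans hT⟩

/-- The result of a run through the bucket of `p`. -/
noncomputable def runFrom (S : Store d) (q : E d) (p : ℕ) : ℕ × Bool :=
  (S.scan q (S.bucket p).klist (p, false)).val

/-- Bound on the cost of a round of a query, if no bucket has more than `D` labels and more than
`N` nodes. -/
def roundCost (d D N : ℕ) : ℕ := 2 * d + 3 + 2 * N + D * (4 * d + 2)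

section

variable {S : Store d} {q : E d} {γ : ℝ} {ω : ℕ → ℕ} {r p k T D N : ℕ}

lemma LoopReturns.of_le (h : γ ≤ ⟪S.pt r, q⟫) :
    S.LoopReturns q γ ω r r k (roundCost d D N) := by
  refine ⟨1, ?_, ?_⟩
  · simp only [queryLoop, Ticked.bind_val, innerT_val, h, ↓reduceIte, Ticked.pure_val]
  · simp only [queryLoop, Ticked.bind_cost, innerT_val, innerT_cost, tick_cost, h, ↓reduceIte,
      Ticked.pure_cost, roundCost]
    omega

lemma LoopReturns.of_move (h : ¬ γ ≤ ⟪S.pt p, q⟫) (hD : (S.bucket p).klist.length ≤ D)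
    (hN : (S.bucket p).nodes ≤ N) (h' : (S.runFrom q p).2 = true)
    (hT : S.LoopReturns q γ ω r (S.runFrom q p).1 k T) :
    S.LoopReturns q γ ω r p k (T + roundCost d D N) := by
  obtain ⟨f, h1, h2⟩ := hT
  rw [runFrom] at h' h1 h2
  refine ⟨f + 1, ?_, ?_⟩
  · simp only [queryLoop, Ticked.bind_val, innerT_val, h, ↓reduceIte, keys_val, h', ↓reduceIte, h1]
  · simp only [queryLoop, Ticked.bind_cost, innerT_val, innerT_cost, tick_cost, h, ↓reduceIte, keys_val,
      keys_cost, h', ↓reduceIte, scan_cost, roundCost]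
    have := Nat.mul_le_mul_right (4 * d + 2) hD
    omega

lemma LoopReturns.of_stay (h : ¬ γ ≤ ⟪S.pt p, q⟫) (hD : (S.bucket p).klist.length ≤ D)
    (hN : (S.bucket p).nodes ≤ N) (h' : (S.runFrom q p).2 = false)
    (hT : S.LoopReturns q γ ω r (ω k) (k + 1) T) :
    S.LoopReturns q γ ω r p k (T + roundCost d D N) := by
  obtain ⟨f, h1, h2⟩ := hT
  rw [runFrom] at h'
  refine ⟨f + 1, ?_, ?_⟩
  · simp only [queryLoop, Ticked.bind_val, innerT_val, h, ↓reduceIte, keys_val, h', h1,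
      Bool.false_eq_true, ↓reduceIte]
  · simp only [queryLoop, Ticked.bind_cost, innerT_val, innerT_cost, tick_cost, h, ↓reduceIte, keys_val,
      keys_cost, h', scan_cost, roundCost, Bool.false_eq_true, ↓reduceIte]
    have := Nat.mul_le_mul_right (4 * d + 2) hD
    omega

end

/-- Hypotheses under which queries are analyzed: the label `r` is the only one within reach of the
query, by a margin of `1 / d`, and buckets are of bounded size. -/
structure QueryHyp (S : Store d) (q : E d) (γ : ℝ) (r n D N : ℕ) : Prop where
  pos : 0 < d
  target : γ ≤ ⟪S.pt r, q⟫
  other : ∀ i < n, i ≠ r → ⟪S.pt i, q⟫ + 1 / (d : ℝ) ≤ γ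
  abs_inner_le : ∀ i < n, |⟪S.pt i, q⟫| ≤ 1
  klist_lt : ∀ i < n, ∀ j ∈ (S.bucket i).klist, j < n
  length_le : ∀ i < n, (S.bucket i).klist.length ≤ D
  nodes_le : ∀ i < n, (S.bucket i).nodes ≤ N

section

variable {S : Store d} {q : E d} {γ : ℝ} {ω : ℕ → ℕ} {r p k T n D N : ℕ}

lemma QueryHyp.not_le (h : S.QueryHyp q γ r n D N) {i : ℕ} (hi : i < n) (hr : i ≠ r) :
    ¬ γ ≤ ⟪S.pt i, q⟫ := by
  have h1 := h.other i hi hr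
  have h2 : (0 : ℝ) < 1 / (d : ℝ) := by have := h.pos; positivity
  linarith

/-- An attempt makes at most `2 * d + 1` rounds. -/
lemma QueryHyp.attempt (h : S.QueryHyp q γ r n D N) (hp : p < n)
    (hT : S.LoopReturns q γ ω r (ω k) (k + 1) T) :
    S.LoopReturns q γ ω r p k (T + (2 * d + 1) * roundCost d D N) := by
  have hd : (0 : ℝ) < d := by exact_mod_cast h.pos
  -- Induction on the remaining potential: from inner product at least `1 - m/d` at most `m` moves
  -- are possible, as each gains `1/d` and no inner product exceeds `1`. Since inner products are at
  -- least `-1`, `m = 2d` covers every start.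
  suffices H : ∀ m : ℕ, ∀ p < n, 1 - (m : ℝ) / d ≤ ⟪S.pt p, q⟫ →
      S.LoopReturns q γ ω r p k (T + (m + 1) * roundCost d D N) by
    refine H (2 * d) p hp ?_
    have := (abs_le.1 (h.abs_inner_le p hp)).1
    have e : ((2 * d : ℕ) : ℝ) / d = 2 := by push_cast; field_simp
    rw [e]; linarith
  intro m
  induction m with
  | zero =>
    intro p hp h1
    by_cases hr : p = r
    · subst hr
      exact (LoopReturns.of_le (D := D) (N := N) h.target).mono (by omega)
    have hn := h.not_le hp hr
    rcases scan_spec S q (S.bucket p).klist (p, false) with h' | ⟨h2, h3, h4⟩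
    · refine (LoopReturns.of_stay hn (h.length_le p hp) (h.nodes_le p hp) ?_ hT).mono (by omega)
      rw [runFrom, h']
    · have := (abs_le.1 (h.abs_inner_le _ (h.klist_lt p hp _ h2))).2
      have : (0 : ℝ) < 1 / (d : ℝ) := by positivity
      simp only [Nat.cast_zero, zero_div, sub_zero] at h1 h4
      linarith
  | succ m ih =>
    intro p hp h1
    by_cases hr : p = r
    · subst hr
      refine (LoopReturns.of_le (D := D) (N := N) h.target).mono ?_
      nlinarith
    have hn := h.not_le hp hr
    rcases scan_spec S q (S.bucket p).klist (p, false) with h' | ⟨h2, h3, h4⟩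
    · refine (LoopReturns.of_stay hn (h.length_le p hp) (h.nodes_le p hp) ?_ hT).mono ?_
      · rw [runFrom, h']
      · nlinarith
    · have h5 := ih (S.runFrom q p).1 (h.klist_lt p hp _ h2) (by
        rw [runFrom]
        have : ((m + 1 : ℕ) : ℝ) / d = m / d + 1 / d := by push_cast; ring
        rw [this] at h1
        simp only at h4
        linarith)
      refine (LoopReturns.of_move hn (h.length_le p hp) (h.nodes_le p hp) h3 h5).mono ?_
      apply le_of_eq; ring

/-- The target beats every other point by at least `1/d`, so by `lt_scan` a run through a bucket
that contains it must end there. -/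
lemma QueryHyp.of_nbr (h : S.QueryHyp q γ r n D N) (hp : p < n) (hr : r ∈ (S.bucket p).klist) :
    S.LoopReturns q γ ω r p k (2 * roundCost d D N) := by
  have hd : (0 : ℝ) < 1 / (d : ℝ) := by have := h.pos; positivity
  by_cases hpr : p = r
  · subst hpr
    exact (LoopReturns.of_le (D := D) (N := N) h.target).mono (by omega)
  have h1 := lt_scan S q h.pos _ (p, false) r hr
  have hh : (S.runFrom q p).1 = r ∧ (S.runFrom q p).2 = true := by
    rcases scan_spec S q (S.bucket p).klist (p, false) with h' | ⟨h2, h3, h4⟩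
    · rw [h'] at h1
      have := h.other p hp hpr
      have := h.target
      simp only at h1
      linarith
    · refine ⟨?_, h3⟩
      by_contra hne
      have := h.other _ (h.klist_lt p hp _ h2) hne
      have := h.target
      linarith
  refine (LoopReturns.of_move (h.not_le hp hpr) (h.length_le p hp) (h.nodes_le p hp) hh.2
    (T := roundCost d D N) ?_).mono (by omega)
  rw [hh.1]
  exact LoopReturns.of_le h.target

/-- A start from whose bucket the query moves to a neighbor of the target, since the other
neighbors are too far away from `q`. -/
lemma QueryHyp.of_second_nbr (h : S.QueryHyp q γ r n D N) {a b : ℝ} (hab : a + 1 / (d : ℝ) ≤ b)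
    (hp : p < n) {j : ℕ} (hj : j ∈ (S.bucket p).klist) (hr : r ∈ (S.bucket j).klist)
    (hjb : b ≤ ⟪S.pt j, q⟫) (hpa : ⟪S.pt p, q⟫ < a)
    (ha : ∀ i ∈ (S.bucket p).klist, i ≠ j → i ≠ r → ⟪S.pt i, q⟫ < a) :
    S.LoopReturns q γ ω r p k (3 * roundCost d D N) := by
  -- If the target itself is in the bucket, the run ends at the target instead of `j`. Otherwise any
  -- final point other than `j` has level below `a ≤ b - 1/d`, against `lt_scan`.
  by_cases hpr : r ∈ (S.bucket p).klist
  · exact (h.of_nbr hp hpr).mono (by omega)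
  by_cases hpr' : p = r
  · subst hpr'
    exact (LoopReturns.of_le (D := D) (N := N) h.target).mono (by omega)
  have h1 := lt_scan S q h.pos _ (p, false) j hj
  have hh : (S.runFrom q p).1 = j ∧ (S.runFrom q p).2 = true := by
    rcases scan_spec S q (S.bucket p).klist (p, false) with h' | ⟨h2, h3, h4⟩
    · rw [h'] at h1
      simp only at h1
      linarith
    · refine ⟨?_, h3⟩
      by_contra hne
      have := ha _ h2 hne (fun e => hpr (e ▸ h2))
      linarith
  refine (LoopReturns.of_move (h.not_le hp hpr') (h.length_le p hp) (h.nodes_le p hp) hh.2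
    (T := 2 * roundCost d D N) ?_).mono (by omega)
  rw [hh.1]
  exact h.of_nbr (h.klist_lt p hp j hj) hr

/-- Backward induction from the good start `ω K`: each earlier start costs one attempt, which either
succeeds by itself or passes on to the next random label. The good start has to work for every
counter `k`, because its run draws no further labels. -/
lemma QueryHyp.queryReturns (h : S.QueryHyp q γ r n D N) (hω : ∀ k, ω k < n) {K R : ℕ}
    (hK : K < R) (hgood : ∀ k, S.LoopReturns q γ ω r (ω K) k (3 * roundCost d D N)) :
    S.QueryReturns q γ ω r (((R * (2 * d + 1) + 4) * roundCost d D N : ℕ) : ℝ) := by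
  have H : ∀ i ≤ K, S.LoopReturns q γ ω r (ω (K - i)) (K - i + 1)
      (3 * roundCost d D N + i * ((2 * d + 1) * roundCost d D N)) := by
    intro i
    induction i with
    | zero => intro _; simpa using hgood (K + 1)
    | succ i ih =>
      intro hi
      have e : K - (i + 1) + 1 = K - i := by omega
      rw [e]
      refine (h.attempt (hω _) (ih (by omega))).mono (le_of_eq ?_)
      ring
  obtain ⟨f, h1, h2⟩ := H K le_rfl
  rw [Nat.sub_self] at h1 h2
  refine ⟨f, ?_, ?_⟩
  · simpa [query] using h1
  · rw [Nat.cast_le]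
    simp only [query, Ticked.bind_cost, tick_cost]
    have h3 : 1 ≤ roundCost d D N := by rw [roundCost]; omega
    have h4 : K * ((2 * d + 1) * roundCost d D N) ≤ R * ((2 * d + 1) * roundCost d D N) :=
      Nat.mul_le_mul_right _ hK.le
    have h5 : (R * (2 * d + 1) + 4) * roundCost d D N =
      R * ((2 * d + 1) * roundCost d D N) + 4 * roundCost d D N := by ring
    rw [h5]
    simp only [zero_add] at h2
    omega

end

end Store

/-! ### Volumes of spherical caps and wedges -/

section Sphere

variable {d : ℕ}

open scoped Pointwise in
-- The surface measure is defined through volumes of cones, so the uniform law of `S` is the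
-- fraction of the unit ball filled by the cone over `S`. All estimates on the sphere become volume
-- comparisons in the ball.
lemma sphereLaw_apply (hd : 0 < d) {S : Set (E d)} (hS : MeasurableSet S) :
    sphereLaw d S = (volume (Metric.ball (0 : E d) 1))⁻¹ *
      volume {x : E d | x ∈ Metric.ball 0 1 ∧ x ≠ 0 ∧ ‖x‖⁻¹ • x ∈ S} := by
  have : NeZero d := ⟨hd.ne'⟩
  have hm : Measurable (fun x : Metric.sphere (0 : E d) 1 => (x : E d)) := measurable_subtype_coe
  have e : Set.Ioo (0 : ℝ) 1 • ((fun x : Metric.sphere (0 : E d) 1 => (x : E d)) ''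
      ((fun x : Metric.sphere (0 : E d) 1 => (x : E d)) ⁻¹' S)) =
      {x : E d | x ∈ Metric.ball 0 1 ∧ x ≠ 0 ∧ ‖x‖⁻¹ • x ∈ S} := by
    ext x
    simp only [Set.mem_smul, Set.mem_image, Set.mem_preimage, Set.mem_ofPred_eq, mem_ball_zero_iff]
    constructor
    · rintro ⟨r, ⟨hr0, hr1⟩, _, ⟨⟨y, hy⟩, hyS, rfl⟩, rfl⟩
      have hy' : ‖y‖ = 1 := by simpa using hy
      have hn : ‖r • y‖ = r := by rw [norm_smul, hy', mul_one, Real.norm_of_nonneg hr0.le]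
      refine ⟨by simpa [hn] using hr1, ?_, ?_⟩
      · rw [← norm_ne_zero_iff]; simp only [hn]; exact hr0.ne'
      · simp only [hn]
        rwa [smul_smul, inv_mul_cancel₀ hr0.ne', one_smul]
    · rintro ⟨h1, h2, h3⟩
      have hpos : 0 < ‖x‖ := norm_pos_iff.2 h2
      refine ⟨‖x‖, ⟨hpos, h1⟩, ‖x‖⁻¹ • x, ⟨⟨‖x‖⁻¹ • x, ?_⟩, h3, rfl⟩, ?_⟩
      · rw [mem_sphere_zero_iff_norm, norm_smul, norm_inv, norm_norm, inv_mul_cancel₀ hpos.ne']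
      · rw [smul_smul, mul_inv_cancel₀ hpos.ne', one_smul]
  rw [sphereLaw, Measure.map_apply hm hS, Measure.smul_apply, Measure.toSphere_apply' _ (hm hS),
    Measure.toSphere_apply_univ, e, finrank_euclideanSpace, Fintype.card_fin, smul_eq_mul,
    ENNReal.mul_inv (by simp [hd.ne']) (by simp), ← mul_assoc, mul_right_comm _ _ (d : ENNReal),
    ENNReal.inv_mul_cancel (by simp [hd.ne']) (by simp), one_mul]

lemma isProbabilityMeasure_sphereLaw (hd : 0 < d) : IsProbabilityMeasure (sphereLaw d) := by
  have : NeZero d := ⟨hd.ne'⟩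
  refine ⟨?_⟩
  rw [sphereLaw, Measure.map_apply measurable_subtype_coe MeasurableSet.univ, Set.preimage_univ,
    Measure.smul_apply, smul_eq_mul]
  refine ENNReal.inv_mul_cancel ?_ (measure_ne_top _ _)
  rw [Measure.toSphere_apply_univ]
  simp [hd.ne', (Metric.measure_ball_pos volume (0 : E d) one_pos).ne']

lemma ae_norm_sphereLaw (d : ℕ) : ∀ᵐ x ∂sphereLaw d, ‖x‖ = 1 := by
  have hm : Measurable (fun x : Metric.sphere (0 : E d) 1 => (x : E d)) := measurable_subtype_coe
  rw [sphereLaw, ae_map_iff hm.aemeasurable (measurableSet_eq_fun measurable_norm measurable_const)]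
  exact ae_of_all _ fun x => by simp

/-- Volume of the unit ball. -/
noncomputable def ballVol (d : ℕ) : ℝ := volume.real (Metric.ball (0 : E d) 1)

lemma ballVol_pos (d : ℕ) : 0 < ballVol d :=
  ENNReal.toReal_pos (Metric.measure_ball_pos volume (0 : E d) one_pos).ne' measure_ball_lt_top.ne

lemma volume_real_ball (hd : 0 < d) (x : E d) {r : ℝ} (hr : 0 ≤ r) :
    volume.real (Metric.ball x r) = r ^ d * ballVol d := by
  have : NeZero d := ⟨hd.ne'⟩
  rw [Measure.real, Measure.addHaar_ball volume x hr, ENNReal.toReal_mul,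
    ENNReal.toReal_ofReal (by positivity), finrank_euclideanSpace, Fintype.card_fin]
  rfl

lemma sphereLaw_real (hd : 0 < d) {S : Set (E d)} (hS : MeasurableSet S) :
    (sphereLaw d).real S =
      volume.real {x : E d | x ∈ Metric.ball 0 1 ∧ x ≠ 0 ∧ ‖x‖⁻¹ • x ∈ S} / ballVol d := by
  rw [Measure.real, sphereLaw_apply hd hS, ENNReal.toReal_mul, ENNReal.toReal_inv, div_eq_inv_mul]
  rfl

lemma sqrt_one_sub_sq_pow_le {a : ℝ} : √(1 - a ^ 2) ^ d ≤ Real.exp (-(d * a ^ 2 / 2)) := by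
  have h1 : √(1 - a ^ 2) ≤ Real.exp (-(a ^ 2 / 2)) := by
    rw [Real.sqrt_le_iff]
    refine ⟨(Real.exp_pos _).le, ?_⟩
    rw [← Real.exp_nat_mul]
    have := Real.add_one_le_exp (((2 : ℕ) : ℝ) * (-(a ^ 2 / 2)))
    push_cast at this ⊢
    linarith
  calc _ ≤ Real.exp (-(a ^ 2 / 2)) ^ d := pow_le_pow_left₀ (Real.sqrt_nonneg _) h1 _
    _ = _ := by rw [← Real.exp_nat_mul]; congr 1; ring

lemma measurableSet_cap (p : E d) (a : ℝ) : MeasurableSet {x : E d | a ≤ ⟪x, p⟫} :=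
  measurableSet_le measurable_const (by fun_prop)

/-- Upper bound for the relative volume of a cap: the cone over the cap, within the unit ball, is
contained in a ball of radius `√(1 - a²)`. -/
theorem sphereLaw_cap_le (hd : 0 < d) {p : E d} (hp : ‖p‖ = 1) {a : ℝ} (ha : 0 ≤ a)
    (ha2 : a ^ 2 ≤ 1 / 2) :
    (sphereLaw d).real {x | a ≤ ⟪x, p⟫} ≤ Real.exp (-(d * a ^ 2 / 2)) := by
  rw [sphereLaw_real hd (measurableSet_cap p a), div_le_iff₀ (ballVol_pos d)]
  have hsub : {x : E d | x ∈ Metric.ball 0 1 ∧ x ≠ 0 ∧ ‖x‖⁻¹ • x ∈ {x | a ≤ ⟪x, p⟫}} ⊆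
      Metric.ball (a • p) (√(1 - a ^ 2)) := by
    rintro x ⟨h1, h2, h3⟩
    have hpos : 0 < ‖x‖ := norm_pos_iff.2 h2
    rw [mem_ball_zero_iff] at h1
    simp only [Set.mem_ofPred_eq, real_inner_smul_left] at h3
    have h4 : a * ‖x‖ ≤ ⟪x, p⟫ := by
      rw [inv_mul_eq_div, le_div_iff₀ hpos] at h3; exact h3
    rw [mem_ball_iff_norm]
    apply Real.lt_sqrt_of_sq_lt
    rw [@norm_sub_sq_real, norm_smul, hp, real_inner_smul_right, Real.norm_eq_abs, mul_one, sq_abs]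
    -- The gap `1 - a² - ‖x - a p‖²` is at least `(1 - ‖x‖)(1 + ‖x‖ - 2a²)`, which is positive
    -- because `a² ≤ 1/2`.
    nlinarith [mul_le_mul_of_nonneg_left h4 ha,
      mul_pos (sub_pos.2 h1) (by linarith : 0 < ‖x‖ + 1 - 2 * a ^ 2)]
  calc _ ≤ volume.real (Metric.ball (a • p) (√(1 - a ^ 2))) := measureReal_mono hsub
    _ = √(1 - a ^ 2) ^ d * ballVol d := volume_real_ball hd _ (Real.sqrt_nonneg _)
    _ ≤ _ := by gcongr; exacts [(ballVol_pos d).le, sqrt_one_sub_sq_pow_le]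

/-- The segment fits into a ball of radius `r√(1 - τ²)` around `rτ p`. Its height is `τ` and not
`rτ`; as `r ≤ 1`, this only makes it smaller. -/
lemma volume_segment_le (hd : 0 < d) {p : E d} (hp : ‖p‖ = 1) {r τ : ℝ} (hr0 : 0 ≤ r) (hr : r ≤ 1)
    (hτ : 0 ≤ τ) (hτ1 : τ ≤ 1) :
    volume.real {y : E d | y ∈ Metric.ball 0 r ∧ τ ≤ ⟪y, p⟫} ≤
      Real.exp (-(d * τ ^ 2 / 2)) * (r ^ d * ballVol d) := by
  have hsub : {y : E d | y ∈ Metric.ball 0 r ∧ τ ≤ ⟪y, p⟫} ⊆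
      Metric.ball ((r * τ) • p) (r * √(1 - τ ^ 2)) := by
    rintro x ⟨h1, h3⟩
    rw [mem_ball_zero_iff] at h1
    rw [mem_ball_iff_norm]
    have hs : √(1 - τ ^ 2) ^ 2 = 1 - τ ^ 2 := Real.sq_sqrt (by nlinarith)
    apply lt_of_pow_lt_pow_left₀ 2 (by positivity)
    rw [@norm_sub_sq_real, norm_smul, hp, real_inner_smul_right, Real.norm_eq_abs, mul_one, sq_abs,
      mul_pow, mul_pow, hs]
    have h5 : ‖x‖ ^ 2 < r ^ 2 := pow_lt_pow_left₀ h1 (norm_nonneg _) two_ne_zero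
    nlinarith [mul_le_mul_of_nonneg_left h3 (mul_nonneg hr0 hτ),
      mul_nonneg (mul_nonneg hr0 (sub_nonneg.2 hr)) (sq_nonneg τ)]
  calc _ ≤ volume.real (Metric.ball ((r * τ) • p) (r * √(1 - τ ^ 2))) := measureReal_mono hsub
    _ = (r * √(1 - τ ^ 2)) ^ d * ballVol d := volume_real_ball hd _ (by positivity)
    _ = √(1 - τ ^ 2) ^ d * (r ^ d * ballVol d) := by rw [mul_pow]; ring
    _ ≤ _ := by
      gcongr
      · have := ballVol_pos d; positivity
      · exact sqrt_one_sub_sq_pow_le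

/-- Lower bound for the relative volume of a wedge, the intersection of two caps in orthogonal
directions. -/
theorem le_sphereLaw_wedge (hd : 0 < d) {q u : E d} (hq : ‖q‖ = 1) (hu : ‖u‖ = 1) (hqu : ⟪q, u⟫ = 0)
    {a b τ s : ℝ} (ha : 0 ≤ a) (hb : 0 ≤ b) (hτ : 0 < τ)
    (hτd : 4 * Real.exp (-(d * τ ^ 2 / 2)) ≤ 1 / 2)
    (hs : s = (a + 2 * τ) ^ 2 + (b + 2 * τ) ^ 2) (hs2 : s ≤ 1 / 2) :
    1 / 2 * Real.exp (-(d / 2 * (s * (1 + 2 * s)))) ≤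
      (sphereLaw d).real {x | a ≤ ⟪x, q⟫ ∧ b ≤ ⟪x, u⟫} := by
  have hS : MeasurableSet {x : E d | a ≤ ⟪x, q⟫ ∧ b ≤ ⟪x, u⟫} :=
    (measurableSet_cap q a).inter (measurableSet_cap u b)
  rw [sphereLaw_real hd hS, le_div_iff₀ (ballVol_pos d)]
  have hs0 : 0 ≤ s := by rw [hs]; positivity
  have hτ1 : τ ≤ 1 := by nlinarith
  set r := √(1 - s) with hr
  have hr2 : r ^ 2 = 1 - s := Real.sq_sqrt (by linarith)
  have hr0 : 0 ≤ r := Real.sqrt_nonneg _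
  have hr1 : r ≤ 1 := Real.sqrt_le_one.2 (by linarith)
  -- The cone over the wedge contains a translate by `c` of `T`, the ball of radius `r` with both
  -- coordinates restricted to `(-τ, τ)`. The translate stays in both half-spaces, and inside the
  -- unit ball because `(a+2τ)² + (b+2τ)² + r² = 1` leaves room for the cross terms.
  set c : E d := (a + τ) • q + (b + τ) • u with hc
  let T : Set (E d) := {y | y ∈ Metric.ball 0 r ∧ |⟪y, q⟫| < τ ∧ |⟪y, u⟫| < τ}
  have hsub : (fun y => c + y) '' T ⊆
      {x : E d | x ∈ Metric.ball 0 1 ∧ x ≠ 0 ∧ ‖x‖⁻¹ • x ∈ {x | a ≤ ⟪x, q⟫ ∧ b ≤ ⟪x, u⟫}} := by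
    rintro _ ⟨y, ⟨h1, h2, h3⟩, rfl⟩
    rw [mem_ball_zero_iff] at h1
    rw [abs_lt] at h2 h3
    have hqq : ⟪q, q⟫ = 1 := by rw [real_inner_self_eq_norm_sq, hq]; norm_num
    have huu : ⟪u, u⟫ = 1 := by rw [real_inner_self_eq_norm_sq, hu]; norm_num
    have huq : ⟪u, q⟫ = 0 := by rw [real_inner_comm]; exact hqu
    have e1 : ⟪c + y, q⟫ = a + τ + ⟪y, q⟫ := by
      rw [hc]; simp only [inner_add_left, real_inner_smul_left, hqq, huq]; ring
    have e2 : ⟪c + y, u⟫ = b + τ + ⟪y, u⟫ := by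
      rw [hc]; simp only [inner_add_left, real_inner_smul_left, huu, hqu]; ring
    have e3 : ‖c + y‖ ^ 2 = (a + τ) ^ 2 + (b + τ) ^ 2 + 2 * ((a + τ) * ⟪y, q⟫ + (b + τ) * ⟪y, u⟫)
        + ‖y‖ ^ 2 := by
      rw [@norm_add_sq_real]
      have e4 : ‖c‖ ^ 2 = (a + τ) ^ 2 + (b + τ) ^ 2 := by
        rw [← real_inner_self_eq_norm_sq, hc]
        simp only [inner_add_left, inner_add_right, real_inner_smul_left, real_inner_smul_right,
          hqq, huu, hqu, huq]
        ring
      have e5 : ⟪c, y⟫ = (a + τ) * ⟪y, q⟫ + (b + τ) * ⟪y, u⟫ := by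
        rw [hc, inner_add_left, real_inner_smul_left, real_inner_smul_left, real_inner_comm q,
          real_inner_comm u]
      rw [e4, e5]
    have h5 : ‖y‖ ^ 2 < r ^ 2 := pow_lt_pow_left₀ h1 (norm_nonneg _) two_ne_zero
    have h6 : ‖c + y‖ < 1 := by
      rw [← sq_lt_one_iff₀ (norm_nonneg _), e3]
      nlinarith [mul_le_mul_of_nonneg_left h2.2.le (by linarith : 0 ≤ a + τ),
        mul_le_mul_of_nonneg_left h3.2.le (by linarith : 0 ≤ b + τ)]
    have h7 : c + y ≠ 0 := by
      intro h
      rw [h, inner_zero_left] at e1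
      linarith
    have hpos : 0 < ‖c + y‖ := norm_pos_iff.2 h7
    refine ⟨by simpa using h6, h7, ?_⟩
    simp only [Set.mem_ofPred_eq, real_inner_smul_left, inv_mul_eq_div, le_div_iff₀ hpos, e1, e2]
    constructor <;> nlinarith
  -- What `T` misses of the ball of radius `r` is covered by four segments of height `τ`, by `hτd`
  -- at most half of that ball in total.
  have hT : 1 / 2 * (r ^ d * ballVol d) ≤ volume.real T := by
    have hcov : Metric.ball (0 : E d) r ⊆ T ∪ ({y | y ∈ Metric.ball 0 r ∧ τ ≤ ⟪y, q⟫} ∪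
        {y | y ∈ Metric.ball 0 r ∧ τ ≤ ⟪y, -q⟫} ∪ ({y | y ∈ Metric.ball 0 r ∧ τ ≤ ⟪y, u⟫} ∪
        {y | y ∈ Metric.ball 0 r ∧ τ ≤ ⟪y, -u⟫})) := by
      intro y hy
      by_contra hcon
      simp only [T, Set.mem_union, Set.mem_ofPred_eq, hy, true_and, inner_neg_right, not_or, not_le,
        abs_lt] at hcon
      exact hcon.1 ⟨⟨by linarith, by linarith⟩, by linarith, by linarith⟩
    have hfin : ∀ A : Set (E d), A ⊆ Metric.ball 0 r → volume A ≠ ⊤ := fun A hA =>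
      ((measure_mono hA).trans_lt measure_ball_lt_top).ne
    have h1 := measureReal_mono (μ := volume) hcov (hfin _ (by
      rintro y (h | (h | h) | h | h) <;> exact h.1))
    rw [volume_real_ball hd _ hr0] at h1
    have hq' : ‖-q‖ = 1 := by rw [norm_neg, hq]
    have hu' : ‖-u‖ = 1 := by rw [norm_neg, hu]
    have b1 := volume_segment_le hd hq hr0 hr1 hτ.le hτ1
    have b2 := volume_segment_le hd hq' hr0 hr1 hτ.le hτ1
    have b3 := volume_segment_le hd hu hr0 hr1 hτ.le hτ1
    have b4 := volume_segment_le hd hu' hr0 hr1 hτ.le hτ1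
    have h2 := h1.trans ((measureReal_union_le _ _).trans (add_le_add_right
      ((measureReal_union_le _ _).trans (add_le_add (measureReal_union_le _ _)
        (measureReal_union_le _ _))) _))
    have hv : 0 ≤ r ^ d * ballVol d := by have := ballVol_pos d; positivity
    nlinarith
  have h8 : Real.exp (-(d / 2 * (s * (1 + 2 * s)))) ≤ r ^ d := by
    have hs1 : 0 < 1 - s := by linarith
    have h9 : Real.exp (-(s * (1 + 2 * s) / 2)) ≤ r := by
      apply Real.le_sqrt_of_sq_le
      rw [← Real.exp_nat_mul, ← Real.le_log_iff_exp_le hs1]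
      have := Real.one_sub_inv_le_log_of_pos hs1
      refine le_trans ?_ this
      have e : 1 - (1 - s)⁻¹ = - (s / (1 - s)) := by field_simp; ring
      rw [e]
      push_cast
      have : s / (1 - s) ≤ s * (1 + 2 * s) := by
        rw [div_le_iff₀ hs1]
        nlinarith [mul_nonneg (sq_nonneg s) (by linarith : 0 ≤ 1 - 2 * s)]
      linarith
    calc _ = Real.exp (-(s * (1 + 2 * s) / 2)) ^ d := by
          rw [← Real.exp_nat_mul]; congr 1; ring
      _ ≤ _ := pow_le_pow_left₀ (Real.exp_pos _).le h9 _
  calc _ = 1 / 2 * (Real.exp (-(d / 2 * (s * (1 + 2 * s)))) * ballVol d) := by ring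
    _ ≤ 1 / 2 * (r ^ d * ballVol d) := by gcongr; exact (ballVol_pos d).le
    _ ≤ volume.real T := hT
    _ = volume.real ((fun y => c + y) '' T) := by
      rw [Measure.real, Measure.real, Set.image_add_left, measure_preimage_add]
    _ ≤ _ := measureReal_mono hsub
      ((measure_mono (fun x hx => hx.1)).trans_lt (measure_ball_lt_top (x := (0 : E d)) (r := 1))).ne

end Sphere

/-! ### Independent coordinates -/

section Product

variable {ι Ω : Type*} [MeasurableSpace Ω]

lemma measurable_update_pair [DecidableEq ι] (i : ι) :
    Measurable (fun z : Ω × (ι → Ω) => Function.update z.2 i z.1) := by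
  rw [measurable_pi_iff]
  intro j
  by_cases h : j = i
  · subst h; simpa using measurable_fst
  · simp only [Function.update_of_ne h]
    exact (measurable_pi_apply j).comp measurable_snd

lemma measurable_card_filter {κ X : Type*} [MeasurableSpace X] (T : Finset κ) (P : κ → X → Prop)
    [∀ x, DecidablePred fun k => P k x] (hP : ∀ k ∈ T, MeasurableSet {x | P k x}) :
    Measurable (fun x => ((T.filter fun k => P k x).card : ℝ)) := by
  simp only [Finset.card_filter, Nat.cast_sum]
  refine Finset.measurable_sum _ fun k hk => ?_
  exact measurable_from_top.comp (Measurable.ite (hP k hk) measurable_const measurable_const)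

/-- Markov's inequality for the number of events that occur. -/
lemma card_filter_markov {κ X : Type*} [MeasurableSpace X] (m : Measure X) (T : Finset κ)
    (P : κ → X → Prop) [∀ x, DecidablePred fun k => P k x] (hP : ∀ k ∈ T, MeasurableSet {x | P k x}) {c M : ℝ} (hM : 0 < M)
    (h : ∀ k ∈ T, m {x | P k x} ≤ ENNReal.ofReal c) :
    m {x | M ≤ ((T.filter fun k => P k x).card : ℝ)} ≤ ENNReal.ofReal (T.card * c / M) := by
  have e : ∀ x, ENNReal.ofReal ((T.filter fun k => P k x).card : ℝ) =
      ∑ k ∈ T, {x | P k x}.indicator 1 x := by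
    intro x
    rw [ENNReal.ofReal_natCast, Finset.card_filter, Nat.cast_sum]
    refine Finset.sum_congr rfl fun k _ => ?_
    by_cases hk : P k x <;> simp [hk]
  calc m {x | M ≤ ((T.filter fun k => P k x).card : ℝ)}
      ≤ m {x | ENNReal.ofReal M ≤ ∑ k ∈ T, {x | P k x}.indicator 1 x} := by
        refine measure_mono fun x hx => ?_
        rw [Set.mem_ofPred_eq, ← e]
        exact ENNReal.ofReal_le_ofReal hx
    _ ≤ (∫⁻ x, ∑ k ∈ T, {x | P k x}.indicator 1 x ∂m) / ENNReal.ofReal M :=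
        meas_ge_le_lintegral_div (Finset.aemeasurable_fun_sum _ fun k hk =>
          (measurable_one.indicator (hP k hk)).aemeasurable) (by simpa using hM)
          ENNReal.ofReal_ne_top
    _ ≤ (T.card * ENNReal.ofReal c) / ENNReal.ofReal M := by
        gcongr
        rw [lintegral_finsetSum' _ fun k hk => (measurable_one.indicator (hP k hk)).aemeasurable]
        calc _ ≤ ∑ k ∈ T, ENNReal.ofReal c := Finset.sum_le_sum fun k hk => by
              rw [lintegral_indicator_one (hP k hk)]; exact h k hk
          _ = _ := by simp
    _ = _ := by
        rw [ENNReal.ofReal_div_of_pos hM, ENNReal.ofReal_mul (Nat.cast_nonneg _),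
          ENNReal.ofReal_natCast]

variable [Fintype ι] (ν : ι → Measure Ω) [∀ i, IsProbabilityMeasure (ν i)]

lemma integrable_exp_card (T : Finset ι) (S : Set Ω) [DecidablePred (· ∈ S)] (hS : MeasurableSet S) (θ : ℝ) :
    Integrable (fun x : ι → Ω => Real.exp (θ * (T.filter fun j => x j ∈ S).card))
      (Measure.pi ν) := by
  refine Integrable.of_bound (C := Real.exp (|θ| * T.card)) ?_ (ae_of_all _ fun x => ?_)
  · exact (Real.measurable_exp.comp
      ((measurable_card_filter T (fun j (x : ι → Ω) => x j ∈ S)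
      fun j _ => measurable_pi_apply j hS).const_mul θ)).aestronglyMeasurable
  · rw [Real.norm_eq_abs, Real.abs_exp, Real.exp_le_exp]
    have : ((T.filter fun j => x j ∈ S).card : ℝ) ≤ T.card := by
      exact_mod_cast Finset.card_filter_le _ _
    exact mul_le_mul (le_abs_self θ) this (by positivity) (abs_nonneg θ)

variable [DecidableEq ι]

/-- Moment generating function of the number of coordinates in a set. -/
lemma integral_exp_card_le (T : Finset ι) (S : Set Ω) [DecidablePred (· ∈ S)] (hS : MeasurableSet S) (θ : ℝ) :
    ∫ x, Real.exp (θ * (T.filter fun j => x j ∈ S).card) ∂Measure.pi ν ≤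
      Real.exp ((Real.exp θ - 1) * ∑ j ∈ T, (ν j).real S) := by
  -- The exponential of a count is a product of functions of single coordinates, so independence
  -- turns its expectation into a product; then `1 + x ≤ e^x` is applied to each factor.
  let f : ι → Ω → ℝ := fun i y => if i ∈ T then (if y ∈ S then Real.exp θ else 1) else 1
  have e : ∀ x : ι → Ω, Real.exp (θ * (T.filter fun j => x j ∈ S).card) = ∏ i, f i (x i) := by
    intro x
    rw [mul_comm, Real.exp_nat_mul, ← Finset.prod_const, Finset.prod_filter]
    rw [Finset.prod_ite_mem]
    simp
  simp_rw [e]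
  rw [integral_fintype_prod_eq_prod (𝕜 := ℝ) f]
  have h1 : ∀ i, ∫ y, f i y ∂ν i = if i ∈ T then 1 + (Real.exp θ - 1) * (ν i).real S else 1 := by
    intro i
    by_cases hi : i ∈ T
    · simp only [f, hi, if_true]
      have : (fun y => if y ∈ S then Real.exp θ else 1) =
          fun y => 1 + S.indicator (fun _ => Real.exp θ - 1) y := by
        ext y; by_cases hy : y ∈ S <;> simp [hy]
      rw [this, integral_add (integrable_const _) ((integrable_const _).indicator hS),
        integral_indicator_const _ hS]
      simp [mul_comm]
    · simp [f, hi]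
  simp_rw [h1]
  rw [Finset.prod_ite_mem, Finset.univ_inter, Finset.mul_sum, Real.exp_sum]
  refine Finset.prod_le_prod (fun i _ => ?_) fun i _ => ?_
  · have h1 : (ν i).real S ≤ 1 := measureReal_le_one
    have h2 : 0 ≤ (ν i).real S := measureReal_nonneg
    nlinarith [Real.exp_pos θ]
  · linarith [Real.add_one_le_exp ((Real.exp θ - 1) * (ν i).real S)]

/-- Chernoff bound with parameter `-1`: as `1/e < 1/2`, the exponent is at most `m lo/4 - m lo/2`,
where `m` is the number of trials. -/
lemma card_le_tail (T : Finset ι) (S : Set Ω) [DecidablePred (· ∈ S)] (hS : MeasurableSet S) {lo : ℝ}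
    (h : ∀ j ∈ T, lo ≤ (ν j).real S) :
    (Measure.pi ν).real {x | ((T.filter fun j => x j ∈ S).card : ℝ) ≤ T.card * lo / 4} ≤
      Real.exp (-(T.card * lo / 4)) := by
  have h1 := mul_meas_ge_le_integral_of_nonneg (μ := Measure.pi ν)
    (ae_of_all _ fun x => (Real.exp_pos (-1 * ((T.filter fun j => x j ∈ S).card : ℝ))).le)
    (integrable_exp_card ν T S hS (-1)) (Real.exp (-1 * (T.card * lo / 4)))
  have h2 := h1.trans (integral_exp_card_le ν T S hS (-1))
  have e : {x : ι → Ω | Real.exp (-1 * (T.card * lo / 4)) ≤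
      Real.exp (-1 * ((T.filter fun j => x j ∈ S).card : ℝ))} =
      {x | ((T.filter fun j => x j ∈ S).card : ℝ) ≤ T.card * lo / 4} := by
    ext x
    simp only [Set.mem_ofPred_eq, Real.exp_le_exp]
    constructor <;> intro h <;> linarith
  rw [e, mul_comm, ← le_div_iff₀ (Real.exp_pos _), ← Real.exp_sub] at h2
  refine h2.trans (Real.exp_le_exp.2 ?_)
  have h3 : (T.card : ℝ) * lo ≤ ∑ j ∈ T, (ν j).real S := by
    rw [← nsmul_eq_mul]; exact Finset.card_nsmul_le_sum _ _ _ h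
  have h4 : 0 ≤ ∑ j ∈ T, (ν j).real S := Finset.sum_nonneg fun _ _ => measureReal_nonneg
  have h5 : Real.exp (-1) < 1 / 2 := Real.exp_neg_one_lt_half
  nlinarith

/-- Chernoff bound with parameter `1`: as `e - 1 < 2`, the exponent is at most `2 m hi - 4 m hi`,
where `m` is the number of trials. -/
lemma le_card_tail (T : Finset ι) (S : Set Ω) [DecidablePred (· ∈ S)] (hS : MeasurableSet S) {hi : ℝ}
    (h : ∀ j ∈ T, (ν j).real S ≤ hi) :
    (Measure.pi ν).real {x | 4 * (T.card * hi) ≤ ((T.filter fun j => x j ∈ S).card : ℝ)} ≤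
      Real.exp (-(2 * (T.card * hi))) := by
  have h1 := mul_meas_ge_le_integral_of_nonneg (μ := Measure.pi ν)
    (ae_of_all _ fun x => (Real.exp_pos (1 * ((T.filter fun j => x j ∈ S).card : ℝ))).le)
    (integrable_exp_card ν T S hS 1) (Real.exp (1 * (4 * (T.card * hi))))
  have h2 := h1.trans (integral_exp_card_le ν T S hS 1)
  simp only [Real.exp_le_exp, one_mul] at h2
  rw [mul_comm, ← le_div_iff₀ (Real.exp_pos _), ← Real.exp_sub] at h2
  refine h2.trans (Real.exp_le_exp.2 ?_)
  have h3 : ∑ j ∈ T, (ν j).real S ≤ (T.card : ℝ) * hi := by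
    rw [← nsmul_eq_mul]; exact Finset.sum_le_card_nsmul _ _ _ h
  have h4 : 0 ≤ ∑ j ∈ T, (ν j).real S := Finset.sum_nonneg fun _ _ => measureReal_nonneg
  have h5 : Real.exp 1 < 3 := by have := Real.exp_one_lt_d9; linarith
  nlinarith

/-- A coordinate of a random vector with independent coordinates may be drawn anew. -/
lemma map_update_pi (i : ι) :
    ((ν i).prod (Measure.pi ν)).map (fun z : Ω × (ι → Ω) => Function.update z.2 i z.1) =
      Measure.pi ν := by
  symm
  apply Measure.pi_eq
  intro s hs
  have e : (fun z : Ω × (ι → Ω) => Function.update z.2 i z.1) ⁻¹' (Set.univ.pi s) =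
      s i ×ˢ Set.univ.pi (Function.update s i Set.univ) := by
    ext ⟨y, x⟩
    simp only [Set.mem_preimage, Set.mem_univ_pi, Set.mem_prod]
    constructor
    · intro h
      refine ⟨by simpa using h i, fun j => ?_⟩
      by_cases hj : j = i
      · subst hj; simp
      · simpa [Function.update_of_ne hj] using h j
    · rintro ⟨h1, h2⟩ j
      by_cases hj : j = i
      · subst hj; simpa using h1
      · simpa [Function.update_of_ne hj] using h2 j
  rw [Measure.map_apply (measurable_update_pair i) (MeasurableSet.univ_pi hs), e,
    Measure.prod_prod, Measure.pi_pi, ← Finset.mul_prod_erase _ _ (Finset.mem_univ i),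
    ← Finset.mul_prod_erase Finset.univ (fun j => ν j (s j)) (Finset.mem_univ i)]
  simp only [Function.update_self, measure_univ, one_mul]
  congr 1
  refine Finset.prod_congr rfl fun j hj => ?_
  rw [Function.update_of_ne (Finset.ne_of_mem_erase hj)]

/-- Fubini after redrawing coordinate `i`. The outer integral still runs over all coordinates, but
the old value of coordinate `i` is overwritten, so no splitting of the index set is needed. -/
lemma pi_eq_lintegral (i : ι) {A : Set (ι → Ω)} (hA : MeasurableSet A) :
    Measure.pi ν A = ∫⁻ x, ν i {y | Function.update x i y ∈ A} ∂Measure.pi ν := by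
  conv_lhs => rw [← map_update_pi ν i]
  rw [Measure.map_apply (measurable_update_pair i) hA,
    Measure.prod_apply_symm (measurable_update_pair i hA)]
  rfl

lemma pi_eq_lintegral_coord (i : ι) {A : Set (ι → Ω)} (hA : MeasurableSet A) :
    Measure.pi ν A = ∫⁻ y, Measure.pi ν {x | Function.update x i y ∈ A} ∂ν i := by
  conv_lhs => rw [← map_update_pi ν i]
  rw [Measure.map_apply (measurable_update_pair i) hA,
    Measure.prod_apply (measurable_update_pair i hA)]
  rfl

/-- Conditioning on a coordinate. -/
lemma pi_le_of_forall_coord (i : ι) {A : Set (ι → Ω)} (hA : MeasurableSet A) {c : ENNReal}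
    (h : ∀ᵐ y ∂ν i, Measure.pi ν {x | Function.update x i y ∈ A} ≤ c) : Measure.pi ν A ≤ c := by
  rw [pi_eq_lintegral_coord ν i hA]
  calc _ ≤ ∫⁻ _, c ∂ν i := lintegral_mono_ae h
    _ = c := by simp

/-- Conditioning on all coordinates but one. -/
lemma pi_le_mul (i : ι) {A B : Set (ι → Ω)} (hA : MeasurableSet A) (hB : MeasurableSet B)
    {w : ENNReal} (hAB : ∀ x y, Function.update x i y ∈ A → x ∈ B)
    (h : ∀ x ∈ B, ν i {y | Function.update x i y ∈ A} ≤ w) :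
    Measure.pi ν A ≤ w * Measure.pi ν B := by
  rw [pi_eq_lintegral ν i hA, ← lintegral_indicator_const hB]
  refine lintegral_mono fun x => ?_
  by_cases hx : x ∈ B
  · simpa [hx] using h x hx
  · have : {y | Function.update x i y ∈ A} = ∅ := by
      ext y; simpa using fun hy => hx (hAB x y hy)
    simp [this]

end Product

/-! ### Random starts -/

section Starts

variable {n : ℕ} [NeZero n]

instance : IsProbabilityMeasure (startLaw n) := by unfold startLaw; infer_instance

/-- The starts are independent, so the probability is `(1 - |G|/n)^R`, and `1 - x ≤ e^(-x)`. -/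
lemma startLaw_avoid_le (G : Finset (Fin n)) (R : ℕ) :
    startLaw n {ω | ∀ k < R, ω k ∉ G} ≤ ENNReal.ofReal (Real.exp (-(R * (G.card / n)))) := by
  have e : {ω : ℕ → Fin n | ∀ k < R, ω k ∉ G} =
      Set.pi (Finset.range R : Set ℕ) (fun _ => {i | i ∉ G}) := by
    ext ω; simp [Set.mem_pi]
  have hn : (0 : ℝ) < n := by exact_mod_cast Nat.pos_of_ne_zero (NeZero.ne n)
  have hc : (PMF.uniformOfFintype (Fin n)).toMeasure {i | i ∉ G} =
      ENNReal.ofReal (1 - G.card / n) := by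
    rw [PMF.toMeasure_uniformOfFintype_apply _ (MeasurableSet.of_discrete)]
    have : Fintype.card {i : Fin n // i ∈ {i | i ∉ G}} = n - G.card := by
      simp
    have hle : G.card ≤ n := by simpa using Finset.card_le_univ G
    have e2 : (1 - G.card / n : ℝ) = ((n - G.card : ℕ) : ℝ) / n := by
      rw [Nat.cast_sub hle]; field_simp
    rw [e2, ENNReal.ofReal_div_of_pos hn, ENNReal.ofReal_natCast, ENNReal.ofReal_natCast,
      Fintype.card_fin]
    congr 2
  rw [e, startLaw, Measure.infinitePi_pi _ (fun _ _ => MeasurableSet.of_discrete),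
    Finset.prod_const, hc, Finset.card_range, ← ENNReal.ofReal_pow]
  · refine ENNReal.ofReal_le_ofReal ?_
    have h1 : (1 - G.card / n : ℝ) ≤ Real.exp (-(G.card / n)) := Real.one_sub_le_exp_neg _
    have h0 : (0 : ℝ) ≤ 1 - G.card / n := by
      rw [sub_nonneg, div_le_one hn]
      exact_mod_cast (by simpa using Finset.card_le_univ G : G.card ≤ n)
    calc _ ≤ Real.exp (-(G.card / n)) ^ R := pow_le_pow_left₀ h0 h1 _
      _ = _ := by rw [← Real.exp_nat_mul]; congr 1; ring
  · rw [sub_nonneg, div_le_one hn]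
    exact_mod_cast (by simpa using Finset.card_le_univ G : G.card ≤ n)

open Classical in
/-- Independent random starts hit one of many good labels. -/
lemma prod_startLaw_avoid_le {Ω : Type*} [MeasurableSpace Ω] (ν : Measure Ω)
    [IsProbabilityMeasure ν] (good : Fin n → Set Ω) (hgood : ∀ i, MeasurableSet (good i))
    (R : ℕ) (g : ℝ) :
    (ν.prod (startLaw n)) {z | g ≤ ((Finset.univ.filter fun i => z.1 ∈ good i).card : ℝ) ∧
      ∀ k < R, z.1 ∉ good (z.2 k)} ≤ ENNReal.ofReal (Real.exp (-(R * (g / n)))) := by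
  have hm : MeasurableSet {z : Ω × (ℕ → Fin n) |
      g ≤ ((Finset.univ.filter fun i => z.1 ∈ good i).card : ℝ) ∧
      ∀ k < R, z.1 ∉ good (z.2 k)} := by
    rw [Set.ofPred_and]
    refine MeasurableSet.inter (measurableSet_le measurable_const ?_) ?_
    · exact measurable_card_filter _ (fun i (z : Ω × (ℕ → Fin n)) => z.1 ∈ good i)
        fun i _ => measurable_fst (hgood i)
    · have e : {z : Ω × (ℕ → Fin n) | ∀ k < R, z.1 ∉ good (z.2 k)} =
          ⋂ k ∈ Finset.range R, ⋃ i : Fin n,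
            ((Prod.fst ⁻¹' (good i)ᶜ) ∩ {z : Ω × (ℕ → Fin n) | z.2 k = i}) := by
        ext z; simp
      rw [e]
      refine Finset.measurableSet_biInter _ fun k _ => MeasurableSet.iUnion fun i => ?_
      refine (measurable_fst (hgood i).compl).inter ?_
      have hk : Measurable fun z : Ω × (ℕ → Fin n) => z.2 k :=
        (measurable_pi_apply k).comp measurable_snd
      exact hk (measurableSet_singleton i)
  rw [Measure.prod_apply hm]
  calc _ ≤ ∫⁻ _, ENNReal.ofReal (Real.exp (-(R * (g / n)))) ∂ν := by
        refine lintegral_mono fun x => ?_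
        by_cases hx : g ≤ ((Finset.univ.filter fun i => x ∈ good i).card : ℝ)
        · refine le_trans (measure_mono ?_) ((startLaw_avoid_le
            (Finset.univ.filter fun i => x ∈ good i) R).trans (ENNReal.ofReal_le_ofReal ?_))
          · rintro ω ⟨-, h⟩ k hk
            simpa using h k hk
          · gcongr
        · have : Prod.mk x ⁻¹' {z : Ω × (ℕ → Fin n) |
              g ≤ ((Finset.univ.filter fun i => z.1 ∈ good i).card : ℝ) ∧
              ∀ k < R, z.1 ∉ good (z.2 k)} = ∅ := by
            ext ω; simp only [Set.mem_preimage, Set.mem_ofPred_eq, Set.mem_empty_iff_false,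
              iff_false, not_and]; exact fun h => absurd h hx
          rw [this]; simp
    _ = _ := by simp

end Starts

/-! ### Caps in the sparse regime -/

/-- The sparse regime: `log n = o(d)`, `log d = o(log n)`, and `n = 1 / C(μ)`. -/
structure Sparse (n : ℕ → ℕ) (μ : ℕ → ℝ) : Prop where
  pos : ∀ d, 0 < n d
  eq_inv : ∀ᶠ d in atTop, (n d : ℝ) = 1 / capVolume d (μ d)
  log_small : (fun d => Real.log (n d)) =o[atTop] (fun d : ℕ => (d : ℝ))
  log_large : (fun d : ℕ => Real.log d) =o[atTop] (fun d => Real.log (n d))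

lemma capVolume_eq {d : ℕ} (hd : 0 < d) (a : ℝ) :
    capVolume d a = (sphereLaw d).real {x | a ≤ ⟪x, EuclideanSpace.single ⟨0, hd⟩ (1 : ℝ)⟫} := by
  rw [capVolume]
  congr 1
  ext x
  simp [hd, EuclideanSpace.inner_single_right]

lemma exists_unit_orthogonal {d : ℕ} (hd : 2 ≤ d) (p : E d) : ∃ u : E d, ‖u‖ = 1 ∧ ⟪p, u⟫ = 0 := by
  have h : (ℝ ∙ p)ᗮ ≠ ⊥ := by
    rw [Ne, Submodule.orthogonal_eq_bot_iff]
    intro h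
    have h1 := finrank_span_le_card (R := ℝ) ({p} : Set (E d))
    rw [h, finrank_top, finrank_euclideanSpace, Fintype.card_fin, Set.toFinset_singleton,
      Finset.card_singleton] at h1
    omega
  obtain ⟨v, hv, hv0⟩ := Submodule.exists_mem_ne_zero_of_ne_bot h
  refine ⟨‖v‖⁻¹ • v, ?_, ?_⟩
  · rw [norm_smul, norm_inv, norm_norm, inv_mul_cancel₀ (norm_ne_zero_iff.2 hv0)]
  · rw [real_inner_smul_right, Submodule.mem_orthogonal_singleton_iff_inner_right.1 hv, mul_zero]

lemma four_mul_exp_le : 4 * Real.exp (-(9 / 2)) ≤ 1 / 2 := by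
  have h1 : (8 : ℝ) ≤ Real.exp (9 / 2) := by
    have h2 : (5 / 2 : ℝ) ≤ Real.exp (3 / 2) := by
      have := Real.add_one_le_exp (3 / 2 : ℝ); linarith
    have h3 : Real.exp (9 / 2) = Real.exp (3 / 2) ^ 3 := by
      rw [← Real.exp_nat_mul]; norm_num
    rw [h3]
    calc (8 : ℝ) ≤ (5 / 2) ^ 3 := by norm_num
      _ ≤ _ := pow_le_pow_left₀ (by norm_num) h2 3
  rw [Real.exp_neg, ← div_eq_mul_inv, div_le_iff₀ (Real.exp_pos _)]
  linarith

/-- `le_sphereLaw_wedge` with the width `3 / √d`. -/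
lemma le_wedge {d : ℕ} (hd : 0 < d) {q u : E d} (hq : ‖q‖ = 1) (hu : ‖u‖ = 1) (hqu : ⟪q, u⟫ = 0)
    {a b s : ℝ} (ha : 0 ≤ a) (hb : 0 ≤ b)
    (hs : s = (a + 6 / √d) ^ 2 + (b + 6 / √d) ^ 2) (hs2 : s ≤ 1 / 2) :
    1 / 2 * Real.exp (-(d / 2 * (s * (1 + 2 * s)))) ≤
      (sphereLaw d).real {x | a ≤ ⟪x, q⟫ ∧ b ≤ ⟪x, u⟫} := by
  have hd' : (0 : ℝ) < d := by exact_mod_cast hd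
  have hsq : 0 < √(d : ℝ) := Real.sqrt_pos.2 hd'
  refine le_sphereLaw_wedge hd hq hu hqu ha hb (τ := 3 / √d) (by positivity) ?_ ?_ hs2
  · have : (d : ℝ) * (3 / √d) ^ 2 / 2 = 9 / 2 := by
      rw [div_pow, Real.sq_sqrt hd'.le]; field_simp; norm_num
    rw [this]
    exact four_mul_exp_le
  · rw [hs]; ring

namespace Sparse

variable {n : ℕ → ℕ} {μ : ℕ → ℝ}

lemma tendsto_log (h : Sparse n μ) : Tendsto (fun d => Real.log (n d)) atTop atTop := by
  have h1 : Tendsto (fun d : ℕ => Real.log d) atTop atTop :=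
    Real.tendsto_log_atTop.comp tendsto_natCast_atTop_atTop
  have h2 := h.log_large.bound one_pos
  refine tendsto_atTop_mono' _ ?_ h1
  filter_upwards [h2] with d hd
  have h3 : 0 ≤ Real.log (n d) := Real.log_natCast_nonneg _
  rw [Real.norm_eq_abs, Real.norm_eq_abs, abs_of_nonneg h3, one_mul] at hd
  exact (le_abs_self _).trans hd

lemma rpow_eq (h : Sparse n μ) (d : ℕ) (x : ℝ) :
    (n d : ℝ) ^ x = Real.exp (x * Real.log (n d)) := by
  rw [Real.rpow_def_of_pos (by exact_mod_cast h.pos d), mul_comm]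

lemma tendsto_rpow (h : Sparse n μ) {x : ℝ} (hx : 0 < x) :
    Tendsto (fun d => (n d : ℝ) ^ x) atTop atTop := by
  simp_rw [h.rpow_eq]
  exact Real.tendsto_exp_atTop.comp (h.tendsto_log.const_mul_atTop hx)

lemma le_rpow (h : Sparse n μ) {x : ℝ} (hx : 0 < x) (C : ℝ) :
    ∀ᶠ d in atTop, C ≤ (n d : ℝ) ^ x := (h.tendsto_rpow hx).eventually_ge_atTop C

lemma dim_le_rpow (h : Sparse n μ) {x : ℝ} (hx : 0 < x) :
    ∀ᶠ d : ℕ in atTop, (d : ℝ) ≤ (n d : ℝ) ^ x := by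
  filter_upwards [h.log_large.bound hx, eventually_gt_atTop 0] with d hd hd0
  have h3 : 0 ≤ Real.log (n d) := Real.log_natCast_nonneg _
  have h4 : 0 ≤ Real.log (d : ℝ) := Real.log_natCast_nonneg _
  rw [Real.norm_eq_abs, Real.norm_eq_abs, abs_of_nonneg h3, abs_of_nonneg h4] at hd
  rw [h.rpow_eq, ← Real.log_le_iff_le_exp (by exact_mod_cast hd0)]
  exact hd

lemma log_le_dim (h : Sparse n μ) {x : ℝ} (hx : 0 < x) :
    ∀ᶠ d : ℕ in atTop, Real.log (n d) ≤ x * d := by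
  filter_upwards [h.log_small.bound hx] with d hd
  have h3 : 0 ≤ Real.log (n d) := Real.log_natCast_nonneg _
  rw [Real.norm_eq_abs, Real.norm_eq_abs, abs_of_nonneg h3, abs_of_nonneg (Nat.cast_nonneg d)] at hd
  exact hd

lemma log_eq (h : Sparse n μ) :
    ∀ᶠ d in atTop, 0 < d ∧ capVolume d (μ d) = Real.exp (-Real.log (n d)) := by
  filter_upwards [h.eq_inv, eventually_gt_atTop 0] with d hd h0
  refine ⟨h0, ?_⟩
  rw [Real.exp_neg, Real.exp_log (by exact_mod_cast h.pos d), hd, one_div, inv_inv]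

lemma capVolume_anti {d : ℕ} (hd : 0 < d) {a b : ℝ} (hab : a ≤ b) :
    capVolume d b ≤ capVolume d a := by
  have := isProbabilityMeasure_sphereLaw hd
  rw [capVolume_eq hd, capVolume_eq hd]
  exact measureReal_mono fun x hx => hab.trans hx

/-- A cap of constant height has volume exponentially small in `d`, whereas `C(μ) = 1/n` is only
`e^(-o(d))`; hence `μ → 0`. -/
lemma mu_le (h : Sparse n μ) {θ : ℝ} (hθ : 0 < θ) : ∀ᶠ d in atTop, μ d ≤ θ := by
  set t := min θ (1 / 2) with ht
  have ht0 : 0 < t := by positivity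
  have ht2 : t ^ 2 ≤ 1 / 2 := by
    have : t ≤ 1 / 2 := min_le_right _ _
    nlinarith
  filter_upwards [h.log_eq, h.log_le_dim (by positivity : 0 < t ^ 2 / 4)] with d ⟨hd, h1⟩ h2
  by_contra! hlt
  have h3 : capVolume d (μ d) ≤ Real.exp (-(d * t ^ 2 / 2)) := by
    refine (capVolume_anti hd ((min_le_left _ _ : t ≤ θ).trans hlt.le)).trans ?_
    rw [capVolume_eq hd]
    exact sphereLaw_cap_le hd (by simp) ht0.le ht2
  rw [h1, Real.exp_le_exp] at h3
  have hd' : (0 : ℝ) < d := by exact_mod_cast hd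
  nlinarith [mul_pos hd' (pow_pos ht0 2)]

lemma inv_sqrt_dim_le {θ : ℝ} (hθ : 0 < θ) : ∀ᶠ d : ℕ in atTop, 6 / √(d : ℝ) ≤ θ := by
  have h : Tendsto (fun d : ℕ => √(d : ℝ)) atTop atTop :=
    Real.tendsto_sqrt_atTop.comp tendsto_natCast_atTop_atTop
  filter_upwards [h.eventually_ge_atTop (6 / θ), eventually_gt_atTop 0] with d hd h0
  have : 0 < √(d : ℝ) := Real.sqrt_pos.2 (by exact_mod_cast h0)
  rw [div_le_iff₀ this]
  rw [div_le_iff₀ hθ] at hd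
  linarith

/-- This is the lower bound on wedges with second height `0`, applied to `C(μ) = 1/n`. The positive
part of `μ` appears because `μ > 0` is only deduced from this bound, in `mu_pos`. -/
lemma log_le_aux (h : Sparse n μ) {η : ℝ} (hη : 0 < η) (hη1 : η ≤ 1 / 2) :
    ∀ᶠ d : ℕ in atTop, Real.log (n d) ≤
      Real.log 2 + (1 + 2 * η) / 2 * ((max (μ d) 0 * √d + 6) ^ 2 + 36) := by
  have hη2 : 0 < √(η / 8) := by positivity
  filter_upwards [h.log_eq, h.mu_le hη2, inv_sqrt_dim_le hη2, eventually_ge_atTop 2]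
    with d ⟨hd, h1⟩ h2 h3 hd2
  set a := max (μ d) 0 with ha
  have hd' : (0 : ℝ) < d := by exact_mod_cast hd
  have hsq : 0 < √(d : ℝ) := Real.sqrt_pos.2 hd'
  have hss : √(d : ℝ) ^ 2 = d := Real.sq_sqrt hd'.le
  have ha0 : 0 ≤ a := le_max_right _ _
  have ha1 : a ≤ √(η / 8) := max_le h2 hη2.le
  have hη3 : √(η / 8) ^ 2 = η / 8 := Real.sq_sqrt (by positivity)
  have h6 : 0 ≤ 6 / √(d : ℝ) := by positivity
  obtain ⟨u, hu, hqu⟩ := exists_unit_orthogonal hd2 (EuclideanSpace.single ⟨0, hd⟩ (1 : ℝ))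
  set s := (a + 6 / √d) ^ 2 + (0 + 6 / √d) ^ 2 with hs
  have hsη : s ≤ η := by
    have e1 : (a + 6 / √d) ^ 2 ≤ (√(η / 8) + √(η / 8)) ^ 2 :=
      pow_le_pow_left₀ (by positivity) (add_le_add ha1 h3) 2
    have e2 : (0 + 6 / √d) ^ 2 ≤ (0 + √(η / 8)) ^ 2 :=
      pow_le_pow_left₀ (by positivity) (add_le_add_right h3 _) 2
    rw [hs]; nlinarith
  have hs0 : 0 ≤ s := by positivity
  have := isProbabilityMeasure_sphereLaw hd
  have h4 := le_wedge hd (by simp) hu hqu ha0 le_rfl hs (hsη.trans hη1)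
  have h5 : capVolume d (μ d) ≥ 1 / 2 * Real.exp (-(d / 2 * (s * (1 + 2 * s)))) := by
    rw [capVolume_eq hd]
    refine h4.trans (measureReal_mono fun x hx => ?_)
    exact (le_max_left _ _).trans hx.1
  have e2 : (1 / 2 : ℝ) = Real.exp (-Real.log 2) := by
    rw [Real.exp_neg, Real.exp_log two_pos, one_div]
  rw [h1, e2, ← Real.exp_add, ge_iff_le, Real.exp_le_exp] at h5
  have e3 : (d : ℝ) * s = (a * √d + 6) ^ 2 + 36 := by
    have x1 : √(d : ℝ) * (6 / √d) = 6 := by field_simp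
    calc (d : ℝ) * s = (a * √d + √d * (6 / √d)) ^ 2 + (√d * (6 / √d)) ^ 2 := by
          rw [hs, ← hss]; simp only [hss]; ring_nf; simp only [hss]; ring
      _ = _ := by rw [x1]; ring
  have e4 : d / 2 * (s * (1 + 2 * s)) ≤ (1 + 2 * η) / 2 * (d * s) := by
    have : (d * s) * (1 + 2 * s) ≤ (d * s) * (1 + 2 * η) :=
      mul_le_mul_of_nonneg_left (by linarith) (by positivity)
    linarith
  rw [e3] at e4
  linarith

/-- If `μ√d` stayed bounded, `log_le_aux` would bound `log n`. So `μ` dominates the width `6/√d`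
lost in the volume estimates. -/
lemma le_mu_mul_sqrt (h : Sparse n μ) {M : ℝ} (hM : 0 < M) :
    ∀ᶠ d : ℕ in atTop, M ≤ μ d * √d := by
  filter_upwards [h.log_le_aux one_half_pos le_rfl,
    h.tendsto_log.eventually_gt_atTop (Real.log 2 + ((M + 6) ^ 2 + 36))] with d h1 h2
  by_contra! hlt
  have h3 : max (μ d) 0 * √d ≤ M := by
    rw [max_mul_of_nonneg _ _ (Real.sqrt_nonneg _), zero_mul]
    exact max_le hlt.le hM.le
  have h4 : 0 ≤ max (μ d) 0 * √(d : ℝ) := mul_nonneg (le_max_right _ _) (Real.sqrt_nonneg _)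
  nlinarith

lemma mu_pos (h : Sparse n μ) : ∀ᶠ d in atTop, 0 < μ d := by
  filter_upwards [h.le_mu_mul_sqrt one_pos] with d hd
  by_contra! hle
  nlinarith [Real.sqrt_nonneg (d : ℝ)]

lemma dim_mul_sq_le (h : Sparse n μ) : ∀ᶠ d : ℕ in atTop, d * μ d ^ 2 / 2 ≤ Real.log (n d) := by
  filter_upwards [h.log_eq, h.mu_le one_half_pos, h.mu_pos] with d ⟨hd, h1⟩ h2 h3
  have h4 : capVolume d (μ d) ≤ Real.exp (-(d * μ d ^ 2 / 2)) := by
    rw [capVolume_eq hd]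
    exact sphereLaw_cap_le hd (by simp) h3.le (by nlinarith)
  rw [h1, Real.exp_le_exp] at h4
  linarith

/-- Together with `dim_mul_sq_le` this says `log n = (1+o(1)) d μ²/2`, the dictionary between
heights in units of `μ` and powers of `n`. -/
lemma log_le_dim_mul_sq (h : Sparse n μ) {η : ℝ} (hη : 0 < η) :
    ∀ᶠ d : ℕ in atTop, Real.log (n d) ≤ (1 + η) * (d * μ d ^ 2 / 2) := by
  wlog hη1 : η ≤ 1 generalizing η
  · filter_upwards [this one_pos le_rfl] with d hd
    have : 0 ≤ d * μ d ^ 2 / 2 := by positivity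
    nlinarith
  filter_upwards [h.log_le_aux (by positivity : 0 < η / 8) (by linarith),
    h.le_mu_mul_sqrt (by positivity : 0 < 400 / η), h.mu_pos] with d h1 h2 h3
  rw [max_eq_left h3.le] at h1
  have hl : Real.log 2 < 1 := by have := Real.log_two_lt_d9; linarith
  set l := μ d * √d with hldef
  have e : (d : ℝ) * μ d ^ 2 = l ^ 2 := by
    rw [hldef, mul_pow, Real.sq_sqrt (Nat.cast_nonneg d)]; ring
  rw [e]
  rw [div_le_iff₀ hη] at h2
  have h5 : 400 ≤ l := by nlinarith
  have h6 : 400 * l ≤ η * l ^ 2 := by nlinarith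
  -- With `l ≥ 400/η`, the linear term `12 l` and the constants are absorbed by `(η/4) l²`; the
  -- added `2` pays for `log 2`.
  have h7 : (l + 6) ^ 2 + 36 + 2 ≤ (1 + η / 4) * l ^ 2 := by nlinarith
  have h8 : (1 + 2 * (η / 8)) / 2 * ((l + 6) ^ 2 + 36 + 2) ≤
      (1 + 2 * (η / 8)) / 2 * ((1 + η / 4) * l ^ 2) := by gcongr
  have h9 : (1 + η / 4) * (1 + η / 4) ≤ 1 + η := by nlinarith
  have h10 : (1 + η / 4) * (1 + η / 4) * l ^ 2 ≤ (1 + η) * l ^ 2 := by gcongr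
  nlinarith

/-- Caps of height at least `t μ` have relative volume at most `n^(-t² + o(1))`. -/
lemma cap_le (h : Sparse n μ) {t ε : ℝ} (ht : 0 ≤ t) (hε : 0 < ε) :
    ∀ᶠ d in atTop, ∀ p : E d, ‖p‖ = 1 → ∀ a, t * μ d ≤ a →
      (sphereLaw d).real {x | a ≤ ⟪x, p⟫} ≤ (n d : ℝ) ^ (-t ^ 2 + ε) := by
  have hη : 0 < ε / (t ^ 2 + 1) := by positivity
  filter_upwards [h.log_le_dim_mul_sq hη, h.mu_pos, h.dim_mul_sq_le,
    h.mu_le (by positivity : 0 < 1 / (2 * (t + 1))), eventually_gt_atTop 0] with d h1 h2 h3 h4 hd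
  intro p hp a ha
  have := isProbabilityMeasure_sphereLaw hd
  have h5 : t * μ d ≤ 1 / 2 := by
    rw [le_div_iff₀ (by positivity)] at h4
    nlinarith
  have h6 : 0 ≤ t * μ d := by positivity
  calc _ ≤ (sphereLaw d).real {x | t * μ d ≤ ⟪x, p⟫} := measureReal_mono fun x hx => ha.trans hx
    _ ≤ Real.exp (-(d * (t * μ d) ^ 2 / 2)) := sphereLaw_cap_le hd hp h6 (by nlinarith)
    _ ≤ _ := by
      rw [h.rpow_eq, Real.exp_le_exp]
      set X := d * μ d ^ 2 / 2 with hX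
      have e : d * (t * μ d) ^ 2 / 2 = t ^ 2 * X := by rw [hX]; ring
      rw [e]
      set L := Real.log (n d)
      have hX0 : 0 ≤ X := by positivity
      have e2 : ε / (t ^ 2 + 1) * (t ^ 2 + 1) = ε := by field_simp
      have h7 : t ^ 2 * L ≤ t ^ 2 * ((1 + ε / (t ^ 2 + 1)) * X) := by gcongr
      have h8 : t ^ 2 * (ε / (t ^ 2 + 1)) * X ≤ ε * X := by
        gcongr; nlinarith
      have h9 : ε * X ≤ ε * L := by gcongr
      nlinarith

/-- Caps of constant height have negligible volume. -/
lemma cap_const_le (h : Sparse n μ) {θ : ℝ} (hθ : 0 < θ) (K : ℝ) :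
    ∀ᶠ d in atTop, ∀ p : E d, ‖p‖ = 1 →
      (sphereLaw d).real {x | θ ≤ ⟪x, p⟫} ≤ (n d : ℝ) ^ (-K) := by
  set t := min θ (1 / 2) with ht
  have ht0 : 0 < t := by positivity
  have ht2 : t ^ 2 ≤ 1 / 2 := by
    have : t ≤ 1 / 2 := min_le_right _ _
    nlinarith
  filter_upwards [h.log_le_dim (by positivity : 0 < t ^ 2 / 2 / (|K| + 1)),
    eventually_gt_atTop 0] with d h1 hd
  intro p hp
  have := isProbabilityMeasure_sphereLaw hd
  calc (sphereLaw d).real {x | θ ≤ ⟪x, p⟫} ≤ (sphereLaw d).real {x | t ≤ ⟪x, p⟫} :=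
        measureReal_mono fun x hx => (min_le_left θ (1 / 2)).trans hx
    _ ≤ Real.exp (-(d * t ^ 2 / 2)) := sphereLaw_cap_le hd hp ht0.le ht2
    _ ≤ _ := by
      rw [h.rpow_eq, Real.exp_le_exp, neg_mul, neg_le_neg_iff]
      have h0 : 0 ≤ Real.log (n d) := Real.log_natCast_nonneg _
      calc K * Real.log (n d) ≤ (|K| + 1) * Real.log (n d) := by
            gcongr; linarith [le_abs_self K]
        _ ≤ (|K| + 1) * (t ^ 2 / 2 / (|K| + 1) * d) := by gcongr
        _ = _ := by field_simp

/-- Wedges of heights `s μ` and `t μ` in orthogonal directions have relative volume at least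
`n^(-(s² + t²) - o(1))`. -/
lemma le_wedge (h : Sparse n μ) {s t ε : ℝ} (hs : 0 ≤ s) (ht : 0 ≤ t) (hε : 0 < ε) :
    ∀ᶠ d in atTop, ∀ q u : E d, ‖q‖ = 1 → ‖u‖ = 1 → ⟪q, u⟫ = 0 →
      (n d : ℝ) ^ (-(s ^ 2 + t ^ 2) - ε) ≤
        (sphereLaw d).real {x | s * μ d ≤ ⟪x, q⟫ ∧ t * μ d ≤ ⟪x, u⟫} := by
  -- Three losses share `ε`: `ζμ` bounds the shift `6/√d`, `ξ` bounds the second-order term `1 +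
  -- 2S`, and `n^(ε/2) ≥ 2` absorbs the factor `1/2`.
  set ζ := min 1 (ε / (8 * (s + t + 1))) with hζ
  have hζ0 : 0 < ζ := by positivity
  have hζ1 : ζ ≤ 1 := min_le_left _ _
  have hζ2 : ζ * (8 * (s + t + 1)) ≤ ε := by
    rw [← le_div_iff₀ (by positivity)]; exact min_le_right _ _
  set B := (s + ζ) ^ 2 + (t + ζ) ^ 2 with hB
  have hB0 : 0 < B := by positivity
  have hB1 : B ≤ s ^ 2 + t ^ 2 + ε / 4 := by rw [hB]; nlinarith
  set ξ := min (1 / 2) (ε / (8 * B)) with hξ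
  have hξ0 : 0 < ξ := by positivity
  have hξ2 : ξ * (8 * B) ≤ ε := by
    rw [← le_div_iff₀ (by positivity)]; exact min_le_right _ _
  filter_upwards [h.mu_pos, h.mu_le (by positivity : 0 < √(ξ / B)), h.dim_mul_sq_le,
    h.le_mu_mul_sqrt (by positivity : 0 < 6 / ζ), h.le_rpow (half_pos hε) 2,
    eventually_gt_atTop 0] with d h1 h2 h3 h4 h5 hd
  intro q u hq hu hqu
  have hd' : (0 : ℝ) < d := by exact_mod_cast hd
  have hsq : 0 < √(d : ℝ) := Real.sqrt_pos.2 hd'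
  have h6 : 6 / √(d : ℝ) ≤ ζ * μ d := by
    rw [div_le_iff₀ hsq]
    rw [div_le_iff₀ hζ0] at h4
    linarith
  have h60 : 0 ≤ 6 / √(d : ℝ) := by positivity
  set S := (s * μ d + 6 / √d) ^ 2 + (t * μ d + 6 / √d) ^ 2 with hS
  have hSB : S ≤ B * μ d ^ 2 := by
    have e1 : (s * μ d + 6 / √d) ^ 2 ≤ (s * μ d + ζ * μ d) ^ 2 :=
      pow_le_pow_left₀ (by positivity) (by linarith) 2
    have e2 : (t * μ d + 6 / √d) ^ 2 ≤ (t * μ d + ζ * μ d) ^ 2 :=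
      pow_le_pow_left₀ (by positivity) (by linarith) 2
    rw [hB, hS]; nlinarith
  have hS0 : 0 ≤ S := by positivity
  have hSξ : S ≤ ξ := by
    have e1 : μ d ^ 2 ≤ √(ξ / B) ^ 2 := pow_le_pow_left₀ h1.le h2 2
    rw [Real.sq_sqrt (by positivity), le_div_iff₀ hB0] at e1
    linarith
  refine le_trans ?_ (NNG.le_wedge hd hq hu hqu (by positivity) (by positivity) hS
    (hSξ.trans (min_le_left _ _)))
  have e5 : (n d : ℝ) ^ (-(ε / 2)) ≤ 1 / 2 := by
    rw [Real.rpow_neg (Nat.cast_nonneg _), inv_eq_one_div]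
    exact one_div_le_one_div_of_le two_pos h5
  have hn : (0 : ℝ) < n d := by exact_mod_cast h.pos d
  have e6 : (n d : ℝ) ^ (-(s ^ 2 + t ^ 2) - ε) =
      (n d : ℝ) ^ (-(s ^ 2 + t ^ 2) - ε / 2) * (n d : ℝ) ^ (-(ε / 2)) := by
    rw [← Real.rpow_add hn]; congr 1; ring
  rw [e6, mul_comm]
  refine mul_le_mul e5 ?_ (by positivity) (by norm_num)
  rw [h.rpow_eq, Real.exp_le_exp]
  set L := Real.log (n d)
  have hL : 0 ≤ L := Real.log_natCast_nonneg _
  have e7 : d / 2 * (S * (1 + 2 * S)) ≤ d / 2 * (B * μ d ^ 2 * (1 + 2 * ξ)) := by gcongr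
  have e8 : d / 2 * (B * μ d ^ 2 * (1 + 2 * ξ)) = (B * (1 + 2 * ξ)) * (d * μ d ^ 2 / 2) := by ring
  have e9 : (B * (1 + 2 * ξ)) * (d * μ d ^ 2 / 2) ≤ (B * (1 + 2 * ξ)) * L := by gcongr
  have e10 : (B * (1 + 2 * ξ)) * L ≤ (s ^ 2 + t ^ 2 + ε / 2) * L := by
    gcongr; linarith
  linarith

lemma le_cap (h : Sparse n μ) {s ε : ℝ} (hs : 0 ≤ s) (hε : 0 < ε) :
    ∀ᶠ d in atTop, ∀ p : E d, ‖p‖ = 1 →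
      (n d : ℝ) ^ (-s ^ 2 - ε) ≤ (sphereLaw d).real {x | s * μ d ≤ ⟪x, p⟫} := by
  filter_upwards [h.le_wedge hs le_rfl hε, eventually_ge_atTop 2] with d h1 hd p hp
  have := isProbabilityMeasure_sphereLaw (by omega : 0 < d)
  obtain ⟨u, hu, hpu⟩ := exists_unit_orthogonal hd p
  have h2 := h1 p u hp hu hpu
  have e : -(s ^ 2 + (0 : ℝ) ^ 2) - ε = -s ^ 2 - ε := by ring
  rw [e] at h2
  exact h2.trans (measureReal_mono fun x hx => hx.1)

end Sparse

/-! ### Wedges in directions that are not orthogonal -/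

namespace Sparse

variable {n : ℕ → ℕ} {μ : ℕ → ℝ}

/-- Wedges of heights `s μ` and `t μ` in almost orthogonal (or opposite) directions have relative
volume at most `n^(-(s² + t²) + o(1))`. -/
lemma wedge_le (h : Sparse n μ) {s t ε : ℝ} (hs : 0 < s) (ht : 0 ≤ t) (hε : 0 < ε) :
    ∃ η > 0, ∀ᶠ d in atTop, ∀ p q : E d, ‖p‖ = 1 → ‖q‖ = 1 → ⟪p, q⟫ ≤ η →
      (sphereLaw d).real {x | s * μ d ≤ ⟪x, p⟫ ∧ t * μ d ≤ ⟪x, q⟫} ≤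
        (n d : ℝ) ^ (-(s ^ 2 + t ^ 2) + ε) := by
  set A := s ^ 2 + t ^ 2 with hA
  have hA0 : 0 < A := by positivity
  set η := ε / (4 * (s * t + 1)) with hη
  have hη2 : η * (4 * (s * t + 1)) = ε := by rw [hη]; field_simp
  have hη0 : 0 < η := by positivity
  set r := √(max (A - ε / 2) 0) with hr
  have hr2 : r ^ 2 = max (A - ε / 2) 0 := Real.sq_sqrt (le_max_right _ _)
  have hr0 : 0 ≤ r := Real.sqrt_nonneg _
  refine ⟨η, hη0, ?_⟩
  filter_upwards [h.cap_le hr0 (half_pos hε), h.mu_pos, eventually_gt_atTop 0] with d h1 h2 hd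
  intro p q hp hq hpq
  have := isProbabilityMeasure_sphereLaw hd
  -- The wedge lies in one cap in the direction of `v`: on it `⟪x, v⟫ ≥ (s² + t²)μ`, while `‖v‖²`
  -- exceeds `s² + t²` by at most `2stη`. The height is thus at least `rμ`, where `r²` is `A - ε/2`
  -- cut off at `0`.
  set v := s • p + t • q with hv
  have hin : ∀ x : E d, s * μ d ≤ ⟪x, p⟫ ∧ t * μ d ≤ ⟪x, q⟫ → A * μ d ≤ ⟪x, v⟫ := by
    rintro x ⟨ha, hb⟩
    rw [hv, inner_add_right, real_inner_smul_right, real_inner_smul_right, hA]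
    nlinarith [mul_le_mul_of_nonneg_left ha hs.le, mul_le_mul_of_nonneg_left hb ht]
  have hnv : ‖v‖ ^ 2 ≤ A + ε / 2 := by
    rw [hv, @norm_add_sq_real, norm_smul, norm_smul, hp, hq, real_inner_smul_left,
      real_inner_smul_right, Real.norm_eq_abs, Real.norm_eq_abs, mul_one, mul_one, sq_abs, sq_abs]
    have : s * (t * ⟪p, q⟫) ≤ s * (t * η) := by gcongr
    nlinarith
  by_cases hv0 : v = 0
  · have : {x : E d | s * μ d ≤ ⟪x, p⟫ ∧ t * μ d ≤ ⟪x, q⟫} = ∅ := by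
      ext x
      simp only [Set.mem_ofPred_eq, Set.mem_empty_iff_false, iff_false]
      intro hx
      have h3 := hin x hx
      rw [hv0, inner_zero_right] at h3
      have : 0 < A * μ d := by positivity
      linarith
    rw [this, measureReal_empty]
    positivity
  have hpos : 0 < ‖v‖ := norm_pos_iff.2 hv0
  have hrv : r * ‖v‖ ≤ A := by
    apply le_of_sq_le_sq _ hA0.le
    rw [mul_pow, hr2]
    rcases le_total (A - ε / 2) 0 with h0 | h0
    · rw [max_eq_right h0, zero_mul]; positivity
    · rw [max_eq_left h0]
      calc _ ≤ (A - ε / 2) * (A + ε / 2) := by gcongr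
        _ ≤ A ^ 2 := by nlinarith
  have h3 := h1 (‖v‖⁻¹ • v) (by rw [norm_smul, norm_inv, norm_norm, inv_mul_cancel₀ hpos.ne'])
    (r * μ d) le_rfl
  calc (sphereLaw d).real {x | s * μ d ≤ ⟪x, p⟫ ∧ t * μ d ≤ ⟪x, q⟫}
      ≤ (sphereLaw d).real {x | r * μ d ≤ ⟪x, ‖v‖⁻¹ • v⟫} := by
        refine measureReal_mono fun x hx => ?_
        rw [Set.mem_ofPred_eq, real_inner_smul_right, inv_mul_eq_div, le_div_iff₀ hpos]
        refine le_trans ?_ (hin x hx)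
        nlinarith
    _ ≤ (n d : ℝ) ^ (-r ^ 2 + ε / 2) := h3
    _ ≤ _ := by
      refine Real.rpow_le_rpow_of_exponent_le (by exact_mod_cast h.pos d) ?_
      rw [hr2]
      linarith [le_max_left (A - ε / 2) 0]

/-- Lower bound for the volume of wedges in two directions with inner product `γ`. -/
lemma le_wedge_of_inner_eq (h : Sparse n μ) {k b γ ε : ℝ} (hγ0 : 0 ≤ γ) (hγ1 : γ < 1) (hb : 0 ≤ b)
    (hk : γ * b ≤ k) (hε : 0 < ε) :
    ∀ᶠ d in atTop, ∀ q p : E d, ‖q‖ = 1 → ‖p‖ = 1 → ⟪p, q⟫ = γ →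
      (n d : ℝ) ^ (-(b ^ 2 + (k - γ * b) ^ 2 / (1 - γ ^ 2)) - ε) ≤
        (sphereLaw d).real {x | b * μ d ≤ ⟪x, q⟫ ∧ k * μ d ≤ ⟪x, p⟫} := by
  have hg : 0 < 1 - γ ^ 2 := by nlinarith
  set r := √(1 - γ ^ 2) with hr
  have hr0 : 0 < r := Real.sqrt_pos.2 hg
  have hr2 : r ^ 2 = 1 - γ ^ 2 := Real.sq_sqrt hg.le
  have ht : 0 ≤ (k - γ * b) / r := div_nonneg (by linarith) hr0.le
  filter_upwards [h.le_wedge hb ht hε, eventually_gt_atTop 0] with d h1 hd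
  intro q p hq hp hpq
  have := isProbabilityMeasure_sphereLaw hd
  have hqq : ⟪q, q⟫ = 1 := by rw [real_inner_self_eq_norm_sq, hq]; norm_num
  have hqp : ⟪q, p⟫ = γ := by rw [real_inner_comm]; exact hpq
  -- Gram-Schmidt: `p = γ q + r u` with `u` a unit vector orthogonal to `q`. Heights `bμ` along `q`
  -- and `(k - γb)μ/r` along `u` force height `kμ` along `p`; `γb ≤ k` makes the second height
  -- nonnegative.
  have h2 := h1 q (r⁻¹ • (p - γ • q)) hq (by
    rw [← sq_eq_sq₀ (norm_nonneg _) zero_le_one, norm_smul, mul_pow, @norm_sub_sq_real, norm_smul,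
      real_inner_smul_right, hpq, hp, hq, Real.norm_eq_abs, Real.norm_eq_abs, sq_abs, inv_pow, hr2,
      mul_one, sq_abs]
    field_simp
    ring) (by
    rw [real_inner_smul_right, inner_sub_right, real_inner_smul_right, hqp, hqq]; ring)
  rw [div_pow, hr2] at h2
  refine h2.trans (measureReal_mono ?_)
  rintro x ⟨ha, hc⟩
  refine ⟨ha, ?_⟩
  rw [real_inner_smul_right, inner_sub_right, real_inner_smul_right, inv_mul_eq_div,
    le_div_iff₀ hr0] at hc
  have e : (k - γ * b) / r * μ d * r = (k - γ * b) * μ d := by field_simp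
  rw [e] at hc
  nlinarith [mul_le_mul_of_nonneg_left ha hγ0]

end Sparse

/-! ### The planted neighbor -/

section Planted

variable {d : ℕ}

/-- A proper subspace is a null set, and so is the cone over its intersection with the sphere. Off
it, `orthDir q` does not fall under the convention `0⁻¹ = 0`. -/
lemma ae_not_mem_span (hd : 2 ≤ d) (q : E d) : ∀ᵐ x ∂sphereLaw d, x ∉ (ℝ ∙ q) := by
  have hd0 : 0 < d := by omega
  have hm : MeasurableSet ((ℝ ∙ q : Submodule ℝ (E d)) : Set (E d)) :=
    (Submodule.closed_of_finiteDimensional _).measurableSet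
  rw [ae_iff]
  simp only [not_not]
  change sphereLaw d ((ℝ ∙ q : Submodule ℝ (E d)) : Set (E d)) = 0
  rw [sphereLaw_apply hd0 hm]
  have h0 : volume ((ℝ ∙ q : Submodule ℝ (E d)) : Set (E d)) = 0 := by
    refine Measure.addHaar_submodule _ _ fun h => ?_
    have h1 := finrank_span_le_card (R := ℝ) ({q} : Set (E d))
    rw [h, finrank_top, finrank_euclideanSpace, Fintype.card_fin, Set.toFinset_singleton,
      Finset.card_singleton] at h1
    omega
  refine mul_eq_zero_of_right _ (measure_mono_null ?_ h0)
  rintro x ⟨-, hx0, hx⟩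
  have := (ℝ ∙ q : Submodule ℝ (E d)).smul_mem ‖x‖ hx
  rwa [smul_smul, mul_inv_cancel₀ (norm_ne_zero_iff.2 hx0), one_smul] at this

lemma measurable_planted (q : E d) (γ : ℝ) :
    Measurable (fun x : E d => γ • q + √(1 - γ ^ 2) • orthDir q x) := by
  unfold orthDir
  fun_prop

lemma isProbabilityMeasure_plantedLaw (hd : 0 < d) (q : E d) (γ : ℝ) :
    IsProbabilityMeasure (plantedLaw q γ) := by
  have := isProbabilityMeasure_sphereLaw hd
  exact Measure.isProbabilityMeasure_map (measurable_planted q γ).aemeasurable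

lemma ae_plantedLaw (hd : 2 ≤ d) {q : E d} (hq : ‖q‖ = 1) {γ : ℝ} (hγ : γ ^ 2 ≤ 1) :
    ∀ᵐ y ∂plantedLaw q γ, ‖y‖ = 1 ∧ ⟪y, q⟫ = γ := by
  have hm : MeasurableSet {y : E d | ‖y‖ = 1 ∧ ⟪y, q⟫ = γ} :=
    (measurableSet_eq_fun measurable_norm measurable_const).inter
      (measurableSet_eq_fun (by fun_prop) measurable_const)
  rw [plantedLaw, ae_map_iff (measurable_planted q γ).aemeasurable hm]
  filter_upwards [ae_not_mem_span hd q] with x hx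
  set v := x - ⟪x, q⟫ • q with hv
  have hqq : ⟪q, q⟫ = 1 := by rw [real_inner_self_eq_norm_sq, hq]; norm_num
  have hv0 : v ≠ 0 := fun h => hx (by
    rw [sub_eq_zero.1 h]; exact Submodule.smul_mem _ _ (Submodule.mem_span_singleton_self q))
  have hvq : ⟪v, q⟫ = 0 := by
    rw [hv, inner_sub_left, real_inner_smul_left, hqq]; ring
  have ho : ‖orthDir q x‖ = 1 := by
    rw [orthDir, ← hv, norm_smul, norm_inv, norm_norm, inv_mul_cancel₀ (norm_ne_zero_iff.2 hv0)]
  have hoq : ⟪orthDir q x, q⟫ = 0 := by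
    rw [orthDir, ← hv, real_inner_smul_left, hvq, mul_zero]
  have hqo : ⟪q, orthDir q x⟫ = 0 := by rw [real_inner_comm]; exact hoq
  constructor
  · rw [← sq_eq_sq₀ (norm_nonneg _) zero_le_one, @norm_add_sq_real, norm_smul, norm_smul, hq, ho,
      real_inner_smul_left, real_inner_smul_right, hqo, Real.norm_eq_abs, Real.norm_eq_abs, mul_one,
      mul_one, sq_abs, sq_abs, Real.sq_sqrt (by linarith)]
    ring
  · rw [inner_add_left, real_inner_smul_left, real_inner_smul_left, hqq, hoq]; ring

end Planted

/-! ### Counting starts at distance two from the planted neighbor -/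

open Classical in
/-- Vertices `s` (other than `star`) outside `H` with a neighbor `j` in `J` such that all other
neighbors of `s` are outside `H`, where `J ⊆ H`. Their number is at least the number of edges to `J`
minus the number of bad pairs and triples. -/
lemma card_second_starts {V : Type*} [Fintype V] (star : V) (adj : V → V → Prop) (J H : V → Prop)
    (hJH : ∀ j, J j → H j) {D m M : ℝ} (hD : 0 ≤ D)
    (hdeg : ∀ j, j ≠ star → J j →
      D ≤ ((Finset.univ.filter fun s => (s ≠ j ∧ s ≠ star) ∧ adj s j).card : ℝ))
    (hJ : m ≤ ((Finset.univ.filter fun j => j ≠ star ∧ J j).card : ℝ))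
    (h2 : ((Finset.univ.filter fun z : V × V => (z.1 ≠ star ∧ z.2 ≠ star ∧ z.1 ≠ z.2) ∧
      J z.2 ∧ adj z.1 z.2 ∧ H z.1).card : ℝ) ≤ M)
    (h3 : ((Finset.univ.filter fun z : V × V × V => (z.1 ≠ star ∧ z.2.1 ≠ star ∧ z.2.2 ≠ star ∧
      z.1 ≠ z.2.1 ∧ z.2.2 ≠ z.1 ∧ z.2.2 ≠ z.2.1) ∧
      J z.2.1 ∧ adj z.1 z.2.1 ∧ adj z.1 z.2.2 ∧ H z.2.2).card : ℝ) ≤ M) :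
    m * D - 2 * M ≤ ((Finset.univ.filter fun s => s ≠ star ∧ ¬ H s ∧
      ∃ j, j ≠ star ∧ j ≠ s ∧ J j ∧ adj s j ∧
        ∀ k, k ≠ star → k ≠ s → k ≠ j → adj s k → ¬ H k).card : ℝ) := by
  set Z2 := Finset.univ.filter fun z : V × V => (z.1 ≠ star ∧ z.2 ≠ star ∧ z.1 ≠ z.2) ∧
      J z.2 ∧ adj z.1 z.2 ∧ H z.1 with hZ2
  set Z3 := Finset.univ.filter fun z : V × V × V => (z.1 ≠ star ∧ z.2.1 ≠ star ∧ z.2.2 ≠ star ∧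
      z.1 ≠ z.2.1 ∧ z.2.2 ≠ z.1 ∧ z.2.2 ≠ z.2.1) ∧
      J z.2.1 ∧ adj z.1 z.2.1 ∧ adj z.1 z.2.2 ∧ H z.2.2 with hZ3
  set P := (Finset.univ.filter fun j => j ≠ star ∧ J j).sigma
    (fun j => Finset.univ.filter fun s => (s ≠ j ∧ s ≠ star) ∧ adj s j) with hP
  set G := P.filter fun z => ¬ H z.2 ∧ ∀ k, k ≠ star → k ≠ z.2 → k ≠ z.1 → adj z.2 k → ¬ H k
    with hG
  have hPcard : m * D ≤ (P.card : ℝ) := by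
    rw [hP, Finset.card_sigma, Nat.cast_sum]
    calc m * D ≤ ((Finset.univ.filter fun j => j ≠ star ∧ J j).card : ℝ) * D := by gcongr
      _ = ∑ j ∈ Finset.univ.filter (fun j => j ≠ star ∧ J j), D := by simp
      _ ≤ _ := Finset.sum_le_sum fun j hj => by
        rw [Finset.mem_filter] at hj
        exact hdeg j hj.2.1 hj.2.2
  have hcov : P ⊆ G ∪ (Z2.image (fun z => (⟨z.2, z.1⟩ : Σ _ : V, V)) ∪
      Z3.image (fun z => (⟨z.2.1, z.1⟩ : Σ _ : V, V))) := by
    rintro ⟨j, s⟩ hz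
    have hz' := hz
    simp only [hP, Finset.mem_sigma, Finset.mem_filter, Finset.mem_univ, true_and] at hz'
    obtain ⟨⟨hj, hJj⟩, ⟨hsj, hs⟩, hadj⟩ := hz'
    simp only [Finset.mem_union, Finset.mem_image]
    by_cases hHs : H s
    · exact Or.inr (Or.inl ⟨(s, j), by simp [hZ2, hs, hj, hsj, hJj, hadj, hHs], rfl⟩)
    by_cases hk : ∀ k, k ≠ star → k ≠ s → k ≠ j → adj s k → ¬ H k
    · left
      rw [hG, Finset.mem_filter]
      exact ⟨hz, hHs, hk⟩
    · push Not at hk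
      obtain ⟨k, h1, h2, h3, h4, h5⟩ := hk
      exact Or.inr (Or.inr ⟨(s, j, k), by simp [hZ3, hs, hj, hsj, hJj, hadj, h1, h2, h3, h4, h5],
        rfl⟩)
  have hGcard : G.card ≤ (Finset.univ.filter fun s => s ≠ star ∧ ¬ H s ∧
      ∃ j, j ≠ star ∧ j ≠ s ∧ J j ∧ adj s j ∧
        ∀ k, k ≠ star → k ≠ s → k ≠ j → adj s k → ¬ H k).card := by
    refine Finset.card_le_card_of_injOn (fun z => z.2) ?_ ?_
    · rintro ⟨j, s⟩ hz
      simp only [hG, hP, Finset.coe_filter, Finset.mem_sigma, Finset.mem_filter, Finset.mem_univ,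
        true_and, Set.mem_ofPred_eq] at hz ⊢
      obtain ⟨⟨⟨hj, hJj⟩, ⟨hsj, hs⟩, hadj⟩, hH, hk⟩ := hz
      exact ⟨hs, hH, j, hj, hsj.symm, hJj, hadj, hk⟩
    -- Each start is counted once: two good edges at the same `s` with different ends `j`, `j'`
    -- would make `j'` a further neighbor in `J ⊆ H`.
    · rintro ⟨j, s⟩ hz ⟨j', s'⟩ hz' hss
      simp only [hG, hP, Finset.coe_filter, Finset.mem_sigma, Finset.mem_filter, Finset.mem_univ,
        true_and, Set.mem_ofPred_eq] at hz hz' hss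
      subst hss
      obtain ⟨⟨⟨hj, hJj⟩, ⟨hsj, hs⟩, hadj⟩, hH, hk⟩ := hz
      obtain ⟨⟨⟨hj', hJj'⟩, ⟨hsj', -⟩, hadj'⟩, -, -⟩ := hz'
      by_contra hne
      refine hk j' hj' hsj'.symm (fun h => hne ?_) hadj' (hJH _ hJj')
      rw [h]
  have h5 : P.card ≤ G.card + (Z2.card + Z3.card) :=
    (Finset.card_le_card hcov).trans ((Finset.card_union_le _ _).trans
      (Nat.add_le_add_left ((Finset.card_union_le _ _).trans
        (Nat.add_le_add Finset.card_image_le Finset.card_image_le)) _))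
  have h6 : (P.card : ℝ) ≤ G.card + (Z2.card + Z3.card) := by exact_mod_cast h5
  have h7 : (G.card : ℝ) ≤ _ := Nat.cast_le.2 hGcard
  linarith

/-! ### Typical instances -/

section Instance

variable {d n : ℕ}

lemma isProbabilityMeasure_coord (hd : 0 < d) (star : Fin n) (q : E d) (γ : ℝ) (i : Fin n) :
    IsProbabilityMeasure (if i = star then plantedLaw q γ else sphereLaw d) := by
  split_ifs
  exacts [isProbabilityMeasure_plantedLaw hd q γ, isProbabilityMeasure_sphereLaw hd]

/-- Labels other than `star` and `i`. -/
def others (star i : Fin n) : Finset (Fin n) := Finset.univ.filter fun j => j ≠ i ∧ j ≠ star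

open Classical in
/-- Number of neighbors of `i` other than `star`. -/
noncomputable def deg (α : ℝ) (star : Fin n) (x : Fin n → E d) (i : Fin n) : ℕ :=
  ((others star i).filter fun j => α ≤ ⟪x i, x j⟫).card

/-- Properties of typical data sets. -/
structure Typical (star : Fin n) (q : E d) (γ α η lo hi : ℝ) (x : Fin n → E d) : Prop where
  norm_eq : ∀ i, ‖x i‖ = 1
  planted : ⟪x star, q⟫ = γ
  far : ∀ i, i ≠ star → ⟪x i, q⟫ < η
  deg_lo : ∀ i, n * lo / 8 < deg α star x i
  deg_hi : ∀ i, (deg α star x i : ℝ) < 4 * (n * hi)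

lemma measurableSet_le_inner (a : ℝ) (i j : Fin n) :
    MeasurableSet {x : Fin n → E d | a ≤ ⟪x i, x j⟫} :=
  measurableSet_le measurable_const (by fun_prop)

lemma measurableSet_le_inner_const (a : ℝ) (i : Fin n) (q : E d) :
    MeasurableSet {x : Fin n → E d | a ≤ ⟪x i, q⟫} :=
  measurableSet_le measurable_const (by fun_prop)

lemma measurable_deg (α : ℝ) (star i : Fin n) :
    Measurable fun x : Fin n → E d => (deg α star x i : ℝ) :=
  measurable_card_filter _ (fun j (x : Fin n → E d) => α ≤ ⟪x i, x j⟫)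
    fun j _ => measurableSet_le_inner α i j

lemma card_others (star i : Fin n) : n ≤ (others star i).card + 2 ∧ (others star i).card ≤ n := by
  constructor
  · have h : (Finset.univ : Finset (Fin n)) ⊆ others star i ∪ {i, star} := by
      intro j _
      simp only [others, Finset.mem_union, Finset.mem_filter, Finset.mem_univ, true_and,
        Finset.mem_insert, Finset.mem_singleton]
      tauto
    have h1 := Finset.card_le_card h
    have h2 := Finset.card_union_le (others star i) {i, star}
    have h3 : ({i, star} : Finset (Fin n)).card ≤ 2 := Finset.card_le_two
    rw [Finset.card_univ, Fintype.card_fin] at h1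
    omega
  · simpa using Finset.card_le_univ (others star i)

lemma half_le_card_others (hn : 4 ≤ n) (star i : Fin n) :
    (n : ℝ) / 2 ≤ ((others star i).card : ℝ) := by
  have h1 : (n : ℝ) ≤ (others star i).card + 2 := by exact_mod_cast (card_others star i).1
  have h2 : (4 : ℝ) ≤ n := by exact_mod_cast hn
  linarith

open Classical in
lemma deg_update (α : ℝ) (star i : Fin n) (x : Fin n → E d) (y : E d) :
    deg α star (Function.update x i y) i =
      ((others star i).filter fun j => x j ∈ {z | α ≤ ⟪z, y⟫}).card := by
  rw [deg]
  congr 1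
  refine Finset.filter_congr fun j hj => ?_
  have hji : j ≠ i := by simp only [others, Finset.mem_filter] at hj; exact hj.2.1
  rw [Function.update_self, Function.update_of_ne hji, real_inner_comm]
  rfl

variable {star : Fin n} {q : E d} {γ α η lo hi : ℝ}

lemma ae_coord (hd : 2 ≤ d) (hq : ‖q‖ = 1) (hγ : γ ^ 2 ≤ 1) (i : Fin n) :
    ∀ᵐ y ∂(if i = star then plantedLaw q γ else sphereLaw d), ‖y‖ = 1 := by
  split_ifs
  · filter_upwards [ae_plantedLaw hd hq hγ] with y hy using hy.1
  · exact ae_norm_sphereLaw d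

open Classical in
/-- The degree of a vertex is concentrated. -/
lemma deg_tail (hd : 2 ≤ d) (hn : 4 ≤ n) (hq : ‖q‖ = 1) (hγ : γ ^ 2 ≤ 1) (hlo : 0 ≤ lo)
    (hcap : ∀ p : E d, ‖p‖ = 1 → lo ≤ (sphereLaw d).real {x | α ≤ ⟪x, p⟫} ∧
      (sphereLaw d).real {x | α ≤ ⟪x, p⟫} ≤ hi) (i : Fin n) :
    dataLaw star q γ {x | ¬ (n * lo / 8 < deg α star x i ∧ (deg α star x i : ℝ) < 4 * (n * hi))} ≤
      ENNReal.ofReal (2 * Real.exp (-(n * lo / 8))) := by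
  have := isProbabilityMeasure_coord (by omega : 0 < d) star q γ
  set ν := fun i : Fin n => if i = star then plantedLaw q γ else sphereLaw d with hν
  have hm : MeasurableSet {x : Fin n → E d |
      ¬ (n * lo / 8 < deg α star x i ∧ (deg α star x i : ℝ) < 4 * (n * hi))} :=
    ((measurableSet_lt measurable_const (measurable_deg α star i)).inter
      (measurableSet_lt (measurable_deg α star i) measurable_const)).compl
  refine pi_le_of_forall_coord ν i hm ?_
  filter_upwards [ae_coord (star := star) hd hq hγ i] with y hy
  set S := {z : E d | α ≤ ⟪z, y⟫} with hS
  have hSm : MeasurableSet S := measurableSet_cap y α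
  have hνS : ∀ j ∈ others star i, lo ≤ (ν j).real S ∧ (ν j).real S ≤ hi := by
    -- The degree leaves out `star` so that all remaining coordinates are uniform; `star` changes a
    -- degree by at most one.
    intro j hj
    simp only [others, Finset.mem_filter] at hj
    simp only [hν, if_neg hj.2.2]
    exact hcap y hy
  have h1 := card_le_tail ν (others star i) S hSm (fun j hj => (hνS j hj).1)
  have h2 := le_card_tail ν (others star i) S hSm (fun j hj => (hνS j hj).2)
  have hc1 := half_le_card_others hn star i
  have hc2 : ((others star i).card : ℝ) ≤ n := by exact_mod_cast (card_others star i).2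
  have hhi : lo ≤ hi := (hcap y hy).1.trans (hcap y hy).2
  have hn0 : (0 : ℝ) ≤ n := Nat.cast_nonneg n
  have b1 : n * lo / 8 ≤ (others star i).card * lo / 4 := by nlinarith
  have b2 : n * lo / 8 ≤ 2 * ((others star i).card * hi) := by nlinarith
  have b3 : (others star i).card * hi ≤ n * hi := by gcongr; linarith
  rw [← ofReal_measureReal]
  refine ENNReal.ofReal_le_ofReal ?_
  calc _ ≤ (Measure.pi ν).real ({x | (((others star i).filter fun j => x j ∈ S).card : ℝ) ≤
          (others star i).card * lo / 4} ∪
        {x | 4 * ((others star i).card * hi) ≤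
          (((others star i).filter fun j => x j ∈ S).card : ℝ)}) := by
        refine measureReal_mono fun x hx => ?_
        simp only [Set.mem_ofPred_eq, deg_update, ← hS] at hx
        by_contra hcon
        simp only [Set.mem_union, Set.mem_ofPred_eq, not_or, not_le] at hcon
        exact hx ⟨by linarith [hcon.1], by linarith [hcon.2]⟩
    _ ≤ _ := measureReal_union_le _ _
    _ ≤ Real.exp (-((others star i).card * lo / 4)) +
        Real.exp (-(2 * ((others star i).card * hi))) := add_le_add h1 h2
    _ ≤ Real.exp (-(n * lo / 8)) + Real.exp (-(n * lo / 8)) :=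
        add_le_add (Real.exp_le_exp.2 (by linarith)) (Real.exp_le_exp.2 (by linarith))
    _ = _ := by ring

lemma dataLaw_coord (hd : 0 < d) (i : Fin n) {S : Set (E d)} (hS : MeasurableSet S) :
    dataLaw star q γ {x | x i ∈ S} = (if i = star then plantedLaw q γ else sphereLaw d) S := by
  have := isProbabilityMeasure_coord hd star q γ
  have h := (measurePreserving_eval
    (fun i : Fin n => if i = star then plantedLaw q γ else sphereLaw d) i).measure_preimage
      hS.nullMeasurableSet
  exact h

/-- Data sets are typical with high probability. -/
lemma not_typical_le (hd : 2 ≤ d) (hn : 4 ≤ n) (hq : ‖q‖ = 1) (hγ : γ ^ 2 ≤ 1) (hlo : 0 ≤ lo)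
    (hcap : ∀ p : E d, ‖p‖ = 1 → lo ≤ (sphereLaw d).real {x | α ≤ ⟪x, p⟫} ∧
      (sphereLaw d).real {x | α ≤ ⟪x, p⟫} ≤ hi) {c : ℝ}
    (hc : (sphereLaw d).real {x | η ≤ ⟪x, q⟫} ≤ c) :
    dataLaw star q γ {x | ¬ Typical star q γ α η lo hi x} ≤
      ENNReal.ofReal (n * c + n * (2 * Real.exp (-(n * lo / 8)))) := by
  have := isProbabilityMeasure_coord (by omega : 0 < d) star q γ
  have := isProbabilityMeasure_sphereLaw (by omega : 0 < d)
  have hc0 : 0 ≤ c := measureReal_nonneg.trans hc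
  have hnorm : ∀ i, dataLaw star q γ {x | ¬ ‖x i‖ = 1} = 0 := by
    intro i
    have hS : MeasurableSet {y : E d | ¬ ‖y‖ = 1} :=
      (measurableSet_eq_fun measurable_norm measurable_const).compl
    rw [show {x : Fin n → E d | ¬ ‖x i‖ = 1} = {x | x i ∈ {y : E d | ¬ ‖y‖ = 1}} from rfl,
      dataLaw_coord (by omega) i hS]
    exact ae_iff.1 (ae_coord hd hq hγ i)
  have hpl : dataLaw star q γ {x | ¬ ⟪x star, q⟫ = γ} = 0 := by
    have hS : MeasurableSet {y : E d | ¬ ⟪y, q⟫ = γ} :=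
      (measurableSet_eq_fun (by fun_prop) measurable_const).compl
    rw [show {x : Fin n → E d | ¬ ⟪x star, q⟫ = γ} = {x | x star ∈ {y : E d | ¬ ⟪y, q⟫ = γ}} from
      rfl, dataLaw_coord (by omega) star hS, if_pos rfl, ← ae_iff]
    filter_upwards [ae_plantedLaw hd hq hγ] with y hy using hy.2
  have hfar : ∀ i, dataLaw star q γ {x | i ≠ star ∧ η ≤ ⟪x i, q⟫} ≤ ENNReal.ofReal c := by
    intro i
    by_cases hi : i = star
    · simp [hi]
    · simp only [ne_eq, hi, not_false_eq_true, true_and]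
      rw [show {x : Fin n → E d | η ≤ ⟪x i, q⟫} = {x | x i ∈ {y : E d | η ≤ ⟪y, q⟫}} from rfl,
        dataLaw_coord (by omega) i (measurableSet_cap q η), if_neg hi, ← ofReal_measureReal]
      exact ENNReal.ofReal_le_ofReal hc
  have hsub : {x : Fin n → E d | ¬ Typical star q γ α η lo hi x} ⊆
      ((⋃ i, {x | ¬ ‖x i‖ = 1}) ∪ {x | ¬ ⟪x star, q⟫ = γ}) ∪
      ((⋃ i, {x | i ≠ star ∧ η ≤ ⟪x i, q⟫}) ∪
      (⋃ i, {x | ¬ (n * lo / 8 < deg α star x i ∧ (deg α star x i : ℝ) < 4 * (n * hi))})) := by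
    intro x hx
    by_contra hcon
    simp only [Set.mem_union, Set.mem_iUnion, Set.mem_ofPred_eq, not_or, not_exists, not_not,
      not_and, not_le] at hcon
    have hdeg : ∀ i, n * lo / 8 < deg α star x i ∧ (deg α star x i : ℝ) < 4 * (n * hi) :=
      fun i => by
        by_contra h
        exact hcon.2.2 i fun h1 h2 => h ⟨h1, h2⟩
    exact hx ⟨hcon.1.1, hcon.1.2, hcon.2.1, fun i => (hdeg i).1, fun i => (hdeg i).2⟩
  have hz : dataLaw star q γ ((⋃ i, {x | ¬ ‖x i‖ = 1}) ∪ {x | ¬ ⟪x star, q⟫ = γ}) = 0 :=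
    measure_union_null (measure_iUnion_null hnorm) hpl
  have hsum : ∀ (A : Fin n → Set (Fin n → E d)) (c : ℝ), 0 ≤ c →
      (∀ i, dataLaw star q γ (A i) ≤ ENNReal.ofReal c) →
      dataLaw star q γ (⋃ i, A i) ≤ ENNReal.ofReal (n * c) := by
    intro A c hc0 hA
    calc _ ≤ ∑ i, dataLaw star q γ (A i) := measure_iUnion_fintype_le _ _
      _ ≤ ∑ _i : Fin n, ENNReal.ofReal c := Finset.sum_le_sum fun i _ => hA i
      _ = _ := by
        rw [Finset.sum_const, Finset.card_univ, Fintype.card_fin, nsmul_eq_mul,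
          ENNReal.ofReal_mul (Nat.cast_nonneg n), ENNReal.ofReal_natCast]
  calc _ ≤ _ := measure_mono hsub
    _ ≤ _ := measure_union_le _ _
    _ ≤ 0 + (ENNReal.ofReal (n * c) + ENNReal.ofReal (n * (2 * Real.exp (-(n * lo / 8))))) := by
        refine add_le_add hz.le ((measure_union_le _ _).trans (add_le_add ?_ ?_))
        · exact hsum _ c hc0 hfar
        · exact hsum _ _ (by positivity) fun i => deg_tail hd hn hq hγ hlo hcap i
    _ = _ := by rw [zero_add, ENNReal.ofReal_add (by positivity) (by positivity)]

end Instance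

/-! ### Probability of few good starts at distance two -/

section SecondStarts

variable {d n : ℕ}

/-- A label `s` from which a run through the bucket leads to a neighbor of `star`: `s` has a
neighbor `j` of level `a₂` that is a neighbor of `star`, and the other neighbors of `s` are below the
level `a₁`. -/
def SecondStart (α a₁ a₂ : ℝ) (star : Fin n) (q : E d) (x : Fin n → E d) (s : Fin n) : Prop :=
  s ≠ star ∧ ¬ a₁ ≤ ⟪x s, q⟫ ∧ ∃ j, j ≠ star ∧ j ≠ s ∧
    (a₂ ≤ ⟪x j, q⟫ ∧ α ≤ ⟪x j, x star⟫) ∧ α ≤ ⟪x s, x j⟫ ∧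
      ∀ k, k ≠ star → k ≠ s → k ≠ j → α ≤ ⟪x s, x k⟫ → ¬ a₁ ≤ ⟪x k, q⟫

variable {star : Fin n} {q : E d} {γ α η lo hi a₁ a₂ : ℝ}

lemma measurableSet_secondStart (s : Fin n) :
    MeasurableSet {x : Fin n → E d | SecondStart α a₁ a₂ star q x s} := by
  have h1 : ∀ (a : ℝ) (i j : Fin n), Measurable fun x : Fin n → E d => a ≤ ⟪x i, x j⟫ :=
    fun a i j => measurableSet_setOfPred.1 (measurableSet_le_inner a i j)
  have h2 : ∀ (a : ℝ) (i : Fin n), Measurable fun x : Fin n → E d => a ≤ ⟪x i, q⟫ :=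
    fun a i => measurableSet_setOfPred.1 (measurableSet_le_inner_const a i q)
  refine measurableSet_setOfPred.2 (measurable_const.and ((h2 _ _).not.and
    (Measurable.exists fun j => ?_)))
  refine measurable_const.and (measurable_const.and (((h2 _ _).and (h1 _ _ _)).and
    ((h1 _ _ _).and (Measurable.forall fun k => ?_))))
  exact measurable_const.imp (measurable_const.imp (measurable_const.imp ((h1 _ _ _).imp
    (h2 _ _).not)))

lemma measurableSet_typical :
    MeasurableSet {x : Fin n → E d | Typical star q γ α η lo hi x} := by
  have e : {x : Fin n → E d | Typical star q γ α η lo hi x} =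
      (⋂ i, {x | ‖x i‖ = 1}) ∩ ({x | ⟪x star, q⟫ = γ} ∩
      ((⋂ i, {x | i ≠ star → ⟪x i, q⟫ < η}) ∩
      ((⋂ i, {x | n * lo / 8 < deg α star x i}) ∩
      (⋂ i, {x | (deg α star x i : ℝ) < 4 * (n * hi)})))) := by
    ext x
    simp only [Set.mem_inter_iff, Set.mem_iInter, Set.mem_ofPred_eq]
    exact ⟨fun h => ⟨h.1, h.2, h.3, h.4, h.5⟩, fun h => ⟨h.1, h.2.1, h.2.2.1, h.2.2.2.1, h.2.2.2.2⟩⟩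
  rw [e]
  refine (MeasurableSet.iInter fun i => ?_).inter (MeasurableSet.inter ?_
    ((MeasurableSet.iInter fun i => ?_).inter ((MeasurableSet.iInter fun i => ?_).inter
    (MeasurableSet.iInter fun i => ?_))))
  · exact measurableSet_eq_fun (by fun_prop) measurable_const
  · exact measurableSet_eq_fun (by fun_prop) measurable_const
  · by_cases h : i = star
    · simp [h]
    · simp only [ne_eq, h, not_false_eq_true, true_imp_iff]
      exact measurableSet_lt (by fun_prop) measurable_const
  · exact measurableSet_lt measurable_const (measurable_deg α star i)
  · exact measurableSet_lt (measurable_deg α star i) measurable_const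

open Classical in
/-- Typical data sets with few neighbors of `star` of level `a₂`, or with many bad pairs or
triples, are the only ones with few starts at distance two. -/
lemma le_card_secondStart {x : Fin n → E d} (hx : Typical star q γ α η lo hi x) (ha : a₁ ≤ a₂)
    (hlo : 0 ≤ lo) {m M : ℝ}
    (hJ : m ≤ (((others star star).filter fun j => a₂ ≤ ⟪x j, q⟫ ∧ α ≤ ⟪x j, x star⟫).card : ℝ))
    (h2 : (((Finset.univ.filter fun z : Fin n × Fin n => z.1 ≠ star ∧ z.2 ≠ star ∧ z.1 ≠ z.2).filter
      fun z => (‖x z.2‖ = 1 ∧ ⟪x z.2, q⟫ ≤ η ∧ a₂ ≤ ⟪x z.2, q⟫ ∧ α ≤ ⟪x z.2, x star⟫) ∧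
        α ≤ ⟪x z.1, x z.2⟫ ∧ a₁ ≤ ⟪x z.1, q⟫).card : ℝ) ≤ M)
    (h3 : (((Finset.univ.filter fun z : Fin n × Fin n × Fin n => z.1 ≠ star ∧ z.2.1 ≠ star ∧
      z.2.2 ≠ star ∧ z.1 ≠ z.2.1 ∧ z.2.2 ≠ z.1 ∧ z.2.2 ≠ z.2.1).filter
      fun z => ((‖x z.2.1‖ = 1 ∧ a₂ ≤ ⟪x z.2.1, q⟫ ∧ α ≤ ⟪x z.2.1, x star⟫) ∧ ‖x z.1‖ = 1 ∧
        ⟪x z.1, q⟫ ≤ η ∧ α ≤ ⟪x z.1, x z.2.1⟫) ∧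
        α ≤ ⟪x z.2.2, x z.1⟫ ∧ a₁ ≤ ⟪x z.2.2, q⟫).card : ℝ) ≤ M) :
    m * (n * lo / 8) - 2 * M ≤
      ((Finset.univ.filter fun s => SecondStart α a₁ a₂ star q x s).card : ℝ) := by
  refine le_trans (card_second_starts star (fun s j => α ≤ ⟪x s, x j⟫)
    (fun j => a₂ ≤ ⟪x j, q⟫ ∧ α ≤ ⟪x j, x star⟫) (fun s => a₁ ≤ ⟪x s, q⟫)
    (fun j h => ha.trans h.1) (D := n * lo / 8) (m := m) (M := M) (by positivity) ?_ ?_ ?_ ?_)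
    (le_of_eq ?_)
  · intro j hj _
    refine (hx.deg_lo j).le.trans (le_of_eq ?_)
    rw [deg, others, Finset.filter_filter]
    simp only [real_inner_comm]
  · rw [others, Finset.filter_filter] at hJ
    simp only [and_self] at hJ
    convert hJ
  · refine le_trans (Nat.cast_le.2 (Finset.card_le_card ?_)) h2
    intro z
    simp only [Finset.mem_filter, Finset.mem_univ, true_and]
    rintro ⟨hz, ⟨hJ1, hJ2⟩, hadj, hH⟩
    exact ⟨hz, ⟨hx.norm_eq _, (hx.far _ hz.2.1).le, hJ1, hJ2⟩, hadj, hH⟩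
  · refine le_trans (Nat.cast_le.2 (Finset.card_le_card ?_)) h3
    intro z
    simp only [Finset.mem_filter, Finset.mem_univ, true_and]
    rintro ⟨hz, ⟨hJ1, hJ2⟩, hadj, hadj', hH⟩
    refine ⟨hz, ⟨⟨hx.norm_eq _, hJ1, hJ2⟩, hx.norm_eq _, (hx.far _ hz.1).le, hadj⟩, ?_, hH⟩
    rwa [real_inner_comm]
  · congr

open Classical in
/-- There are many starts at distance two from the planted neighbor. -/
lemma few_secondStart_le (hd : 2 ≤ d) (hn : 4 ≤ n) (hq : ‖q‖ = 1) (hγ : γ ^ 2 ≤ 1) (hlo : 0 < lo)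
    (hcap : ∀ p : E d, ‖p‖ = 1 → (sphereLaw d).real {x | α ≤ ⟪x, p⟫} ≤ hi) (hhi : 0 ≤ hi)
    {W w : ℝ} (hW : ∀ p : E d, ‖p‖ = 1 → ⟪p, q⟫ ≤ η →
      (sphereLaw d).real {x | α ≤ ⟪x, p⟫ ∧ a₁ ≤ ⟪x, q⟫} ≤ W) (hW0 : 0 ≤ W)
    (hw : ∀ p : E d, ‖p‖ = 1 → ⟪p, q⟫ = γ →
      w ≤ (sphereLaw d).real {x | a₂ ≤ ⟪x, q⟫ ∧ α ≤ ⟪x, p⟫}) (hw0 : 0 < w) (ha : a₁ ≤ a₂) :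
    dataLaw star q γ {x | Typical star q γ α η lo hi x ∧
      ((Finset.univ.filter fun s => SecondStart α a₁ a₂ star q x s).card : ℝ) <
        n * (n * w * lo) / 128} ≤
      ENNReal.ofReal (Real.exp (-(n * w / 8)) + 256 * W / lo + 256 * (n * hi) * W / lo) := by
  have hd0 : 0 < d := by omega
  have := isProbabilityMeasure_coord hd0 star q γ
  have := isProbabilityMeasure_sphereLaw hd0
  have hn0 : (0 : ℝ) < n := by exact_mod_cast (by omega : 0 < n)
  have hm : MeasurableSet {x : Fin n → E d | Typical star q γ α η lo hi x ∧
      ((Finset.univ.filter fun s => SecondStart α a₁ a₂ star q x s).card : ℝ) <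
        n * (n * w * lo) / 128} := by
    rw [Set.ofPred_and]
    exact measurableSet_typical.inter (measurableSet_lt (measurable_card_filter _
      (fun s x => SecondStart α a₁ a₂ star q x s) fun s _ => measurableSet_secondStart s)
      measurable_const)
  set ν := fun i : Fin n => if i = star then plantedLaw q γ else sphereLaw d with hν
  have hνi : ∀ i, i ≠ star → ν i = sphereLaw d := fun i hi => by simp [hν, hi]
  refine pi_le_of_forall_coord ν star hm ?_
  have hstar : ν star = plantedLaw q γ := by simp [hν]
  rw [hstar]
  filter_upwards [ae_plantedLaw hd hq hγ] with p ⟨hp, hpq⟩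
  set S := {y : E d | a₂ ≤ ⟪y, q⟫ ∧ α ≤ ⟪y, p⟫} with hS
  have hSm : MeasurableSet S := (measurableSet_cap q a₂).inter (measurableSet_cap p α)
  -- With the planted point fixed at `p`, the exact wedge volume `π` is used and not its lower bound
  -- `w`. Both the number of good edges and the expected numbers of bad configurations are
  -- proportional to `π`, which cancels in Markov's inequality.
  set π := (sphereLaw d).real S with hπ
  have hπw : w ≤ π := hw p hp hpq
  have hπ0 : 0 < π := hw0.trans_le hπw
  set M := n * (n * π * lo) / 256 with hM
  have hM0 : 0 < M := by positivity
  set T := others star star with hT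
  set T2 := Finset.univ.filter fun z : Fin n × Fin n => z.1 ≠ star ∧ z.2 ≠ star ∧ z.1 ≠ z.2 with hT2
  set T3 := Finset.univ.filter fun z : Fin n × Fin n × Fin n => z.1 ≠ star ∧ z.2.1 ≠ star ∧
      z.2.2 ≠ star ∧ z.1 ≠ z.2.1 ∧ z.2.2 ≠ z.1 ∧ z.2.2 ≠ z.2.1 with hT3
  let P2 : Fin n × Fin n → (Fin n → E d) → Prop := fun z x =>
    (‖x z.2‖ = 1 ∧ ⟪x z.2, q⟫ ≤ η ∧ x z.2 ∈ S) ∧ α ≤ ⟪x z.1, x z.2⟫ ∧ a₁ ≤ ⟪x z.1, q⟫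
  let P3 : Fin n × Fin n × Fin n → (Fin n → E d) → Prop := fun z x =>
    ((‖x z.2.1‖ = 1 ∧ x z.2.1 ∈ S) ∧ ‖x z.1‖ = 1 ∧ ⟪x z.1, q⟫ ≤ η ∧ α ≤ ⟪x z.1, x z.2.1⟫) ∧
      α ≤ ⟪x z.2.2, x z.1⟫ ∧ a₁ ≤ ⟪x z.2.2, q⟫
  have m1 : ∀ i, MeasurableSet {x : Fin n → E d | ‖x i‖ = 1} := fun i =>
    measurableSet_eq_fun (by fun_prop) measurable_const
  have m2 : ∀ i, MeasurableSet {x : Fin n → E d | ⟪x i, q⟫ ≤ η} := fun i =>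
    measurableSet_le (by fun_prop) measurable_const
  have m3 : ∀ i, MeasurableSet {x : Fin n → E d | x i ∈ S} := fun i => measurable_pi_apply i hSm
  have hSi : ∀ i, i ≠ star → Measure.pi ν {x | x i ∈ S} = ENNReal.ofReal π := by
    intro i hi
    have h := dataLaw_coord (star := star) (q := q) (γ := γ) hd0 i hSm
    rw [if_neg hi] at h
    exact h.trans (ofReal_measureReal).symm
  have mP2 : ∀ z, MeasurableSet {x | P2 z x} := fun z =>
    ((m1 _).inter ((m2 _).inter (m3 _))).inter
      ((measurableSet_le_inner _ _ _).inter (measurableSet_le_inner_const _ _ _))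
  have mP3 : ∀ z, MeasurableSet {x | P3 z x} := fun z =>
    (((m1 _).inter (m3 _)).inter ((m1 _).inter ((m2 _).inter (measurableSet_le_inner _ _ _)))).inter
      ((measurableSet_le_inner _ _ _).inter (measurableSet_le_inner_const _ _ _))
  -- Redraw `s` with `j` fixed: `s` must be adjacent to `j` and of high level, which has probability
  -- at most `W`; the condition on `j` contributes `π`.
  have b2 : ∀ z ∈ T2, Measure.pi ν {x | P2 z x} ≤ ENNReal.ofReal (W * π) := by
    rintro ⟨s, j⟩ hz
    simp only [hT2, Finset.mem_filter, Finset.mem_univ, true_and] at hz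
    obtain ⟨hs, hj, hsj⟩ := hz
    have hB : MeasurableSet {x : Fin n → E d | ‖x j‖ = 1 ∧ ⟪x j, q⟫ ≤ η ∧ x j ∈ S} :=
      (m1 _).inter ((m2 _).inter (m3 _))
    rw [ENNReal.ofReal_mul hW0]
    refine (pi_le_mul ν s (mP2 (s, j)) hB (w := ENNReal.ofReal W) ?_ ?_).trans ?_
    · rintro x y ⟨h, -⟩
      simpa only [Function.update_of_ne hsj.symm, Set.mem_ofPred_eq] using h
    · rintro x ⟨h1, h2, -⟩
      rw [hνi s hs, ← ofReal_measureReal]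
      refine ENNReal.ofReal_le_ofReal ((measureReal_mono ?_).trans (hW (x j) h1 h2))
      rintro y ⟨-, h3, h4⟩
      simp only [Function.update_self, Function.update_of_ne hsj.symm] at h3 h4
      exact ⟨h3, h4⟩
    · gcongr
      rw [← hSi j hj]
      exact measure_mono fun x hx => hx.2.2
  -- Redraw `k` given `s` (factor `W`), then `s` given `j` (factor `hi`), then `j` (factor `π`).
  have b3 : ∀ z ∈ T3, Measure.pi ν {x | P3 z x} ≤ ENNReal.ofReal (W * (hi * π)) := by
    rintro ⟨s, j, k⟩ hz
    simp only [hT3, Finset.mem_filter, Finset.mem_univ, true_and] at hz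
    obtain ⟨hs, hj, hk, hsj, hks, hkj⟩ := hz
    have hB' : MeasurableSet {x : Fin n → E d | ‖x j‖ = 1 ∧ x j ∈ S} := (m1 _).inter (m3 _)
    have hB : MeasurableSet {x : Fin n → E d | (‖x j‖ = 1 ∧ x j ∈ S) ∧ ‖x s‖ = 1 ∧ ⟪x s, q⟫ ≤ η ∧
        α ≤ ⟪x s, x j⟫} :=
      ((m1 _).inter (m3 _)).inter ((m1 _).inter ((m2 _).inter (measurableSet_le_inner _ _ _)))
    rw [ENNReal.ofReal_mul hW0]
    refine (pi_le_mul ν k (mP3 (s, j, k)) hB (w := ENNReal.ofReal W) ?_ ?_).trans ?_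
    · rintro x y ⟨h, -⟩
      simpa only [Function.update_of_ne hks.symm, Function.update_of_ne hkj.symm, Set.mem_ofPred_eq] using h
    · rintro x ⟨-, h1, h2, -⟩
      rw [hνi k hk, ← ofReal_measureReal]
      refine ENNReal.ofReal_le_ofReal ((measureReal_mono ?_).trans (hW (x s) h1 h2))
      rintro y ⟨-, h3, h4⟩
      simp only [Function.update_self, Function.update_of_ne hks.symm] at h3 h4
      exact ⟨h3, h4⟩
    · gcongr
      rw [ENNReal.ofReal_mul hhi]
      refine (pi_le_mul ν s hB hB' (w := ENNReal.ofReal hi) ?_ ?_).trans ?_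
      · rintro x y ⟨h, -⟩
        simpa only [Function.update_of_ne hsj.symm, Set.mem_ofPred_eq] using h
      · rintro x ⟨h1, -⟩
        rw [hνi s hs, ← ofReal_measureReal]
        refine ENNReal.ofReal_le_ofReal ((measureReal_mono ?_).trans (hcap (x j) h1))
        rintro y ⟨-, -, -, h3⟩
        simp only [Function.update_self, Function.update_of_ne hsj.symm] at h3
        exact h3
      · gcongr
        rw [← hSi j hj]
        exact measure_mono fun x hx => hx.2
  have c2 : (T2.card : ℝ) ≤ n * n := by
    have h := Finset.card_le_univ T2
    rw [Fintype.card_prod, Fintype.card_fin] at h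
    exact_mod_cast h
  have c3 : (T3.card : ℝ) ≤ n * (n * n) := by
    have h := Finset.card_le_univ T3
    rw [Fintype.card_prod, Fintype.card_prod, Fintype.card_fin] at h
    exact_mod_cast h
  have f1 : Measure.pi ν {x | ((T.filter fun j => x j ∈ S).card : ℝ) ≤ T.card * π / 4} ≤
      ENNReal.ofReal (Real.exp (-(n * w / 8))) := by
    rw [← ofReal_measureReal]
    refine ENNReal.ofReal_le_ofReal ((card_le_tail ν T S hSm (lo := π) fun j hj => ?_).trans
      (Real.exp_le_exp.2 ?_))
    · simp only [hT, others, Finset.mem_filter] at hj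
      rw [hνi j hj.2.1]
    · have := half_le_card_others hn star star
      rw [← hT] at this
      nlinarith
  have f2 : Measure.pi ν {x | M ≤ ((T2.filter fun z => P2 z x).card : ℝ)} ≤
      ENNReal.ofReal (256 * W / lo) := by
    refine (card_filter_markov _ T2 P2 (fun z _ => mP2 z) hM0 b2).trans
      (ENNReal.ofReal_le_ofReal ?_)
    calc T2.card * (W * π) / M ≤ n * n * (W * π) / M := by gcongr
      _ = _ := by rw [hM]; field_simp
  have f3 : Measure.pi ν {x | M ≤ ((T3.filter fun z => P3 z x).card : ℝ)} ≤
      ENNReal.ofReal (256 * (n * hi) * W / lo) := by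
    refine (card_filter_markov _ T3 P3 (fun z _ => mP3 z) hM0 b3).trans
      (ENNReal.ofReal_le_ofReal ?_)
    calc T3.card * (W * (hi * π)) / M ≤ n * (n * n) * (W * (hi * π)) / M := by gcongr
      _ = _ := by rw [hM]; field_simp
  have hsub : {x | Function.update x star p ∈ {x : Fin n → E d | Typical star q γ α η lo hi x ∧
      ((Finset.univ.filter fun s => SecondStart α a₁ a₂ star q x s).card : ℝ) <
        n * (n * w * lo) / 128}} ⊆
      ({x | ((T.filter fun j => x j ∈ S).card : ℝ) ≤ T.card * π / 4} ∪
        {x | M ≤ ((T2.filter fun z => P2 z x).card : ℝ)}) ∪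
        {x | M ≤ ((T3.filter fun z => P3 z x).card : ℝ)} := by
    rintro x ⟨hx, hlt⟩
    by_contra hcon
    simp only [Set.mem_union, Set.mem_ofPred_eq, not_or, not_le] at hcon
    obtain ⟨⟨g1, g2⟩, g3⟩ := hcon
    set x' := Function.update x star p with hx'
    have hne : ∀ i, i ≠ star → x' i = x i := fun i hi => by rw [hx', Function.update_of_ne hi]
    have hs : x' star = p := by simp [hx']
    have key := le_card_secondStart hx ha hlo.le (m := T.card * π / 4) (M := M) ?_ ?_ ?_
    -- At least `nπ/8` points `j` with degrees at least `n lo/8` give `n²π lo/64` edges; the two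
    -- kinds of bad configurations remove at most half of this.
    · have := half_le_card_others hn star star
      rw [← hT] at this
      have e1 : n * (n * w * lo) ≤ n * (n * π * lo) := by gcongr
      have e2 : n / 2 * π / 4 * (n * lo / 8) ≤ T.card * π / 4 * (n * lo / 8) := by gcongr
      have e3 : n / 2 * π / 4 * (n * lo / 8) - 2 * M = n * (n * π * lo) / 128 := by
        rw [hM]; ring
      linarith
    · refine g1.le.trans (le_of_eq ?_)
      congr 2
      refine Finset.filter_congr fun j hj => ?_
      simp only [hT, others, Finset.mem_filter] at hj
      rw [hne j hj.2.1, hs]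
      rfl
    · refine le_trans (le_of_eq ?_) g2.le
      congr 2
      refine Finset.filter_congr fun z hz => ?_
      simp only [Finset.mem_filter, Finset.mem_univ, true_and] at hz
      rw [hne _ hz.1, hne _ hz.2.1, hs]
      rfl
    · refine le_trans (le_of_eq ?_) g3.le
      congr 2
      refine Finset.filter_congr fun z hz => ?_
      simp only [Finset.mem_filter, Finset.mem_univ, true_and] at hz
      rw [hne _ hz.1, hne _ hz.2.1, hne _ hz.2.2.1, hs]
      rfl
  calc _ ≤ _ := measure_mono hsub
    _ ≤ _ := (measure_union_le _ _).trans (add_le_add (measure_union_le _ _) le_rfl)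
    _ ≤ _ := add_le_add (add_le_add f1 f2) f3
    _ = _ := by
      rw [← ENNReal.ofReal_add (by positivity) (by positivity),
        ← ENNReal.ofReal_add (by positivity) (by positivity)]

end SecondStarts

/-! ### Outcome on typical instances -/

section Outcome

variable {d n : ℕ}

/-- The data structure is correct, and its costs obey the given bounds. -/
def Outcome (α γ : ℝ) (q : E d) (star : Fin n) (tq slo shi ilo ihi dlo dhi : ℝ)
    (ω : (Fin n → E d) × (ℕ → Fin n)) : Prop :=
  (Store.build α ω.1).Represents α (Finset.range n) (labelled ω.1)
  ∧ (Store.build α ω.1).QueryReturns q γ (fun k => (ω.2 k : ℕ)) star tq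
  ∧ ((Store.build α ω.1).space : ℝ) ∈ Set.Icc slo shi
  ∧ (∀ p : E d, ‖p‖ = 1 →
      (((Store.build α ω.1).insert α p).val.Represents α (Finset.range (n + 1))
        (Function.update (labelled ω.1) n p)
      ∧ (((Store.build α ω.1).insert α p).cost : ℝ) ∈ Set.Icc ilo ihi))
  ∧ (∀ j : Fin n,
      (((Store.build α ω.1).delete j).val.Represents α ((Finset.range n).erase j) (labelled ω.1)
      ∧ (((Store.build α ω.1).delete j).cost : ℝ) ∈ Set.Icc dlo dhi))

lemma labelled_coe (x : Fin n → E d) (i : Fin n) : labelled x i = x i := by simp [labelled]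

lemma mem_bucket (α : ℝ) (x : Fin n → E d) (i j : Fin n) :
    (j : ℕ) ∈ ((Store.build α x).bucket i).klist ↔ i ≠ j ∧ α ≤ ⟪x i, x j⟫ := by
  rw [(Store.build_inv α x).mem_iff i i.2 j]
  simp only [j.2, true_and, nnGraph, labelled_coe, ne_eq, Fin.val_inj]

lemma lt_of_mem_bucket {α : ℝ} {x : Fin n → E d} {i k : ℕ} (hi : i < n)
    (hk : k ∈ ((Store.build α x).bucket i).klist) : k < n :=
  (((Store.build_inv α x).mem_iff i hi k).1 hk).1

lemma pt_build (α : ℝ) (x : Fin n → E d) (i : Fin n) : (Store.build α x).pt i = x i := by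
  rw [(Store.build_inv α x).pt_eq i i.2, labelled_coe]

open Classical in
lemma length_bucket (α : ℝ) (star : Fin n) (x : Fin n → E d) (i : Fin n) :
    deg α star x i ≤ ((Store.build α x).bucket i).klist.length ∧
      ((Store.build α x).bucket i).klist.length ≤ deg α star x i + 1 := by
  have hnd := ((Store.build_inv α x).good i i.2).nodup
  rw [← List.toFinset_card_of_nodup hnd, deg]
  constructor
  · rw [← Finset.card_map Fin.valEmbedding]
    refine Finset.card_le_card fun k hk => ?_
    simp only [Finset.mem_map, Finset.mem_filter, others, Finset.mem_univ, true_and,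
      Fin.valEmbedding_apply] at hk
    obtain ⟨j, ⟨⟨h1, -⟩, h2⟩, rfl⟩ := hk
    rw [List.mem_toFinset, mem_bucket]
    exact ⟨h1.symm, h2⟩
  · rw [← Finset.card_map Fin.valEmbedding]
    refine (Finset.card_le_card (t := insert (star : ℕ) (Finset.map Fin.valEmbedding
      ((others star i).filter fun j => α ≤ ⟪x i, x j⟫))) fun k hk => ?_).trans
      (Finset.card_insert_le _ _)
    rw [List.mem_toFinset] at hk
    have hkn := lt_of_mem_bucket i.2 hk
    have h1 := (mem_bucket α x i ⟨k, hkn⟩).1 hk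
    by_cases hs : (⟨k, hkn⟩ : Fin n) = star
    · rw [← hs]; simp
    · refine Finset.mem_insert_of_mem (Finset.mem_map.2 ⟨⟨k, hkn⟩, ?_, rfl⟩)
      simp only [others, Finset.mem_filter, Finset.mem_univ, true_and]
      exact ⟨⟨h1.1.symm, hs⟩, h1.2⟩

variable {star : Fin n} {q : E d} {α γ η lo hi : ℝ} {x : Fin n → E d}

/-- The constant gap between `η` and `γ` provides the margin `1/d` by which the planted point beats
all others. -/
lemma Typical.queryHyp (hx : Typical star q γ α η lo hi x) (hd : 0 < d) (hq : ‖q‖ = 1)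
    (hη : η + 1 / (d : ℝ) ≤ γ) {D : ℕ} (hD : 4 * (n * hi) + 1 ≤ D) :
    (Store.build α x).QueryHyp q γ star n D (D * (n.size + 1)) := by
  have hlen : ∀ i < n, ((Store.build α x).bucket i).klist.length ≤ D := by
    intro i hi
    have h1 := (length_bucket α star x ⟨i, hi⟩).2
    have h2 := hx.deg_hi ⟨i, hi⟩
    have h3 : ((deg α star x ⟨i, hi⟩ + 1 : ℕ) : ℝ) ≤ D := by push_cast; linarith
    exact h1.trans (by exact_mod_cast h3)
  refine ⟨hd, ?_, ?_, ?_, ?_, hlen, ?_⟩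
  · rw [pt_build, hx.planted]
  · intro i hi hne
    have h := pt_build α x ⟨i, hi⟩
    simp only at h
    rw [h]
    have := hx.far ⟨i, hi⟩ (fun h => hne (by rw [← h]))
    linarith
  · intro i hi
    have h := pt_build α x ⟨i, hi⟩
    simp only at h
    rw [h]
    have := abs_real_inner_le_norm (x ⟨i, hi⟩) q
    rwa [hx.norm_eq, hq, one_mul] at this
  · exact fun i hi j hj => lt_of_mem_bucket hi hj
  · exact (Store.build_inv α x).nodes_le hlen

lemma outcome_of_typical (hx : Typical star q γ α η lo hi x) (hd : 0 < d) (hq : ‖q‖ = 1)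
    (hη : η + 1 / (d : ℝ) ≤ γ) {D R : ℕ} (hD : 4 * (n * hi) + 1 ≤ D) {ω : ℕ → Fin n}
    (hω : ∃ K < R, ∀ k, (Store.build α x).LoopReturns q γ (fun k => (ω k : ℕ)) star (ω K) k
      (3 * Store.roundCost d D (D * (n.size + 1)))) :
    Outcome α γ q star
      (((R * (2 * d + 1) + 4) * Store.roundCost d D (D * (n.size + 1)) : ℕ) : ℝ)
      (n * (n * lo / 8)) ((n * (d + 2 + 3 * (D * (n.size + 1))) : ℕ) : ℝ)
      n (((n + 1) * (2 * d + 2 * n.size + 6) : ℕ) : ℝ)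
      (n * lo / 8) (((D + 1) * (3 * n.size + 6) : ℕ) : ℝ) (x, ω) := by
  have hinv := Store.build_inv α x
  have hQ := hx.queryHyp hd hq hη hD
  have hlo : ∀ i < n, ⌈n * lo / 8⌉₊ ≤ ((Store.build α x).bucket i).klist.length := by
    intro i hi
    rw [Nat.ceil_le]
    have h1 := (length_bucket α star x ⟨i, hi⟩).1
    have h2 := hx.deg_lo ⟨i, hi⟩
    exact h2.le.trans (by exact_mod_cast h1)
  refine ⟨hinv.represents, ?_, ⟨?_, ?_⟩, fun p _ => ?_, fun j => ?_⟩
  · obtain ⟨K, hK, hL⟩ := hω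
    exact hQ.queryReturns (fun k => (ω k).2) hK hL
  · have h := hinv.le_space hlo
    calc (n : ℝ) * (n * lo / 8) ≤ n * (⌈n * lo / 8⌉₊ : ℝ) := by
          gcongr; exact Nat.le_ceil _
      _ ≤ _ := by exact_mod_cast h
  · exact Nat.cast_le.2 (hinv.space_le hQ.length_le)
  · obtain ⟨h1, h2, h3⟩ := hinv.insert le_rfl p
    exact ⟨h1.represents, Nat.cast_le.2 h2, Nat.cast_le.2 h3⟩
  · obtain ⟨h1, h2, h3⟩ := hinv.delete j.2 (Nat.size_le_size j.2.le)
    refine ⟨h1, ?_, ?_⟩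
    · exact (Nat.le_ceil _).trans (Nat.cast_le.2 ((hlo j j.2).trans h2))
    · refine Nat.cast_le.2 (h3.trans ?_)
      gcongr
      exact hQ.length_le j j.2

lemma Store.QueryReturns.mono {S : Store d} {ω : ℕ → ℕ} {r : ℕ} {T T' : ℝ}
    (h : S.QueryReturns q γ ω r T) (hT : T ≤ T') : S.QueryReturns q γ ω r T' := by
  obtain ⟨f, h1, h2⟩ := h
  exact ⟨f, h1, h2.trans hT⟩

lemma Outcome.mono {tq slo shi ilo ihi dlo dhi tq' slo' shi' ilo' ihi' dlo' dhi' : ℝ}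
    {ω : (Fin n → E d) × (ℕ → Fin n)} (h : Outcome α γ q star tq slo shi ilo ihi dlo dhi ω)
    (h1 : tq ≤ tq') (h2 : slo' ≤ slo) (h3 : shi ≤ shi') (h4 : ilo' ≤ ilo) (h5 : ihi ≤ ihi')
    (h6 : dlo' ≤ dlo) (h7 : dhi ≤ dhi') :
    Outcome α γ q star tq' slo' shi' ilo' ihi' dlo' dhi' ω :=
  ⟨h.1, h.2.1.mono h1, Set.Icc_subset_Icc h2 h3 h.2.2.1,
    fun p hp => ⟨(h.2.2.2.1 p hp).1, Set.Icc_subset_Icc h4 h5 (h.2.2.2.1 p hp).2⟩,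
    fun j => ⟨(h.2.2.2.2 j).1, Set.Icc_subset_Icc h6 h7 (h.2.2.2.2 j).2⟩⟩

/-- Starts at neighbors of `star` are good. -/
lemma loopReturns_of_nbr {D N : ℕ} (hQ : (Store.build α x).QueryHyp q γ star n D N) {s : Fin n}
    (hs : s ≠ star) (h : α ≤ ⟪x s, x star⟫) (ω : ℕ → ℕ) (k : ℕ) :
    (Store.build α x).LoopReturns q γ ω star s k (3 * Store.roundCost d D N) :=
  (hQ.of_nbr s.2 ((mem_bucket α x s star).2 ⟨hs, h⟩)).mono (by omega)

/-- Starts at distance two from `star` are good. -/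
lemma loopReturns_of_secondStart {D N : ℕ} (hQ : (Store.build α x).QueryHyp q γ star n D N)
    {a₁ a₂ : ℝ} (ha : a₁ + 1 / (d : ℝ) ≤ a₂) {s : Fin n} (h : SecondStart α a₁ a₂ star q x s)
    (ω : ℕ → ℕ) (k : ℕ) :
    (Store.build α x).LoopReturns q γ ω star s k (3 * Store.roundCost d D N) := by
  obtain ⟨hs, hsa, j, hj, hjs, ⟨hj1, hj2⟩, hsj, hk⟩ := h
  refine hQ.of_second_nbr ha s.2 ((mem_bucket α x s j).2 ⟨hjs.symm, hsj⟩)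
    ((mem_bucket α x j star).2 ⟨hj, hj2⟩) ?_ ?_ ?_
  · rwa [pt_build]
  · rw [pt_build]; exact not_le.1 hsa
  · intro i hi hij hir
    have hin := lt_of_mem_bucket s.2 hi
    have h1 := (mem_bucket α x s ⟨i, hin⟩).1 hi
    have h2 := pt_build α x ⟨i, hin⟩
    simp only at h2
    rw [h2]
    exact not_le.1 (hk ⟨i, hin⟩ (fun e => hir (by rw [← e])) h1.1.symm
      (fun e => hij (by rw [← e])) h1.2)

open Classical in
/-- The probability that something goes wrong. -/
lemma not_outcome_le [NeZero n] (hd : 0 < d) (hq : ‖q‖ = 1)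
    (hη : η + 1 / (d : ℝ) ≤ γ) {D R : ℕ} (hD : 4 * (n * hi) + 1 ≤ D)
    (good : Fin n → Set (Fin n → E d)) (hm : ∀ s, MeasurableSet (good s))
    (hgood : ∀ x s, x ∈ good s → ∀ D N, (Store.build α x).QueryHyp q γ star n D N →
      ∀ ω k, (Store.build α x).LoopReturns q γ ω star s k (3 * Store.roundCost d D N)) (g : ℝ) :
    instanceLaw star q γ {ω | ¬ Outcome α γ q star
      (((R * (2 * d + 1) + 4) * Store.roundCost d D (D * (n.size + 1)) : ℕ) : ℝ)
      (n * (n * lo / 8)) ((n * (d + 2 + 3 * (D * (n.size + 1))) : ℕ) : ℝ)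
      n (((n + 1) * (2 * d + 2 * n.size + 6) : ℕ) : ℝ)
      (n * lo / 8) (((D + 1) * (3 * n.size + 6) : ℕ) : ℝ) ω} ≤
    dataLaw star q γ {x | ¬ Typical star q γ α η lo hi x} +
      dataLaw star q γ {x | Typical star q γ α η lo hi x ∧
        ((Finset.univ.filter fun s => x ∈ good s).card : ℝ) < g} +
      ENNReal.ofReal (Real.exp (-(R * (g / n)))) := by
  have := isProbabilityMeasure_coord hd star q γ
  have : IsProbabilityMeasure (dataLaw star q γ) := by unfold dataLaw; infer_instance
  have hfst : ∀ A : Set (Fin n → E d), instanceLaw star q γ (Prod.fst ⁻¹' A) =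
      dataLaw star q γ A := by
    intro A
    rw [← Set.prod_univ, instanceLaw, Measure.prod_prod, measure_univ, mul_one]
  rw [← hfst, ← hfst]
  -- Only monotonicity and subadditivity are applied to the failure event, so its measurability is
  -- not needed.
  refine le_trans (measure_mono (t := (Prod.fst ⁻¹' {x | ¬ Typical star q γ α η lo hi x} ∪
    Prod.fst ⁻¹' {x | Typical star q γ α η lo hi x ∧
        ((Finset.univ.filter fun s => x ∈ good s).card : ℝ) < g}) ∪
    {z : (Fin n → E d) × (ℕ → Fin n) | g ≤ ((Finset.univ.filter fun i => z.1 ∈ good i).card : ℝ) ∧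
      ∀ k < R, z.1 ∉ good (z.2 k)}) ?_) ((measure_union_le _ _).trans
      (add_le_add (measure_union_le _ _) (prod_startLaw_avoid_le _ good hm R g)))
  rintro ⟨x, ω⟩ hz
  by_contra hcon
  simp only [Set.mem_union, Set.mem_preimage, Set.mem_ofPred_eq, not_or, not_not, not_and,
    not_lt, not_forall] at hcon
  obtain ⟨⟨hx, hc⟩, hω⟩ := hcon
  obtain ⟨K, hK, hKg⟩ := hω (hc hx)
  exact hz (outcome_of_typical hx hd hq hη hD
    ⟨K, hK, hgood x _ hKg D _ (hx.queryHyp hd hq hη hD) _⟩)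

end Outcome

/-! ### Asymptotics -/

/-- Probabilities bounded by a null sequence tend to zero. -/
lemma tendsto_measure_of_le {X : ℕ → Type*} [∀ d, MeasurableSpace (X d)] {m : ∀ d, Measure (X d)}
    {A : ∀ d, Set (X d)} {f : ℕ → ENNReal} (hf : Tendsto f atTop (𝓝 0))
    (h : ∀ᶠ d in atTop, m d (A d) ≤ f d) : Tendsto (fun d => m d (A d)) atTop (𝓝 0) :=
  tendsto_of_tendsto_of_tendsto_of_le_of_le' tendsto_const_nhds hf
    (Eventually.of_forall fun _ => zero_le) h

lemma tendsto_ofReal_zero {f : ℕ → ℝ} (hf : Tendsto f atTop (𝓝 0)) :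
    Tendsto (fun d => ENNReal.ofReal (f d)) atTop (𝓝 0) := by
  simpa using ENNReal.tendsto_ofReal hf

namespace Sparse

variable {n : ℕ → ℕ} {μ : ℕ → ℝ}

lemma log_le_rpow (h : Sparse n μ) {a : ℝ} (ha : 0 < a) (C : ℝ) :
    ∀ᶠ d in atTop, C * Real.log (n d) + C ≤ (n d : ℝ) ^ a := by
  filter_upwards [h.le_rpow (half_pos ha) (|C| * (1 / (a / 2) + 1)), h.le_rpow (half_pos ha) 1]
    with d h1 h2
  have hn : (0 : ℝ) < n d := by exact_mod_cast h.pos d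
  have h3 := Real.log_le_rpow_div hn.le (half_pos ha)
  set y := (n d : ℝ) ^ (a / 2) with hy
  have h4 : (n d : ℝ) ^ a = y * y := by rw [hy, ← Real.rpow_add hn]; congr 1; ring
  have hL : 0 ≤ Real.log (n d) := Real.log_natCast_nonneg _
  calc C * Real.log (n d) + C ≤ |C| * Real.log (n d) + |C| := by
        gcongr <;> exact le_abs_self C
    _ ≤ |C| * (y / (a / 2)) + |C| * y := by
        gcongr
        nlinarith [abs_nonneg C]
    _ = |C| * (1 / (a / 2) + 1) * y := by ring
    _ ≤ y * y := by gcongr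
    _ = _ := h4.symm

lemma size_le_rpow (h : Sparse n μ) {a : ℝ} (ha : 0 < a) :
    ∀ᶠ d in atTop, ((n d).size : ℝ) + 1 ≤ (n d : ℝ) ^ a := by
  filter_upwards [h.log_le_rpow ha 2] with d h1
  refine le_trans ?_ h1
  have hn : (0 : ℝ) < n d := by exact_mod_cast h.pos d
  have hpos : 0 < (n d).size := Nat.size_pos.2 (h.pos d)
  obtain ⟨m, hm⟩ : ∃ m, (n d).size = m + 1 := ⟨(n d).size - 1, by omega⟩
  have h2 : 2 ^ m ≤ n d := Nat.lt_size.1 (by omega)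
  have h3 : (m : ℝ) * Real.log 2 ≤ Real.log (n d) := by
    rw [← Real.log_pow]
    exact Real.log_le_log (by positivity) (by exact_mod_cast h2)
  have h4 : 1 / 2 < Real.log 2 := by have := Real.log_two_gt_d9; linarith
  rw [hm]
  push_cast
  have h5 : (0 : ℝ) ≤ m := Nat.cast_nonneg m
  nlinarith

lemma tendsto_rpow_neg (h : Sparse n μ) {x : ℝ} (hx : x < 0) (C : ℝ) :
    Tendsto (fun d => C * (n d : ℝ) ^ x) atTop (𝓝 0) := by
  have h1 := (h.tendsto_rpow (neg_pos.2 hx)).inv_tendsto_atTop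
  have h2 : (fun d => (n d : ℝ) ^ x) = (fun d => (n d : ℝ) ^ (-x))⁻¹ := by
    ext d
    rw [Pi.inv_apply, ← Real.rpow_neg (Nat.cast_nonneg _), neg_neg]
  rw [← h2] at h1
  simpa using h1.const_mul C

lemma tendsto_exp_neg_rpow (h : Sparse n μ) {a c : ℝ} (ha : 0 < a) (hc : 0 < c) :
    Tendsto (fun d => Real.exp (-((n d : ℝ) ^ a / c))) atTop (𝓝 0) :=
  Real.tendsto_exp_neg_atTop_nhds_zero.comp ((h.tendsto_rpow ha).atTop_div_const hc)

/-- An exponentially small probability beats a union bound over the data set. -/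
lemma tendsto_mul_exp_neg_rpow (h : Sparse n μ) {a c : ℝ} (ha : 0 < a) (hc : 0 < c) :
    Tendsto (fun d => (n d : ℝ) * (2 * Real.exp (-((n d : ℝ) ^ a / c)))) atTop (𝓝 0) := by
  refine squeeze_zero' (Eventually.of_forall fun d => by positivity) ?_
    (h.tendsto_rpow_neg (x := -1) (by norm_num) 2)
  filter_upwards [h.log_le_rpow ha (2 * c)] with d hd
  have hn : (0 : ℝ) < n d := by exact_mod_cast h.pos d
  rw [h.rpow_eq d (-1)]
  have h1 : 2 * Real.log (n d) ≤ (n d : ℝ) ^ a / c := by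
    rw [le_div_iff₀ hc]; nlinarith
  calc (n d : ℝ) * (2 * Real.exp (-((n d : ℝ) ^ a / c)))
      ≤ Real.exp (Real.log (n d)) * (2 * Real.exp (-(2 * Real.log (n d)))) := by
        rw [Real.exp_log hn]; gcongr
    _ = 2 * (Real.exp (Real.log (n d)) * Real.exp (-(2 * Real.log (n d)))) := by ring
    _ = _ := by rw [← Real.exp_add]; congr 2; ring

end Sparse

/-- Products of powers in the cost bounds. -/
lemma cost_bounds {A X Y d m D R n : ℝ} (hA : 2000 ≤ A) (hX : 1 ≤ X) (hY : 1 ≤ Y) (hd0 : 0 ≤ d)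
    (hd : d ≤ A) (hm0 : 0 ≤ m) (hm : m + 1 ≤ A) (hD0 : 0 ≤ D) (hD : D ≤ 4 * (X * A) + 2)
    (hR : R ≤ Y * A ^ 3 + 1) (hn : 1 ≤ n) :
    (R * (2 * d + 1) + 4) * (2 * d + 3 + 2 * (D * (m + 1)) + D * (4 * d + 2)) ≤ Y * X * A ^ 9 ∧
    n * (d + 2 + 3 * (D * (m + 1))) ≤ n * (X * A ^ 4) ∧
    (n + 1) * (2 * d + 2 * m + 6) ≤ n * A ^ 2 ∧ (D + 1) * (3 * m + 6) ≤ X * A ^ 4 := by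
  have hA0 : 0 < A := by linarith
  have hA1 : 1 ≤ A := by linarith
  have p2 : A ^ 2 = A * A := by ring
  have hXA : A ≤ X * A := by nlinarith
  -- The factor `A = n^e` bounds `d`, the digit count and all constants. Its ninth power is reached
  -- as `A^5` for the number of rounds times `A^4` for the cost of a round. The `-1` leaves room for
  -- `D + 1` in the cost of deletion.
  have hD2 : D ≤ X * A ^ 2 - 1 := by
    have h1 : 2000 * (X * A) ≤ A * (X * A) := by gcongr
    nlinarith
  have hD3 : D * (m + 1) ≤ X * A ^ 3 := by
    calc D * (m + 1) ≤ (X * A ^ 2) * A := by gcongr; linarith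
      _ = _ := by ring
  have hXp : ∀ k, A ^ k ≤ X * A ^ k := fun k => le_mul_of_one_le_left (by positivity) hX
  have hA3 : A ≤ A ^ 3 := le_self_pow₀ hA1 (by norm_num)
  have hA2 : A ≤ A ^ 2 := le_self_pow₀ hA1 (by norm_num)
  have hA23 : A ^ 2 ≤ A ^ 3 := pow_le_pow_right₀ hA1 (by norm_num)
  have hA4 : 2000 * (X * A ^ 3) ≤ X * A ^ 4 := by
    calc 2000 * (X * A ^ 3) ≤ A * (X * A ^ 3) := by gcongr
      _ = _ := by ring
  have hX3 := hXp 3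
  have hDd : D * (4 * d + 2) ≤ 6 * (X * A ^ 3) := by
    calc D * (4 * d + 2) ≤ (X * A ^ 2) * (6 * A) := by gcongr <;> linarith
      _ = _ := by ring
  refine ⟨?_, ?_, ?_, ?_⟩
  · have hY3 : A ^ 3 ≤ Y * A ^ 3 := le_mul_of_one_le_left (by positivity) hY
    have hR2 : R * (2 * d + 1) ≤ (2 * (Y * A ^ 3)) * (3 * A) := by gcongr <;> linarith
    have hR3 : R * (2 * d + 1) + 4 ≤ Y * A ^ 5 := by
      have : 2000 * (Y * A ^ 4) ≤ Y * A ^ 5 := by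
        calc 2000 * (Y * A ^ 4) ≤ A * (Y * A ^ 4) := by gcongr
          _ = _ := by ring
      have : 1 ≤ Y * A ^ 4 := one_le_mul_of_one_le_of_one_le hY (one_le_pow₀ hA1)
      nlinarith
    calc _ ≤ (Y * A ^ 5) * (X * A ^ 4) := by
          gcongr
          linarith
      _ = _ := by ring
  · gcongr
    linarith
  · calc (n + 1) * (2 * d + 2 * m + 6) ≤ (2 * n) * (10 * A) := by gcongr <;> linarith
      _ = n * (20 * A) := by ring
      _ ≤ n * A ^ 2 := by gcongr; nlinarith
  · calc (D + 1) * (3 * m + 6) ≤ (X * A ^ 2) * (6 * A) := by gcongr <;> linarith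
      _ = 6 * (X * A ^ 3) := by ring
      _ ≤ _ := by nlinarith

open Classical in
/-- The theorem, given that there are many good starts. -/
lemma Sparse.tendsto_outcome {n : ℕ → ℕ} [∀ d, NeZero (n d)] {μ : ℕ → ℝ} (h : Sparse n μ)
    {κ γ η e θ : ℝ} (hκ0 : 0 < κ) (hγ1 : γ ^ 2 ≤ 1) (hη0 : 0 < η) (hηγ : η < γ)
    (he : 0 < e) (he1 : κ ^ 2 + e < 1) (hθ : 0 ≤ θ)
    {q : ∀ d, E d} (hq : ∀ᶠ d in atTop, ‖q d‖ = 1) (star : ∀ d, Fin (n d))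
    (good : ∀ d, Fin (n d) → Set (Fin (n d) → E d)) (hm : ∀ d s, MeasurableSet (good d s))
    (hgood : ∀ᶠ d in atTop, ∀ x s, x ∈ good d s → ∀ D N,
      (Store.build (κ * μ d) x).QueryHyp (q d) γ (star d) (n d) D N →
      ∀ ω k, (Store.build (κ * μ d) x).LoopReturns (q d) γ ω (star d) s k
        (3 * Store.roundCost d D N))
    (hfew : Tendsto (fun d => dataLaw (star d) (q d) γ {x |
      Typical (star d) (q d) γ (κ * μ d) η ((n d : ℝ) ^ (-κ ^ 2 - e)) ((n d : ℝ) ^ (-κ ^ 2 + e)) x ∧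
      ((Finset.univ.filter fun s => x ∈ good d s).card : ℝ) <
        n d * (n d : ℝ) ^ (-θ - 2 * e) / 128}) atTop (𝓝 0)) :
    Tendsto (fun d => instanceLaw (star d) (q d) γ {ω | ¬ Outcome (κ * μ d) γ (q d) (star d)
      ((n d : ℝ) ^ (θ + (1 - κ ^ 2) + 9 * e)) ((n d : ℝ) ^ (2 - κ ^ 2 - 2 * e))
      ((n d : ℝ) ^ (2 - κ ^ 2 + 4 * e)) ((n d : ℝ) ^ (1 - e)) ((n d : ℝ) ^ (1 + 2 * e))
      ((n d : ℝ) ^ (1 - κ ^ 2 - 2 * e)) ((n d : ℝ) ^ (1 - κ ^ 2 + 4 * e)) ω}) atTop (𝓝 0) := by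
  have t1 : Tendsto (fun d => ENNReal.ofReal (1 * (n d : ℝ) ^ (-1 : ℝ) +
      (n d : ℝ) * (2 * Real.exp (-((n d : ℝ) ^ (1 - κ ^ 2 - e) / 8))))) atTop (𝓝 0) := by
    refine tendsto_ofReal_zero ?_
    have := (h.tendsto_rpow_neg (x := -1) (by norm_num) 1).add
      (h.tendsto_mul_exp_neg_rpow (a := 1 - κ ^ 2 - e) (c := 8) (by linarith) (by norm_num))
    simpa using this
  have t3 : Tendsto (fun d => ENNReal.ofReal (Real.exp (-((n d : ℝ) ^ e / 128)))) atTop (𝓝 0) :=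
    tendsto_ofReal_zero (h.tendsto_exp_neg_rpow he (by norm_num))
  refine tendsto_measure_of_le (f := fun d => _ + _ + _) (by simpa using (t1.add hfew).add t3) ?_
  filter_upwards [hq, hgood, eventually_ge_atTop 2, h.le_cap hκ0.le he, h.cap_le hκ0.le he,
    h.cap_const_le hη0 2, h.le_rpow one_pos 4, h.le_rpow he 2000, h.dim_le_rpow he,
    h.size_le_rpow he, Sparse.inv_sqrt_dim_le (sub_pos.2 hηγ)]
    with d hq hgood hd hlo hhi hconst hn4 hA hdA hmA hsqrt
  have hd0 : 0 < d := by omega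
  have hn : (0 : ℝ) < n d := by exact_mod_cast h.pos d
  rw [Real.rpow_one] at hn4
  have hn4' : 4 ≤ n d := by exact_mod_cast hn4
  have hn1 : (1 : ℝ) ≤ n d := by linarith
  have hpow : ∀ a b : ℝ, (n d : ℝ) ^ a * (n d : ℝ) ^ b = (n d : ℝ) ^ (a + b) := fun a b =>
    (Real.rpow_add hn a b).symm
  have hnmul : ∀ a : ℝ, (n d : ℝ) * (n d : ℝ) ^ a = (n d : ℝ) ^ (1 + a) := fun a => by
    rw [Real.rpow_add hn, Real.rpow_one]
  have hpk : ∀ (k : ℕ), ((n d : ℝ) ^ e) ^ k = (n d : ℝ) ^ (k * e) := fun k => by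
    rw [← Real.rpow_natCast, ← Real.rpow_mul hn.le, mul_comm]
  have hη : η + 1 / (d : ℝ) ≤ γ := by
    have hd1 : (1 : ℝ) ≤ d := by exact_mod_cast hd0
    have h1 : √(d : ℝ) ≤ d := Real.sqrt_le_self_iff.2 (Or.inr hd1)
    have h2 : 0 < √(d : ℝ) := Real.sqrt_pos.2 (by linarith)
    have h3 : 1 / (d : ℝ) ≤ 6 / √d := by
      calc 1 / (d : ℝ) ≤ 1 / √d := one_div_le_one_div_of_le h2 h1
        _ ≤ _ := by gcongr; norm_num
    linarith
  set lo := (n d : ℝ) ^ (-κ ^ 2 - e) with hlodef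
  set hi := (n d : ℝ) ^ (-κ ^ 2 + e) with hhidef
  set D := ⌈4 * ((n d : ℝ) * hi) + 1⌉₊ with hDdef
  -- The fraction of good starts is at least `n^(-θ-2e)/128`, so this many starts all miss with
  -- probability at most `exp(-n^e/128)`.
  set R := ⌈(n d : ℝ) ^ (θ + 3 * e)⌉₊ with hRdef
  have key := not_outcome_le (α := κ * μ d) (star := star d) (lo := lo) (hi := hi) hd0 hq hη
    (D := D) (R := R) (Nat.le_ceil _) (good d) (hm d) hgood (n d * (n d : ℝ) ^ (-θ - 2 * e) / 128)
  have hR1 : (n d : ℝ) ^ (θ + 3 * e) ≤ R := Nat.le_ceil _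
  have hR2 : (R : ℝ) ≤ (n d : ℝ) ^ (θ + 3 * e) + 1 :=
    (Nat.ceil_lt_add_one (by positivity)).le
  have hD2 : (D : ℝ) ≤ 4 * ((n d : ℝ) * hi) + 1 + 1 :=
    (Nat.ceil_lt_add_one (by positivity)).le
  have hnlo : (n d : ℝ) * lo = (n d : ℝ) ^ (1 - κ ^ 2 - e) := by
    rw [hlodef, hnmul]; congr 1; ring
  have hnhi : (n d : ℝ) * hi = (n d : ℝ) ^ (1 - κ ^ 2) * (n d : ℝ) ^ e := by
    rw [hhidef, hnmul, hpow]; congr 1; ring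
  refine le_trans ?_ (key.trans (add_le_add (add_le_add ?_ le_rfl) ?_))
  · refine measure_mono fun ω hω hout => hω ?_
    obtain ⟨c1, c2, c3, c4⟩ := cost_bounds (A := (n d : ℝ) ^ e) (X := (n d : ℝ) ^ (1 - κ ^ 2))
      (Y := (n d : ℝ) ^ θ) (d := d) (m := (n d).size) (D := D) (R := R) (n := n d) hA
      (Real.one_le_rpow hn1 (by linarith)) (Real.one_le_rpow hn1 hθ) (Nat.cast_nonneg _) hdA
      (Nat.cast_nonneg _) hmA (Nat.cast_nonneg _) (by rw [← hnhi]; linarith)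
      (by
        rw [hpk, hpow]
        push_cast
        exact hR2) hn1
    rw [hpk, hpow, hpow] at c1
    rw [hpk, hpow, hnmul] at c2
    rw [hpk, hnmul] at c3
    rw [hpk, hpow] at c4
    have hA8 : (n d : ℝ) ^ (-e) ≤ 1 / 8 := by
      rw [Real.rpow_neg hn.le, inv_eq_one_div]
      exact one_div_le_one_div_of_le (by norm_num) (by linarith)
    have hlow : (n d : ℝ) ^ (1 - κ ^ 2 - 2 * e) ≤ n d * lo / 8 := by
      have e1 : (n d : ℝ) ^ (1 - κ ^ 2 - 2 * e) = (n d * lo) * (n d : ℝ) ^ (-e) := by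
        rw [hnlo, hpow]; congr 1; ring
      rw [e1]
      have : 0 < n d * lo := by positivity
      nlinarith
    refine hout.mono ?_ ?_ ?_ ?_ ?_ hlow ?_
    · rw [Store.roundCost]
      push_cast
      refine c1.trans (le_of_eq ?_)
      congr 1
    · have e1 : (n d : ℝ) ^ (2 - κ ^ 2 - 2 * e) = n d * (n d : ℝ) ^ (1 - κ ^ 2 - 2 * e) := by
        rw [hnmul]; congr 1; ring
      rw [e1]
      gcongr
    · push_cast
      refine c2.trans (le_of_eq ?_)
      congr 1; push_cast; ring
    · calc (n d : ℝ) ^ (1 - e) ≤ (n d : ℝ) ^ (1 : ℝ) :=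
            Real.rpow_le_rpow_of_exponent_le hn1 (by linarith)
        _ = _ := Real.rpow_one _
    · push_cast
      refine c3.trans (le_of_eq ?_)
      congr 1
    · push_cast
      refine c4.trans (le_of_eq ?_)
      congr 1
  · refine (not_typical_le hd hn4' hq hγ1 (by positivity) ?_ (hconst (q d) hq)).trans
      (ENNReal.ofReal_le_ofReal ?_)
    · exact fun p hp => ⟨hlo p hp, hhi p hp _ le_rfl⟩
    · rw [hnmul, hnlo]
      norm_num
  · refine ENNReal.ofReal_le_ofReal (Real.exp_le_exp.2 (neg_le_neg ?_))
    have e1 : (n d : ℝ) * (n d : ℝ) ^ (-θ - 2 * e) / 128 / n d =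
        (n d : ℝ) ^ (-θ - 2 * e) / 128 := by field_simp
    rw [e1]
    calc (n d : ℝ) ^ e / 128 = (n d : ℝ) ^ (θ + 3 * e) * ((n d : ℝ) ^ (-θ - 2 * e) / 128) := by
          rw [← mul_div_assoc, hpow]; congr 2; ring
      _ ≤ _ := by gcongr

/-! ### Choice of the starts and the resulting exponents -/

namespace Sparse

variable {n : ℕ → ℕ} [∀ d, NeZero (n d)] {μ : ℕ → ℝ} {κ γ : ℝ} {q : ∀ d, E d}

/-- With probability tending to one, the outcome has the exponents of the theorem up to `ε`, with
query exponent `ρ`. -/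
def WithHighProbability (n : ℕ → ℕ) [∀ d, NeZero (n d)] (μ : ℕ → ℝ) (κ γ : ℝ) (q : ∀ d, E d)
    (star : ∀ d, Fin (n d)) (ρ ε : ℝ) : Prop :=
  Tendsto (fun d => instanceLaw (star d) (q d) γ {ω | ¬ Outcome (κ * μ d) γ (q d) (star d)
    ((n d : ℝ) ^ (ρ + ε)) ((n d : ℝ) ^ (2 - κ ^ 2 - ε)) ((n d : ℝ) ^ (2 - κ ^ 2 + ε))
    ((n d : ℝ) ^ (1 - ε)) ((n d : ℝ) ^ (1 + ε))
    ((n d : ℝ) ^ (1 - κ ^ 2 - ε)) ((n d : ℝ) ^ (1 - κ ^ 2 + ε)) ω}) atTop (𝓝 0)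

lemma withHighProbability_of_le (h : Sparse n μ) {star : ∀ d, Fin (n d)} {e ρ ρ' ε : ℝ} (he : 0 < e)
    (hρ : ρ' + 9 * e ≤ ρ + ε) (hε : 4 * e ≤ ε)
    (H : Tendsto (fun d => instanceLaw (star d) (q d) γ {ω | ¬ Outcome (κ * μ d) γ (q d) (star d)
      ((n d : ℝ) ^ (ρ' + 9 * e)) ((n d : ℝ) ^ (2 - κ ^ 2 - 2 * e))
      ((n d : ℝ) ^ (2 - κ ^ 2 + 4 * e)) ((n d : ℝ) ^ (1 - e)) ((n d : ℝ) ^ (1 + 2 * e))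
      ((n d : ℝ) ^ (1 - κ ^ 2 - 2 * e)) ((n d : ℝ) ^ (1 - κ ^ 2 + 4 * e)) ω}) atTop (𝓝 0)) :
    WithHighProbability n μ κ γ q star ρ ε := by
  refine tendsto_measure_of_le H (Eventually.of_forall fun d => measure_mono fun ω hω hout => hω ?_)
  have hn : (1 : ℝ) ≤ n d := by exact_mod_cast h.pos d
  refine hout.mono ?_ ?_ ?_ ?_ ?_ ?_ ?_ <;>
    exact Real.rpow_le_rpow_of_exponent_le hn (by linarith)

/-- Starts at neighbors of the planted point suffice for a query exponent above one. -/
lemma withHighProbability_of_one_le (h : Sparse n μ) (hκ0 : 0 < κ) (hκ1 : κ < 1) (hγ0 : 0 < γ)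
    (hγ1 : γ < 1) (hq : ∀ᶠ d in atTop, ‖q d‖ = 1) (star : ∀ d, Fin (n d)) {ρ ε : ℝ}
    (hρ : 1 ≤ ρ) (hε : 0 < ε) : WithHighProbability n μ κ γ q star ρ ε := by
  classical
  obtain ⟨e, he, he1, he2⟩ : ∃ e > 0, e < 1 - κ ^ 2 ∧ e ≤ ε / 9 := by
    have h1 : 0 < 1 - κ ^ 2 := by nlinarith
    exact ⟨min ((1 - κ ^ 2) / 2) (ε / 9), by positivity,
      (min_le_left _ _).trans_lt (by linarith), min_le_right _ _⟩
  have H := h.tendsto_outcome hκ0 (by nlinarith : γ ^ 2 ≤ 1) (half_pos hγ0) (half_lt_self hγ0) he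
    (by linarith) (sq_nonneg κ) hq star
    (fun d s => {x | s ≠ star d ∧ κ * μ d ≤ ⟪x s, x (star d)⟫})
    (fun d s => by
      rw [Set.ofPred_and]
      exact (MeasurableSet.const _).inter (measurableSet_le_inner _ _ _))
    (Eventually.of_forall fun d x s hs D N hQ ω k => loopReturns_of_nbr hQ hs.1 hs.2 ω k) ?_
  · refine h.withHighProbability_of_le (ρ' := κ ^ 2 + (1 - κ ^ 2)) he (by linarith) (by linarith) H
  · refine tendsto_measure_of_le tendsto_const_nhds ?_
    -- Here the event of few good starts is empty: the lower bound on the degree of `star` is part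
    -- of being typical.
    filter_upwards [h.le_rpow he 1] with d hd
    rw [nonpos_iff_eq_zero, ← measure_empty (μ := dataLaw (star d) (q d) γ)]
    congr 1
    ext x
    simp only [Set.mem_ofPred_eq, Set.mem_empty_iff_false, iff_false, not_and, not_lt]
    intro hx
    have hn : (0 : ℝ) < n d := by exact_mod_cast h.pos d
    have h1 := hx.deg_lo (star d)
    have h2 : deg (κ * μ d) (star d) x (star d) ≤
        (Finset.univ.filter fun s => s ≠ star d ∧ κ * μ d ≤ ⟪x s, x (star d)⟫).card := by
      refine Finset.card_le_card fun s hs => ?_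
      simp only [others, Finset.mem_filter, Finset.mem_univ, true_and] at hs ⊢
      exact ⟨hs.1.1, by rw [real_inner_comm]; exact hs.2⟩
    have h3 : ((n d : ℝ) ^ (-κ ^ 2 - 2 * e)) ≤ (n d : ℝ) ^ (-κ ^ 2 - e) :=
      Real.rpow_le_rpow_of_exponent_le (by exact_mod_cast h.pos d) (by linarith)
    have h4 : ((deg (κ * μ d) (star d) x (star d) : ℕ) : ℝ) ≤
        ((Finset.univ.filter fun s => s ≠ star d ∧ κ * μ d ≤ ⟪x s, x (star d)⟫).card : ℝ) := by
      exact_mod_cast h2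
    have h5 : (n d : ℝ) * (n d : ℝ) ^ (-κ ^ 2 - 2 * e) ≤ n d * (n d : ℝ) ^ (-κ ^ 2 - e) := by
      gcongr
    have h6 : 0 < (n d : ℝ) * (n d : ℝ) ^ (-κ ^ 2 - 2 * e) := by positivity
    refine le_trans ?_ (h1.le.trans (h4.trans (le_of_eq (by congr))))
    linarith

/-- Starts at distance two from the planted point: the exponent `ρ` for a level `b`. -/
lemma withHighProbability_of_lt_one (h : Sparse n μ) (hκ0 : 0 < κ) (hγ0 : 0 < γ)
    (hγ1 : γ < 1) (hq : ∀ᶠ d in atTop, ‖q d‖ = 1) (star : ∀ d, Fin (n d)) {b₁ b₂ ρ ε : ℝ}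
    (hb₁ : 0 < b₁) (hb₁' : 1 - κ ^ 2 < b₁ ^ 2) (hb : b₁ < b₂) (hb₂ : γ * b₂ ≤ κ) (hκ1 : κ < 1)
    (hρ1 : b₂ ^ 2 + (κ - γ * b₂) ^ 2 / (1 - γ ^ 2) < 1)
    (hρ : b₂ ^ 2 + (κ - γ * b₂) ^ 2 / (1 - γ ^ 2) < ρ + ε) (hε : 0 < ε) :
    WithHighProbability n μ κ γ q star ρ ε := by
  classical
  set r := b₂ ^ 2 + (κ - γ * b₂) ^ 2 / (1 - γ ^ 2) with hr
  have hg : 0 < 1 - γ ^ 2 := by nlinarith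
  have hr0 : b₂ ^ 2 ≤ r := by
    have : 0 ≤ (κ - γ * b₂) ^ 2 / (1 - γ ^ 2) := by positivity
    linarith
  -- Bounds by role: `1 - r` makes the expected number of suitable `j` grow, `(ρ + ε - r)/9` and
  -- `ε/4` keep the cost exponents, `b₁²/2` and `(b₁² - (1-κ²))/3` make bad pairs and bad triples
  -- negligible, and `1 - κ²` makes degrees grow.
  obtain ⟨e, he, he1, he2, he3, he4, he5, he6⟩ : ∃ e > 0, e < 1 - r ∧ e < (ρ + ε - r) / 9 ∧
      e < b₁ ^ 2 / 2 ∧ e < (b₁ ^ 2 - (1 - κ ^ 2)) / 3 ∧ e < ε / 4 ∧ e < 1 - κ ^ 2 := by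
    have : ∀ᶠ e : ℝ in 𝓝[>] 0, 0 < e ∧ e < 1 - r ∧ e < (ρ + ε - r) / 9 ∧
      e < b₁ ^ 2 / 2 ∧ e < (b₁ ^ 2 - (1 - κ ^ 2)) / 3 ∧ e < ε / 4 ∧ e < 1 - κ ^ 2 := by
      have hlt : ∀ {a : ℝ}, 0 < a → ∀ᶠ e : ℝ in 𝓝[>] 0, e < a := fun ha =>
        nhdsWithin_le_nhds (gt_mem_nhds ha)
      exact (eventually_mem_nhdsWithin : ∀ᶠ e : ℝ in 𝓝[>] 0, e ∈ Set.Ioi 0).and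
        ((hlt (by linarith)).and ((hlt (by linarith)).and ((hlt (by positivity)).and
          ((hlt (by linarith)).and ((hlt (by linarith)).and (hlt (by nlinarith)))))))
    exact this.exists
  obtain ⟨η', hη', hW⟩ := h.wedge_le hκ0 hb₁.le he
  have hw := h.le_wedge_of_inner_eq hγ0.le hγ1 (hb₁.trans hb).le hb₂ he
  have H := h.tendsto_outcome (η := min η' (γ / 2)) (θ := r - 1 + κ ^ 2) hκ0
    (by nlinarith : γ ^ 2 ≤ 1) (by positivity) ((min_le_right _ _).trans_lt (half_lt_self hγ0)) he
    (by linarith) (by nlinarith) hq star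
    (fun d s => {x | SecondStart (κ * μ d) (b₁ * μ d) (b₂ * μ d) (star d) (q d) x s})
    (fun d s => measurableSet_secondStart s) ?_ ?_
  · refine h.withHighProbability_of_le (ρ' := r - 1 + κ ^ 2 + (1 - κ ^ 2)) he (by linarith) (by linarith) H
  · filter_upwards [h.le_mu_mul_sqrt (one_div_pos.2 (sub_pos.2 hb)), eventually_gt_atTop 0]
      with d h1 hd x s hs D N hQ ω k
    refine loopReturns_of_secondStart hQ ?_ hs ω k
    have hd1 : (1 : ℝ) ≤ d := by exact_mod_cast hd
    have h2 : √(d : ℝ) ≤ d := Real.sqrt_le_self_iff.2 (Or.inr hd1)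
    have h3 : 1 ≤ √(d : ℝ) := Real.one_le_sqrt.2 hd1
    rw [div_le_iff₀ (sub_pos.2 hb)] at h1
    have h4 : 0 < μ d * (b₂ - b₁) := by
      by_contra! hle
      nlinarith
    -- Since `μ√d → ∞`, the two levels are further apart than the threshold `1/d` for a move.
    have h5 : 1 / (d : ℝ) ≤ μ d * (b₂ - b₁) := by
      rw [div_le_iff₀ (by linarith)]
      nlinarith
    linarith
  · have t : Tendsto (fun d => ENNReal.ofReal (Real.exp (-((n d : ℝ) ^ (1 - r - e) / 8)) +
        256 * (n d : ℝ) ^ (-b₁ ^ 2 + 2 * e) + 256 * (n d : ℝ) ^ (1 - κ ^ 2 - b₁ ^ 2 + 3 * e)))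
        atTop (𝓝 0) := by
      refine tendsto_ofReal_zero ?_
      have := ((h.tendsto_exp_neg_rpow (a := 1 - r - e) (c := 8) (by linarith) (by norm_num)).add
        (h.tendsto_rpow_neg (x := -b₁ ^ 2 + 2 * e) (by linarith) 256)).add
        (h.tendsto_rpow_neg (x := 1 - κ ^ 2 - b₁ ^ 2 + 3 * e) (by linarith) 256)
      simpa using this
    refine tendsto_measure_of_le t ?_
    filter_upwards [hq, hW, hw, h.cap_le hκ0.le he, h.mu_pos, eventually_ge_atTop 2,
      h.le_rpow one_pos 4] with d hq hW hw hcap hμ hd hn4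
    have hn : (0 : ℝ) < n d := by exact_mod_cast h.pos d
    rw [Real.rpow_one] at hn4
    have hn4' : 4 ≤ n d := by exact_mod_cast hn4
    have hpow : ∀ a b : ℝ, (n d : ℝ) ^ a * (n d : ℝ) ^ b = (n d : ℝ) ^ (a + b) := fun a b =>
      (Real.rpow_add hn a b).symm
    have hdiv : ∀ a b : ℝ, (n d : ℝ) ^ a / (n d : ℝ) ^ b = (n d : ℝ) ^ (a - b) := fun a b =>
      (Real.rpow_sub hn a b).symm
    have hnmul : ∀ a : ℝ, (n d : ℝ) * (n d : ℝ) ^ a = (n d : ℝ) ^ (1 + a) := fun a => by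
      rw [Real.rpow_add hn, Real.rpow_one]
    have key := few_secondStart_le (star := star d) (η := min η' (γ / 2)) hd hn4' hq
      (by nlinarith : γ ^ 2 ≤ 1) (lo := (n d : ℝ) ^ (-κ ^ 2 - e)) (by positivity)
      (fun p hp => hcap p hp _ le_rfl) (by positivity)
      (fun p hp hpq => hW p (q d) hp hq (hpq.trans (min_le_left _ _))) (by positivity)
      (fun p hp hpq => hw (q d) p hq hp hpq) (by positivity)
      (mul_le_mul_of_nonneg_right hb.le hμ.le)
    have e1 : (n d : ℝ) * (n d : ℝ) ^ (-r - e) * (n d : ℝ) ^ (-κ ^ 2 - e) =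
        (n d : ℝ) ^ (-(r - 1 + κ ^ 2) - 2 * e) := by
      rw [hnmul, hpow]; congr 1; ring
    rw [e1] at key
    refine key.trans (ENNReal.ofReal_le_ofReal (le_of_eq ?_))
    congr 1
    · congr 1
      · rw [hnmul]; congr 4; ring
      · rw [mul_div_assoc, hdiv]; congr 2; ring
    · rw [mul_div_assoc, mul_assoc, hdiv, hnmul, hpow]; congr 2; ring

/-- The outcome with query exponent `ρ_q`. -/
lemma withHighProbability (h : Sparse n μ) (hκ : √(γ ^ 2 / (1 + γ ^ 2)) < κ) (hκ1 : κ < 1)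
    (hγ0 : 0 < γ) (hγ1 : γ < 1) (hq : ∀ᶠ d in atTop, ‖q d‖ = 1) (star : ∀ d, Fin (n d)) {ε : ℝ}
    (hε : 0 < ε) :
    WithHighProbability n μ κ γ q star ((1 - 2 * γ * √(κ ^ 2 * (1 - κ ^ 2))) / (1 - γ ^ 2)) ε := by
  have hκ0 : 0 < κ := (Real.sqrt_nonneg _).trans_lt hκ
  have hg : 0 < 1 - γ ^ 2 := by nlinarith
  rcases le_or_gt 1 ((1 - 2 * γ * √(κ ^ 2 * (1 - κ ^ 2))) / (1 - γ ^ 2)) with hρ | hρ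
  · exact h.withHighProbability_of_one_le hκ0 hκ1 hγ0 hγ1 hq star hρ hε
  set ρ := (1 - 2 * γ * √(κ ^ 2 * (1 - κ ^ 2))) / (1 - γ ^ 2) with hρdef
  set b := √(1 - κ ^ 2) with hbdef
  have hκ2 : 0 < 1 - κ ^ 2 := by nlinarith
  have hb0 : 0 < b := Real.sqrt_pos.2 hκ2
  have hb2 : b ^ 2 = 1 - κ ^ 2 := Real.sq_sqrt hκ2.le
  -- The lower bound on `κ` rearranges to `γ²(1 - κ²) < κ²`.
  have hγb : γ * b < κ := by
    have h1 : γ ^ 2 / (1 + γ ^ 2) < κ ^ 2 := by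
      rwa [Real.sqrt_lt' hκ0] at hκ
    rw [div_lt_iff₀ (by positivity)] at h1
    nlinarith
  have hρb : b ^ 2 + (κ - γ * b) ^ 2 / (1 - γ ^ 2) = ρ := by
    rw [hρdef, Real.sqrt_mul (sq_nonneg κ), Real.sqrt_sq hκ0.le, ← hbdef]
    field_simp
    linear_combination hb2
  have hlt : ∀ {f : ℝ → ℝ} {a : ℝ}, Continuous f → f b < a → ∀ᶠ x in 𝓝[>] b, f x < a :=
    fun hf ha => nhdsWithin_le_nhds (hf.continuousAt.eventually (gt_mem_nhds ha))
  have hcont : Continuous fun x : ℝ => x ^ 2 + (κ - γ * x) ^ 2 / (1 - γ ^ 2) := by fun_prop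
  -- The level must exceed `b` strictly, so that further high neighbors are rare; by continuity the
  -- exponent stays below `1` and within `ε` of `ρ`.
  have ev : ∀ᶠ x : ℝ in 𝓝[>] b, b < x ∧ γ * x < κ ∧
      x ^ 2 + (κ - γ * x) ^ 2 / (1 - γ ^ 2) < 1 ∧
      x ^ 2 + (κ - γ * x) ^ 2 / (1 - γ ^ 2) < ρ + ε :=
    (eventually_mem_nhdsWithin : ∀ᶠ x : ℝ in 𝓝[>] b, x ∈ Set.Ioi b).and
      ((hlt (continuous_const_mul γ) hγb).and ((hlt hcont (by simpa only [hρb] using hρ)).and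
        (hlt hcont (by simp only [hρb]; linarith))))
  obtain ⟨b₂, h1, h2, h3, h4⟩ := ev.exists
  -- The midpoint `b₁` lies strictly above `b` as well: other neighbors are excluded above `b₁`,
  -- while `j` has level `b₂`.
  refine h.withHighProbability_of_lt_one (b₁ := (b + b₂) / 2) (b₂ := b₂) hκ0 hγ0 hγ1 hq star (by linarith)
    ?_ (by linarith) h2.le hκ1 h3 h4 hε
  nlinarith

end Sparse

end NNG

/-! ### The theorem and its trade-off -/

theorem mainTheorem3 (c γ κ : ℝ) (hc : 1 < c) (hγ : γ = 1 - 1 / c ^ 2)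
    (hκ₀ : √(γ ^ 2 / (1 + γ ^ 2)) < κ) (hκ₁ : κ < 1)
    (n : ℕ → ℕ) [∀ d, NeZero (n d)] (μ : ℕ → ℝ)
    (hμ : ∀ᶠ d in atTop, (n d : ℝ) = 1 / NNG.capVolume d (μ d))
    (hsparse : (fun d => Real.log (n d)) =o[atTop] (fun d : ℕ => (d : ℝ)))
    (hdim : (fun d : ℕ => Real.log d) =o[atTop] (fun d => Real.log (n d)))
    (q : ∀ d, NNG.E d) (hq : ∀ᶠ d in atTop, ‖q d‖ = 1) (star : ∀ d, Fin (n d)) :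
    -- costs
    (∀ ε : ℝ, 0 < ε → Tendsto (fun d => NNG.instanceLaw (star d) (q d) γ {ω |
      ¬ ((NNG.Store.build (κ * μ d) ω.1).Represents (κ * μ d) (Finset.range (n d))
            (NNG.labelled ω.1)
        ∧ (NNG.Store.build (κ * μ d) ω.1).QueryReturns (q d) γ (fun k => (ω.2 k : ℕ)) (star d)
            ((n d : ℝ) ^ ((1 - 2 * γ * √(κ ^ 2 * (1 - κ ^ 2))) / (1 - γ ^ 2) + ε))
        ∧ ((NNG.Store.build (κ * μ d) ω.1).space : ℝ) ∈
            Set.Icc ((n d : ℝ) ^ (2 - κ ^ 2 - ε)) ((n d : ℝ) ^ (2 - κ ^ 2 + ε))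
        ∧ (∀ p : NNG.E d, ‖p‖ = 1 →
            (((NNG.Store.build (κ * μ d) ω.1).insert (κ * μ d) p).val.Represents (κ * μ d)
              (Finset.range (n d + 1)) (Function.update (NNG.labelled ω.1) (n d) p)
            ∧ (((NNG.Store.build (κ * μ d) ω.1).insert (κ * μ d) p).cost : ℝ) ∈
              Set.Icc ((n d : ℝ) ^ (1 - ε)) ((n d : ℝ) ^ (1 + ε))))
        ∧ (∀ j : Fin (n d),
            (((NNG.Store.build (κ * μ d) ω.1).delete j).val.Represents (κ * μ d)
              ((Finset.range (n d)).erase j) (NNG.labelled ω.1)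
            ∧ (((NNG.Store.build (κ * μ d) ω.1).delete j).cost : ℝ) ∈
              Set.Icc ((n d : ℝ) ^ (1 - κ ^ 2 - ε)) ((n d : ℝ) ^ (1 - κ ^ 2 + ε)))))})
      atTop (𝓝 0))
    -- the exponents of query time and space lie on the boundary of the trade-off region
    ∧ (∀ ρq ρs : ℝ, ρq = (1 - 2 * γ * √(κ ^ 2 * (1 - κ ^ 2))) / (1 - γ ^ 2) →
        1 + ρs = 2 - κ ^ 2 →
        (2 * c ^ 2 - 1) * ρq + 2 * c ^ 2 * (c ^ 2 - 1) * √(ρs * (1 - ρs)) = c ^ 4)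
    -- all exponents in that region with this space are achieved
    ∧ (∀ ρq ρs : ℝ, 1 + ρs = 2 - κ ^ 2 →
        (2 * c ^ 2 - 1) * ρq + 2 * c ^ 2 * (c ^ 2 - 1) * √(ρs * (1 - ρs)) ≥ c ^ 4 →
        ∀ ε : ℝ, 0 < ε → Tendsto (fun d => NNG.instanceLaw (star d) (q d) γ {ω |
          ¬ ((NNG.Store.build (κ * μ d) ω.1).QueryReturns (q d) γ (fun k => (ω.2 k : ℕ)) (star d)
              ((n d : ℝ) ^ (ρq + ε))
            ∧ ((NNG.Store.build (κ * μ d) ω.1).space : ℝ) ≤ (n d : ℝ) ^ (1 + ρs + ε))})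
          atTop (𝓝 0)) := by
  have hc2 : 1 < c ^ 2 := by nlinarith
  have hγ0 : 0 < γ := by
    rw [hγ, sub_pos, div_lt_one (by linarith)]
    exact hc2
  have hγ1 : γ < 1 := by
    rw [hγ]
    have : 0 < 1 / c ^ 2 := by positivity
    linarith
  have h : NNG.Sparse n μ := ⟨fun d => Nat.pos_of_neZero _, hμ, hsparse, hdim⟩
  have main := fun (ε : ℝ) (hε : 0 < ε) => h.withHighProbability hκ₀ hκ₁ hγ0 hγ1 hq star hε
  have hγc : γ * c ^ 2 = c ^ 2 - 1 := by
    rw [hγ]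
    field_simp
  have hg : 0 < 1 - γ ^ 2 := by nlinarith
  -- The identity is affine in `x = √(κ²(1-κ²))`: the constant terms agree as `(1 - γ²)c⁴ = 2c² -
  -- 1`, and the terms in `x` cancel as `γc² = c² - 1`.
  have tradeoff : ∀ x : ℝ, (2 * c ^ 2 - 1) * ((1 - 2 * γ * x) / (1 - γ ^ 2)) +
      2 * c ^ 2 * (c ^ 2 - 1) * x = c ^ 4 := by
    intro x
    have h1 : (1 - γ ^ 2) * c ^ 4 = 2 * c ^ 2 - 1 := by
      linear_combination (-(γ * c ^ 2 + (c ^ 2 - 1))) * hγc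
    rw [← h1, mul_right_comm, mul_div_cancel₀ _ hg.ne']
    linear_combination (-2 * x * c ^ 2) * hγc
  have hs : ∀ ρs : ℝ, 1 + ρs = 2 - κ ^ 2 → ρs * (1 - ρs) = κ ^ 2 * (1 - κ ^ 2) := by
    intro ρs h1
    obtain rfl : ρs = 1 - κ ^ 2 := by linarith
    ring
  refine ⟨main, ?_, ?_⟩
  · rintro ρq ρs rfl h1
    rw [hs ρs h1]
    exact tradeoff _
  · intro ρq ρs h1 h2 ε hε
    have h3 := tradeoff √(κ ^ 2 * (1 - κ ^ 2))
    rw [hs ρs h1] at h2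
    -- As `2c² - 1 > 0`, the inequality just says that `ρq` is at least the exponent on the
    -- boundary, so the first part with a larger time bound suffices.
    have hρ : (1 - 2 * γ * √(κ ^ 2 * (1 - κ ^ 2))) / (1 - γ ^ 2) ≤ ρq :=
      le_of_mul_le_mul_left (by linarith) (by linarith : 0 < 2 * c ^ 2 - 1)
    refine NNG.tendsto_measure_of_le (main ε hε)
      (Eventually.of_forall fun d => measure_mono fun ω hω hout => hω ?_)
    have hn : (1 : ℝ) ≤ n d := by exact_mod_cast h.pos d
    refine ⟨hout.2.1.mono (Real.rpow_le_rpow_of_exponent_le hn (by linarith)), ?_⟩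
    rw [h1]
    exact hout.2.2.1.2
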